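/- Let $\mathcal S\subset\{-1,0,1\}^2\setminus\{(0,0)\}$ be the step set of a non-singular walk in the quarter plane, i.e. $\mathcal S$ is not contained in any closed half-plane bounded by a line through the origin, and let $0<z<1/|\mathcal S|$. Let $q(i,j;n)$ be the number of walks of length $n$ with steps in $\mathcal S$ that start at $(0,0)$, stay in $\mathbf Z_+^2$ and end at $(i,j)$, and put $Q(x,y)=\sum_{i,j,n\ge 0}q(i,j;n)x^iy^jz^n$. Let $$K(x,y)=xyz\Big[\sum_{(i,j)\in\mathcal S}x^iy^j-\frac1z\Big]=a(x)y^2+b(x)y+c(x)=\tilde a(y)x^2+\tilde b(y)x+\tilde c(y)$$ and $d=b^2-4ac$, $\tilde d=\tilde b^2-4\tilde a\tilde c$. The four branch points $x_1,x_2,x_3,x_4$ are the roots of $d$ (with $x_4=\infty$ if $d$ has degree three); they are real and numbered so that $x_1<x_2$ are those of modulus less than one, $x_3$ is the smallest root in $]1,\infty[$ and $x_4$ is the remaining one. The points $y_1,\dots,y_4$ are defined in the same way from $\tilde d$. Let $X(y_1)=-\tilde b(y_1)/(2\tilde a(y_1))$ (which is $\infty$ if $\tilde a(y_1)=0$), and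 $$\omega_1=i\int_{x_1}^{x_2}\frac{dx}{\sqrt{-d(x)}},\qquad \omega_2=\int_{x_2}^{x_3}\frac{dx}{\sqrt{d(x)}},\qquad \omega_3=\int_{X(y_1)}^{x_1}\frac{dx}{\sqrt{d(x)}},$$ where the last integral is over the arc of the real projective line described in the increasing direction from $X(y_1)$ to $x_1$ (through $\infty$ if $X(y_1)>x_1$). Let $\wp$ be the Weierstrass function with periods $\omega_1,\omega_2$, let $g_x(t)=d''(x_4)/6+d'(x_4)/(t-x_4)$ if $x_4\neq\infty$ and $g_x(t)=d''(0)/6+d'''(0)t/6$ if $x_4=\infty$, let $g_y$ be defined in the same way from $\tilde d$ and $y_4$, and put, for $\omega\in\mathbf C$, $$x(\omega)=g_x^{-1}(\wp(\omega)),\qquad y(\omega)=g_y^{-1}(\wp(\omega-\omega_3/2)).$$ Let $\Delta_x=\{\omega\in\omega_1\mathbf R+\,]0,\omega_2[\;:\;|x(\omega)|<1\}$, $\Delta_y=\{\omega\in\omega_1\mathbf R+\omega_3/2+\,]0,\omega_2[\;:\;|y(\omega)|<1\}$ and $\Delta=\Delta_x\cup\Delta_y$. Then $\Delta$ is a simply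 connected domain in $\mathbf C$, and the functions $$r_x(\omega)=\begin{cases}K(x(\omega),0)Q(x(\omega),0)&\text{if }\omega\in\Delta_x,\\-K(0,y(\omega))Q(0,y(\omega))+K(0,0)Q(0,0)+x(\omega)y(\omega)&\text{if }\omega\in\Delta_y,\end{cases}$$ $$r_y(\omega)=\begin{cases}K(0,y(\omega))Q(0,y(\omega))&\text{if }\omega\in\Delta_y,\\-K(x(\omega),0)Q(x(\omega),0)+K(0,0)Q(0,0)+x(\omega)y(\omega)&\text{if }\omega\in\Delta_x,\end{cases}$$ are well defined (the two expressions agree on $\Delta_x\cap\Delta_y$) and meromorphic on $\Delta$. Furthermore $$r_x(\omega)+r_y(\omega)-K(0,0)Q(0,0)-x(\omega)y(\omega)=0,\qquad\forall\,\omega\in\Delta,$$ as an identity between meromorphic functions. -/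

import Mathlib

open Polynomial MeasureTheory

noncomputable section

namespace QuarterPlane

/-! ### Walks in the quarter plane and their generating function -/

/-- The walks of length `n` with steps in `S`, started at the origin, staying in the quarter plane
and ending at `(i, j)`; a walk is given by the sequence of its steps. -/
def walks (S : Finset (ℤ × ℤ)) (i j n : ℕ) : Finset (Fin n → ℤ × ℤ) :=
  (Fintype.piFinset fun _ => S).filter fun w =>
    (∀ m : Fin (n + 1),
      0 ≤ (∑ k ∈ Finset.univ.filter (fun k : Fin n => k.val < m.val), w k).1 ∧
      0 ≤ (∑ k ∈ Finset.univ.filter (fun k : Fin n => k.val < m.val), w k).2) ∧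
    ∑ k, w k = ((i : ℤ), (j : ℤ))

/-- The generating function `Q(x, y) = ∑_{i, j, n ≥ 0} q(i, j; n) x ^ i y ^ j z ^ n`. -/
def Q (S : Finset (ℤ × ℤ)) (z : ℝ) (x y : ℂ) : ℂ :=
  ∑' p : ℕ × ℕ × ℕ,
    ((walks S p.1 p.2.1 p.2.2).card : ℂ) * x ^ p.1 * y ^ p.2.1 * (z : ℂ) ^ p.2.2

/-- The kernel `K(x, y) = x y z (∑_{(i, j) ∈ S} x ^ i y ^ j - 1 / z)`, written as a polynomial. -/
def K (S : Finset (ℤ × ℤ)) (z : ℝ) (x y : ℂ) : ℂ :=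
  (z : ℂ) * ∑ s ∈ S, x ^ (s.1 + 1).toNat * y ^ (s.2 + 1).toNat - x * y

/-! ### The coefficients and the discriminants of the kernel

`K(x, y) = a(x) y² + b(x) y + c(x) = ã(y) x² + b̃(y) x + c̃(y)`. -/

/-- The polynomial `a`. -/
def a (S : Finset (ℤ × ℤ)) (z : ℝ) : ℝ[X] :=
  C z * ∑ s ∈ S with s.2 = 1, X ^ (s.1 + 1).toNat

/-- The polynomial `b`. -/
def b (S : Finset (ℤ × ℤ)) (z : ℝ) : ℝ[X] :=
  -X + C z * ∑ s ∈ S with s.2 = 0, X ^ (s.1 + 1).toNat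

/-- The polynomial `c`. -/
def c (S : Finset (ℤ × ℤ)) (z : ℝ) : ℝ[X] :=
  C z * ∑ s ∈ S with s.2 = -1, X ^ (s.1 + 1).toNat

/-- The polynomial `ã`. -/
def a' (S : Finset (ℤ × ℤ)) (z : ℝ) : ℝ[X] :=
  C z * ∑ s ∈ S with s.1 = 1, X ^ (s.2 + 1).toNat

/-- The polynomial `b̃`. -/
def b' (S : Finset (ℤ × ℤ)) (z : ℝ) : ℝ[X] :=
  -X + C z * ∑ s ∈ S with s.1 = 0, X ^ (s.2 + 1).toNat

/-- The polynomial `c̃`. -/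
def c' (S : Finset (ℤ × ℤ)) (z : ℝ) : ℝ[X] :=
  C z * ∑ s ∈ S with s.1 = -1, X ^ (s.2 + 1).toNat

/-- The discriminant `d = b² - 4 a c`. -/
def d (S : Finset (ℤ × ℤ)) (z : ℝ) : ℝ[X] := b S z ^ 2 - 4 * a S z * c S z

/-- The discriminant `d̃ = b̃² - 4 ã c̃`. -/
def d' (S : Finset (ℤ × ℤ)) (z : ℝ) : ℝ[X] := b' S z ^ 2 - 4 * a' S z * c' S z

/-! ### Branch points

The four branch points (roots of the discriminant `p`, one of which is `∞` when `p` has degree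
three) are real and numbered so that `t₁ < t₂` are those of modulus less than one, `t₃ > 1` is the
smallest root in `]1, ∞[`, and `t₄` is the remaining one. -/

/-- The branch point `t₁`. -/
def branch1 (p : ℝ[X]) : ℝ := sInf {t : ℝ | |t| < 1 ∧ p.eval t = 0}

/-- The branch point `t₂`. -/
def branch2 (p : ℝ[X]) : ℝ := sSup {t : ℝ | |t| < 1 ∧ p.eval t = 0}

/-- The branch point `t₃`. -/
def branch3 (p : ℝ[X]) : ℝ := sInf {t : ℝ | 1 < t ∧ p.eval t = 0}

open Classical in
/-- The branch point `t₄`: the root of modulus greater than one other than `t₃` if there is one,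
and `∞` otherwise. -/
def branch4 (p : ℝ[X]) : OnePoint ℝ :=
  if h : ∃ t : ℝ, 1 < |t| ∧ p.eval t = 0 ∧ t ≠ branch3 p then ((h.choose : ℝ) : OnePoint ℝ)
  else OnePoint.infty

/-! ### The periods -/

/-- `ω₁ = i ∫_{x₁}^{x₂} dx / √(-d(x))`. -/
def ω₁ (S : Finset (ℤ × ℤ)) (z : ℝ) : ℂ :=
  Complex.I * ((∫ t in (branch1 (d S z))..(branch2 (d S z)), 1 / √(-(d S z).eval t) : ℝ) : ℂ)

/-- `ω₂ = ∫_{x₂}^{x₃} dx / √(d(x))`. -/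
def ω₂ (S : Finset (ℤ × ℤ)) (z : ℝ) : ℝ :=
  ∫ t in (branch2 (d S z))..(branch3 (d S z)), 1 / √((d S z).eval t)

open Classical in
/-- The point `X(y₁) = -b̃(y₁) / (2 ã(y₁))` of the real projective line, i.e. the double root in `x`
of `K(x, y₁)`; it is `∞` if `ã(y₁) = 0`. -/
def Xy₁ (S : Finset (ℤ × ℤ)) (z : ℝ) : OnePoint ℝ :=
  if (a' S z).eval (branch1 (d' S z)) = 0 then OnePoint.infty
  else ((-(b' S z).eval (branch1 (d' S z)) / (2 * (a' S z).eval (branch1 (d' S z))) : ℝ) :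
    OnePoint ℝ)

open Classical in
/-- The arc of the real projective line (without the point `∞`) described by a point that moves
from `u` to `v` in the increasing direction, through `∞` if `v < u`. -/
def arc : OnePoint ℝ → ℝ → Set ℝ
  | OnePoint.infty, v => Set.Iio v
  | OnePoint.some u, v => if u ≤ v then Set.Ioo u v else Set.Ioi u ∪ Set.Iio v

/-- `ω₃ = ∫_{X(y₁)}^{x₁} dx / √(d(x))`. -/
def ω₃ (S : Finset (ℤ × ℤ)) (z : ℝ) : ℝ :=
  ∫ t in arc (Xy₁ S z) (branch1 (d S z)), 1 / √((d S z).eval t)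

/-! ### The uniformization -/

open Classical in
/-- The Weierstrass elliptic function with periods `w₁`, `w₂`, as a map to the Riemann sphere. -/
def wp (w₁ w₂ : ℂ) (ω : ℂ) : OnePoint ℂ :=
  if h : LinearIndependent ℝ ![w₁, w₂] then
    if ω ∈ (PeriodPair.mk w₁ w₂ h).lattice then OnePoint.infty
    else ((PeriodPair.weierstrassP (PeriodPair.mk w₁ w₂ h) ω : ℂ) : OnePoint ℂ)
  else OnePoint.infty

open Classical in
/-- The inverse, on the Riemann sphere, of the Möbius transformation
`g(t) = p''(t₄) / 6 + p'(t₄) / (t - t₄)` if `t₄ ≠ ∞`, and `g(t) = p''(0) / 6 + p'''(0) t / 6`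
if `t₄ = ∞`. -/
def gInv (p : ℝ[X]) : OnePoint ℝ → OnePoint ℂ → OnePoint ℂ
  | OnePoint.infty, OnePoint.infty => OnePoint.infty
  | OnePoint.infty, OnePoint.some u =>
      (((6 * u - ((derivative^[2] p).eval 0 : ℝ)) / ((derivative^[3] p).eval 0 : ℝ) : ℂ) :
        OnePoint ℂ)
  | OnePoint.some t₄, OnePoint.infty => (((t₄ : ℝ) : ℂ) : OnePoint ℂ)
  | OnePoint.some t₄, OnePoint.some u =>
      if u = (((derivative^[2] p).eval t₄ / 6 : ℝ) : ℂ) then OnePoint.infty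
      else ((t₄ + ((derivative p).eval t₄ : ℝ) / (u - ((derivative^[2] p).eval t₄ / 6 : ℝ)) : ℂ) :
        OnePoint ℂ)

/-- The coordinate `x(ω) = g_x⁻¹(℘(ω))` on the universal covering. -/
def x (S : Finset (ℤ × ℤ)) (z : ℝ) (ω : ℂ) : OnePoint ℂ :=
  gInv (d S z) (branch4 (d S z)) (wp (ω₁ S z) (ω₂ S z) ω)

/-- The coordinate `y(ω) = g_y⁻¹(℘(ω - ω₃ / 2))` on the universal covering. -/
def y (S : Finset (ℤ × ℤ)) (z : ℝ) (ω : ℂ) : OnePoint ℂ :=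
  gInv (d' S z) (branch4 (d' S z)) (wp (ω₁ S z) (ω₂ S z) (ω - ω₃ S z / 2))

/-- The value of a finite point of the Riemann sphere (and `0` at `∞`). -/
def val : OnePoint ℂ → ℂ
  | OnePoint.infty => 0
  | OnePoint.some u => u

/-- The meromorphic function `x(ω) y(ω)`. The normal form gives it the correct value where a zero
of one factor cancels a pole of the other (and the value `0` at its poles). -/
def xy (S : Finset (ℤ × ℤ)) (z : ℝ) (ω : ℂ) : ℂ :=
  toMeromorphicNFAt (fun w => val (x S z w) * val (y S z w)) ω ω

/-! ### The domains and the lifted functions -/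

/-- The strip `ω₁ ℝ + r + ]0, ω₂[`. -/
def strip (S : Finset (ℤ × ℤ)) (z r : ℝ) : Set ℂ :=
  {ω | ∃ s t : ℝ, 0 < t ∧ t < ω₂ S z ∧ ω = ω₁ S z * s + r + t}

/-- `Δ_x`: the part of `{|x(ω)| < 1}` in the strip `ω₁ ℝ + ]0, ω₂[`. -/
def Δx (S : Finset (ℤ × ℤ)) (z : ℝ) : Set ℂ :=
  {ω | ω ∈ strip S z 0 ∧ ∃ u : ℂ, x S z ω = (u : OnePoint ℂ) ∧ ‖u‖ < 1}

/-- `Δ_y`: the part of `{|y(ω)| < 1}` in the strip `ω₁ ℝ + ω₃ / 2 + ]0, ω₂[`. -/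
def Δy (S : Finset (ℤ × ℤ)) (z : ℝ) : Set ℂ :=
  {ω | ω ∈ strip S z (ω₃ S z / 2) ∧ ∃ u : ℂ, y S z ω = (u : OnePoint ℂ) ∧ ‖u‖ < 1}

/-- `Δ = Δ_x ∪ Δ_y`. -/
def Δ (S : Finset (ℤ × ℤ)) (z : ℝ) : Set ℂ := Δx S z ∪ Δy S z

/-- The lift `K(x(ω), 0) Q(x(ω), 0)`, used on `Δ_x`. -/
def liftX (S : Finset (ℤ × ℤ)) (z : ℝ) (ω : ℂ) : ℂ :=
  K S z (val (x S z ω)) 0 * Q S z (val (x S z ω)) 0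

/-- The lift `K(0, y(ω)) Q(0, y(ω))`, used on `Δ_y`. -/
def liftY (S : Finset (ℤ × ℤ)) (z : ℝ) (ω : ℂ) : ℂ :=
  K S z 0 (val (y S z ω)) * Q S z 0 (val (y S z ω))

open Classical in
/-- The function `r_x` on `Δ` (irrelevant outside `Δ`). -/
def rx (S : Finset (ℤ × ℤ)) (z : ℝ) (ω : ℂ) : ℂ :=
  if ω ∈ Δx S z then liftX S z ω else -liftY S z ω + K S z 0 0 * Q S z 0 0 + xy S z ω

open Classical in
/-- The function `r_y` on `Δ` (irrelevant outside `Δ`). -/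
def ry (S : Finset (ℤ × ℤ)) (z : ℝ) (ω : ℂ) : ℂ :=
  if ω ∈ Δy S z then liftY S z ω else -liftX S z ω + K S z 0 0 * Q S z 0 0 + xy S z ω

end QuarterPlane

end

/-!
Let `w i j` be the weight of the step `(i, j)`, which is `z` for the steps of the walk and `0`
otherwise, so that the kernel is `wker w` and its discriminants are `wdisc w` and
`wdisc fun i j => w j i`.

*The analytic input.* For `|x|, |y| ≤ 1` the generating function converges and satisfies
`K Q = K(x, 0) Q(x, 0) + K(0, y) Q(0, y) - K(0, 0) Q(0, 0) - x y` (`K_mul_Q`). Hence the two formulas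
for `r_x`, and those for `r_y`, agree at a point of `Δ_x ∩ Δ_y` as soon as `K(x(ω), y(ω)) = 0` there;
everything else about `r_x` and `r_y` is then immediate. What has to be shown is that the explicit
functions `x(ω)` and `y(ω)` parametrize the curve `K = 0`, and that `Δ` is simply connected.

*The uniformization of each coordinate.* Comparing `b` with `±2 √(a c)` on the real line locates the
branch points (`exists_isBranched`). The transformation `g_x` turns `4 d` into a Weierstrass cubic
whose three roots are the images of the finite branch points `x₁, x₂, x₃`. The integrals `ω₁, ω₂`
are the periods of this cubic, and a cubic with real roots of sum zero is determined by its two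
periods: the complete elliptic integral is strictly monotone in the modulus
(`IsRootTriple.eq_of_periods`). So the roots are the values of `℘` at the half-periods, and
`x'² = 4 d(x)`. The discriminants `d` and `d̃` have the same invariants `g₂, g₃`
(`quarticG2_transpose`, `quarticG3_transpose`), whence the same lattice serves for `y`
(`exists_isCoordinate`).

*The kernel vanishes.* By the definition of `ω₃` there is a point `ω₀` with `y(ω₀) = y₁` and
`x(ω₀) = X(y₁)`, so that `K` and its derivative `K_x` in `x` vanish at `ω₀` (`exists_thirdPeriod`).
There is a sign `σ` for which the three functions `K`, `x' - 2 σ K_y`, `y' + 2 σ K_x` of `ω` vanish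
at `ω₀`; they solve a homogeneous linear differential system, hence vanish identically
(`eventually_wker_eq_zero`, `exists_wker_eq_zero`). If `X(y₁) = ∞`, the same argument applies to
`1 / x` and to the reflected weights.

*The shape of the domains.* On `|x| = 1` the quotient `d(x) / x²` is never a nonpositive real, and
so `|x(ω)|` has nonzero derivative in the direction of the real axis wherever it equals `1`. With the
symmetries of `x`, this implies that each horizontal section of `Δ_x` is an interval whose midpoint is
`ω₂ / 2` and whose half-width depends continuously on the height (`IsTransversal.exists_zero`); the
same holds for `Δ_y`, with midpoint `ω₂ / 2 + ω₃ / 2`. As `K` has no zero with `|x| = |y| = 1`, it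
suffices to look at the height `W₁ / 2`, where `ω₁ = i W₁` and all quantities are real, to see that
the right end of each section of `Δ_x` lies in `Δ_y` (`overlap`). Therefore the sections of `Δ` are
intervals with continuous ends, and `Δ` is homeomorphic to a strip (`isSimplyConnected_between`).
-/

noncomputable section

namespace QuarterPlane

/-! ### The generating function and its functional equation -/

/-- The walks of length `n` with steps in `S` that start at the origin and stay in the quarter
plane, with no condition on the endpoint. -/
def quadrantWalks (S : Finset (ℤ × ℤ)) (n : ℕ) : Finset (Fin n → ℤ × ℤ) :=
  (Fintype.piFinset fun _ => S).filter fun w =>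
    ∀ m : Fin (n + 1),
      0 ≤ (∑ k ∈ Finset.univ.filter (fun k : Fin n => k.val < m.val), w k).1 ∧
      0 ≤ (∑ k ∈ Finset.univ.filter (fun k : Fin n => k.val < m.val), w k).2

lemma walks_eq_filter (S : Finset (ℤ × ℤ)) (i j n : ℕ) :
    walks S i j n = (quadrantWalks S n).filter fun w => ∑ k, w k = ((i : ℤ), (j : ℤ)) := by
  ext w
  simp [walks, quadrantWalks, and_assoc]

lemma sum_nonneg_of_mem_quadrantWalks {S : Finset (ℤ × ℤ)} {n : ℕ} {w : Fin n → ℤ × ℤ}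
    (hw : w ∈ quadrantWalks S n) : 0 ≤ (∑ k, w k).1 ∧ 0 ≤ (∑ k, w k).2 := by
  have h := (Finset.mem_filter.1 hw).2 (Fin.last n)
  simpa using h

lemma snoc_mem_quadrantWalks {S : Finset (ℤ × ℤ)} {n : ℕ} {w : Fin n → ℤ × ℤ} {s : ℤ × ℤ} :
    (Fin.snoc w s : Fin (n + 1) → ℤ × ℤ) ∈ quadrantWalks S (n + 1) ↔
      w ∈ quadrantWalks S n ∧ s ∈ S ∧ 0 ≤ (∑ k, w k + s).1 ∧ 0 ≤ (∑ k, w k + s).2 := by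
  have key : ∀ m : Fin (n + 1),
      ∑ k ∈ Finset.univ.filter (fun k : Fin (n + 1) => k.val < m.castSucc.val),
        (Fin.snoc w s : Fin (n + 1) → ℤ × ℤ) k =
      ∑ k ∈ Finset.univ.filter (fun k : Fin n => k.val < m.val), w k := by
    intro m
    rw [Finset.sum_filter, Finset.sum_filter, Fin.sum_univ_castSucc]
    have : ¬ (n < m.val) := by omega
    simp [this]
  have key2 : ∑ k ∈ Finset.univ.filter (fun k : Fin (n + 1) => k.val < (Fin.last (n + 1)).val),
        (Fin.snoc w s : Fin (n + 1) → ℤ × ℤ) k = ∑ k, w k + s := by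
    rw [Finset.sum_filter, Fin.sum_univ_castSucc]
    simp
  simp only [quadrantWalks, Finset.mem_filter, Fintype.mem_piFinset]
  rw [Fin.forall_fin_succ' (n := n + 1), Fin.forall_fin_succ' (n := n)]
  simp only [key, key2, Fin.snoc_castSucc, Fin.snoc_last]
  tauto

lemma sum_quadrantWalks_succ {M : Type*} [AddCommMonoid M] (S : Finset (ℤ × ℤ)) (n : ℕ)
    (F : ℤ × ℤ → M) :
    ∑ w ∈ quadrantWalks S (n + 1), F (∑ k, w k) =
      ∑ w ∈ quadrantWalks S n, ∑ s ∈ S,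
        if 0 ≤ (∑ k, w k + s).1 ∧ 0 ≤ (∑ k, w k + s).2 then F (∑ k, w k + s) else 0 := by
  rw [← Finset.sum_product', ← Finset.sum_filter]
  symm
  refine Finset.sum_bij' (fun p _ => (Fin.snoc p.1 p.2 : Fin (n + 1) → ℤ × ℤ))
    (fun w _ => (Fin.init w, w (Fin.last n))) ?_ ?_ ?_ ?_ ?_
  · rintro ⟨w, s⟩ h
    rw [Finset.mem_filter, Finset.mem_product] at h
    exact snoc_mem_quadrantWalks.2 ⟨h.1.1, h.1.2, h.2⟩
  · intro w h
    rw [← Fin.snoc_init_self w] at h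
    obtain ⟨h1, h2, h3⟩ := snoc_mem_quadrantWalks.1 h
    exact Finset.mem_filter.2 ⟨Finset.mem_product.2 ⟨h1, h2⟩, h3⟩
  · rintro ⟨w, s⟩ _
    simp
  · intro w _
    simp
  · rintro ⟨w, s⟩ _
    simp [Fin.sum_univ_castSucc]

/-- The generating polynomial `∑ x ^ i y ^ j` of the endpoints `(i, j)` of the walks of
length `n`. -/
def walkPoly (S : Finset (ℤ × ℤ)) (n : ℕ) (x y : ℂ) : ℂ :=
  ∑ w ∈ quadrantWalks S n, x ^ (∑ k, w k).1.toNat * y ^ (∑ k, w k).2.toNat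

lemma card_quadrantWalks_le (S : Finset (ℤ × ℤ)) (n : ℕ) :
    (quadrantWalks S n).card ≤ S.card ^ n := by
  refine (Finset.card_filter_le _ _).trans ?_
  simp

lemma norm_walkPoly_le (S : Finset (ℤ × ℤ)) (n : ℕ) {x y : ℂ} (hx : ‖x‖ ≤ 1) (hy : ‖y‖ ≤ 1) :
    ‖walkPoly S n x y‖ ≤ (S.card : ℝ) ^ n := by
  refine (norm_sum_le _ _).trans ?_
  have : ∀ w ∈ quadrantWalks S n,
      ‖x ^ (∑ k, w k).1.toNat * y ^ (∑ k, w k).2.toNat‖ ≤ 1 := by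
    intro w _
    rw [norm_mul, norm_pow, norm_pow]
    exact mul_le_one₀ (pow_le_one₀ (norm_nonneg _) hx) (by positivity)
      (pow_le_one₀ (norm_nonneg _) hy)
  refine (Finset.sum_le_sum this).trans ?_
  simp only [Finset.sum_const, nsmul_eq_mul, mul_one]
  exact_mod_cast card_quadrantWalks_le S n

lemma hasSum_card_walks (S : Finset (ℤ × ℤ)) (n : ℕ) (x y : ℂ) :
    HasSum (fun p : ℕ × ℕ => ((walks S p.1 p.2 n).card : ℂ) * x ^ p.1 * y ^ p.2)
      (walkPoly S n x y) := by
  have h : ∀ w ∈ quadrantWalks S n, HasSum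
      (fun p : ℕ × ℕ => if p = ((∑ k, w k).1.toNat, (∑ k, w k).2.toNat) then x ^ p.1 * y ^ p.2
        else 0) (x ^ (∑ k, w k).1.toNat * y ^ (∑ k, w k).2.toNat) := by
    intro w _
    have h0 := hasSum_ite_eq ((∑ k, w k).1.toNat, (∑ k, w k).2.toNat)
      (x ^ (∑ k, w k).1.toNat * y ^ (∑ k, w k).2.toNat)
    convert! h0 using 2 with p
    split_ifs with hp <;> simp [hp]
  convert! hasSum_sum h using 2 with p
  obtain ⟨i, j⟩ := p
  rw [walks_eq_filter, Finset.card_filter]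
  push_cast
  rw [mul_assoc, Finset.sum_mul]
  refine Finset.sum_congr rfl fun w hw => ?_
  have h0 := sum_nonneg_of_mem_quadrantWalks hw
  have : (∑ k, w k = ((i : ℤ), (j : ℤ))) ↔ (i, j) = ((∑ k, w k).1.toNat, (∑ k, w k).2.toNat) := by
    rw [Prod.ext_iff, Prod.ext_iff]
    simp only
    omega
  by_cases hh : ∑ k, w k = ((i : ℤ), (j : ℤ))
  · rw [if_pos hh, if_pos (this.1 hh), one_mul]
  · rw [if_neg hh, if_neg (fun h => hh (this.2 h)), zero_mul]

lemma hasSum_Q {S : Finset (ℤ × ℤ)} {z : ℝ} (hz : 0 < z) (hz' : S.card * z < 1) {x y : ℂ}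
    (hx : ‖x‖ ≤ 1) (hy : ‖y‖ ≤ 1) :
    HasSum (fun n => walkPoly S n x y * (z : ℂ) ^ n) (Q S z x y) := by
  have hgeo : Summable fun n : ℕ => ((S.card : ℝ) * z) ^ n :=
    summable_geometric_of_lt_one (by positivity) hz'
  have habs : Summable fun p : ℕ × (ℕ × ℕ) =>
      ((walks S p.2.1 p.2.2 p.1).card : ℂ) * x ^ p.2.1 * y ^ p.2.2 * (z : ℂ) ^ p.1 := by
    have hone : ∀ n, HasSum (fun p : ℕ × ℕ => ((walks S p.1 p.2 n).card : ℝ) * z ^ n)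
        ((quadrantWalks S n).card * z ^ n) := by
      intro n
      have h1 := hasSum_card_walks S n 1 1
      simp only [one_pow, mul_one, walkPoly, Finset.sum_const, nsmul_eq_mul] at h1
      have h2 : HasSum (fun p : ℕ × ℕ => ((walks S p.1 p.2 n).card : ℝ))
          ((quadrantWalks S n).card : ℝ) := by
        refine Complex.hasSum_ofReal.1 ?_
        simpa using h1
      exact h2.mul_right _
    have hs : Summable fun p : ℕ × (ℕ × ℕ) =>
        ((walks S p.2.1 p.2.2 p.1).card : ℝ) * z ^ p.1 := by
      rw [summable_prod_of_nonneg (fun p => by positivity)]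
      refine ⟨fun n => (hone n).summable, ?_⟩
      refine Summable.of_nonneg_of_le (fun n => tsum_nonneg fun p => by positivity) (fun n => ?_)
        hgeo
      rw [(hone n).tsum_eq, mul_pow]
      gcongr
      exact_mod_cast card_quadrantWalks_le S n
    refine Summable.of_norm_bounded hs fun p => ?_
    rw [norm_mul, norm_mul, norm_mul, norm_pow, norm_pow, norm_pow, Complex.norm_natCast,
      Complex.norm_real, Real.norm_of_nonneg hz.le]
    have h1 : ‖x‖ ^ p.2.1 ≤ 1 := pow_le_one₀ (norm_nonneg _) hx
    have h2 : ‖y‖ ^ p.2.2 ≤ 1 := pow_le_one₀ (norm_nonneg _) hy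
    have h3 : ‖x‖ ^ p.2.1 * ‖y‖ ^ p.2.2 ≤ 1 := mul_le_one₀ h1 (by positivity) h2
    calc _ = ((walks S p.2.1 p.2.2 p.1).card : ℝ) * z ^ p.1 * (‖x‖ ^ p.2.1 * ‖y‖ ^ p.2.2) := by
            ring
      _ ≤ _ := mul_le_of_le_one_right (by positivity) h3
  have hn : ∀ n, HasSum (fun p : ℕ × ℕ => ((walks S p.1 p.2 n).card : ℂ) * x ^ p.1 * y ^ p.2 *
      (z : ℂ) ^ n) (walkPoly S n x y * (z : ℂ) ^ n) :=
    fun n => (hasSum_card_walks S n x y).mul_right _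
  have hQ : Q S z x y = ∑' p : ℕ × (ℕ × ℕ),
      ((walks S p.2.1 p.2.2 p.1).card : ℂ) * x ^ p.2.1 * y ^ p.2.2 * (z : ℂ) ^ p.1 := by
    let e : ℕ × (ℕ × ℕ) ≃ ℕ × ℕ × ℕ :=
      ⟨fun p => (p.2.1, p.2.2, p.1), fun p => (p.2.2, p.1, p.2.1), fun _ => rfl, fun _ => rfl⟩
    rw [Q, ← e.tsum_eq]
    rfl
  rw [hQ]
  exact habs.hasSum.prod_fiberwise hn

/-- The kernel without its term `-x y`. -/
def stepPoly (S : Finset (ℤ × ℤ)) (z : ℝ) (x y : ℂ) : ℂ :=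
  (z : ℂ) * ∑ s ∈ S, x ^ (s.1 + 1).toNat * y ^ (s.2 + 1).toNat

lemma K_eq_stepPoly (S : Finset (ℤ × ℤ)) (z : ℝ) (x y : ℂ) :
    K S z x y = stepPoly S z x y - x * y := rfl

/-- Appending a step: the walks that leave the quarter plane are removed by inclusion and
exclusion over the two axes. -/
lemma walkPoly_succ {S : Finset (ℤ × ℤ)} (hS : ∀ s ∈ S, -1 ≤ s.1 ∧ -1 ≤ s.2) (z : ℝ) (n : ℕ)
    (x y : ℂ) :
    x * y * (z * walkPoly S (n + 1) x y) =
      stepPoly S z x y * walkPoly S n x y - stepPoly S z 0 y * walkPoly S n 0 y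
        - stepPoly S z x 0 * walkPoly S n x 0 + stepPoly S z 0 0 * walkPoly S n 0 0 := by
  have h := sum_quadrantWalks_succ S n (fun p => x ^ p.1.toNat * y ^ p.2.toNat)
  simp only [walkPoly, stepPoly]
  rw [h]
  simp only [Finset.mul_sum, Finset.sum_mul, ← Finset.sum_sub_distrib, ← Finset.sum_add_distrib]
  refine Finset.sum_congr rfl fun w hw => Finset.sum_congr rfl fun s hs => ?_
  obtain ⟨h1, h2⟩ := sum_nonneg_of_mem_quadrantWalks hw
  obtain ⟨h3, h4⟩ := hS s hs
  set e := ∑ k, w k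
  obtain ⟨i, hi⟩ := Int.eq_ofNat_of_zero_le h1
  obtain ⟨j, hj⟩ := Int.eq_ofNat_of_zero_le h2
  obtain ⟨p, hp⟩ := Int.eq_ofNat_of_zero_le (show 0 ≤ s.1 + 1 by omega)
  obtain ⟨q, hq⟩ := Int.eq_ofNat_of_zero_le (show 0 ≤ s.2 + 1 by omega)
  have e1 : (e + s).1 = (i + p : ℕ) - 1 := by simp; omega
  have e2 : (e + s).2 = (j + q : ℕ) - 1 := by simp; omega
  rw [hi, hj, hp, hq, e1, e2]
  simp only [Int.toNat_natCast]
  have key : ∀ (u v : ℂ), z * (u ^ p * v ^ q) * (u ^ i * v ^ j) = z * (u ^ (i + p) * v ^ (j + q)) :=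
    fun u v => by ring
  simp only [key]
  have expand : ∀ (u v u' v' : ℂ), (z : ℂ) * (u * v) - z * (u' * v) - z * (u * v') + z * (u' * v')
      = z * ((u - u') * (v - v')) := fun u v u' v' => by ring
  rw [expand]
  rcases Nat.eq_zero_or_pos (i + p) with hip | hip
  · simp [hip]
  rcases Nat.eq_zero_or_pos (j + q) with hjq | hjq
  · simp [hjq]
  obtain ⟨k, hk⟩ := Nat.exists_eq_succ_of_ne_zero hip.ne'
  obtain ⟨l, hl⟩ := Nat.exists_eq_succ_of_ne_zero hjq.ne'
  rw [hk, hl]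
  simp
  ring

/-- The functional equation of the generating function, in the closed unit bidisc. -/
theorem K_mul_Q {S : Finset (ℤ × ℤ)} (hS : ∀ s ∈ S, -1 ≤ s.1 ∧ -1 ≤ s.2) {z : ℝ} (hz : 0 < z)
    (hz' : S.card * z < 1) {x y : ℂ} (hx : ‖x‖ ≤ 1) (hy : ‖y‖ ≤ 1) :
    K S z x y * Q S z x y =
      K S z x 0 * Q S z x 0 + K S z 0 y * Q S z 0 y - K S z 0 0 * Q S z 0 0 - x * y := by
  have h0 : ‖(0 : ℂ)‖ ≤ 1 := by simp
  have hQ := hasSum_Q hz hz' hx hy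
  have hQ1 := (hasSum_nat_add_iff' 1).2 hQ
  have hw0 : walkPoly S 0 x y = 1 := by simp [walkPoly, quadrantWalks]
  simp only [Finset.range_one, Finset.sum_singleton, hw0, pow_zero, mul_one] at hQ1
  have h1 := hQ1.mul_left (x * y)
  have h2 := (((hQ.mul_left (stepPoly S z x y)).sub
    ((hasSum_Q hz hz' h0 hy).mul_left (stepPoly S z 0 y))).sub
    ((hasSum_Q hz hz' hx h0).mul_left (stepPoly S z x 0))).add
    ((hasSum_Q hz hz' h0 h0).mul_left (stepPoly S z 0 0))
  have h3 := h1.unique (by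
    convert! h2 using 2 with n
    have := walkPoly_succ hS z n x y
    linear_combination (z : ℂ) ^ n * this)
  simp only [K_eq_stepPoly, mul_zero, zero_mul, sub_zero]
  linear_combination -h3

lemma differentiableOn_Q_left {S : Finset (ℤ × ℤ)} {z : ℝ} (hz : 0 < z) (hz' : S.card * z < 1) :
    DifferentiableOn ℂ (fun u => Q S z u 0) (Metric.ball 0 1) := by
  have h0 : ‖(0 : ℂ)‖ ≤ 1 := by simp
  have h : DifferentiableOn ℂ (fun u => ∑' n, walkPoly S n u 0 * (z : ℂ) ^ n)
      (Metric.ball 0 1) := by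
    refine Complex.differentiableOn_tsum_of_summable_norm
      (summable_geometric_of_lt_one (by positivity : 0 ≤ (S.card : ℝ) * z) hz') (fun n => ?_)
      Metric.isOpen_ball (fun n u hu => ?_)
    · unfold walkPoly
      fun_prop
    · rw [norm_mul, norm_pow, Complex.norm_real, Real.norm_of_nonneg hz.le, mul_pow]
      gcongr
      exact norm_walkPoly_le S n (by simpa using (mem_ball_zero_iff.1 hu).le) h0
  refine h.congr fun u hu => ?_
  exact (hasSum_Q hz hz' (by simpa using (mem_ball_zero_iff.1 hu).le) h0).tsum_eq.symm

lemma differentiableOn_Q_right {S : Finset (ℤ × ℤ)} {z : ℝ} (hz : 0 < z) (hz' : S.card * z < 1) :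
    DifferentiableOn ℂ (fun u => Q S z 0 u) (Metric.ball 0 1) := by
  have h0 : ‖(0 : ℂ)‖ ≤ 1 := by simp
  have h : DifferentiableOn ℂ (fun u => ∑' n, walkPoly S n 0 u * (z : ℂ) ^ n)
      (Metric.ball 0 1) := by
    refine Complex.differentiableOn_tsum_of_summable_norm
      (summable_geometric_of_lt_one (by positivity : 0 ≤ (S.card : ℝ) * z) hz') (fun n => ?_)
      Metric.isOpen_ball (fun n u hu => ?_)
    · unfold walkPoly
      fun_prop
    · rw [norm_mul, norm_pow, Complex.norm_real, Real.norm_of_nonneg hz.le, mul_pow]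
      gcongr
      exact norm_walkPoly_le S n h0 (by simpa using (mem_ball_zero_iff.1 hu).le)
  refine h.congr fun u hu => ?_
  exact (hasSum_Q hz hz' h0 (by simpa using (mem_ball_zero_iff.1 hu).le)).tsum_eq.symm

/-! ### Weighted step sets and the coefficients of their kernels -/

/-- The weights of a non-singular model of small steps, with total mass less than one: `w i j` is
the weight of the step `(i, j)`. The class is stable under the symmetries of the square, so that
facts about the discriminant `d` can be transported to `d̃` and to the neighbourhood of infinity. -/
structure IsWeight (w : ℤ → ℤ → ℝ) : Prop where
  nonneg : ∀ i j, 0 ≤ w i j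
  zero : w 0 0 = 0
  sum_lt : w (-1) (-1) + w (-1) 0 + w (-1) 1 + w 0 (-1) + w 0 1 + w 1 (-1) + w 1 0 + w 1 1 < 1
  small : ∀ i j, w i j ≠ 0 → (-1 ≤ i ∧ i ≤ 1) ∧ (-1 ≤ j ∧ j ≤ 1)
  nonsing : ∀ α β : ℝ, (α, β) ≠ (0, 0) → ∃ i j : ℤ, w i j ≠ 0 ∧ α * i + β * j < 0

lemma IsWeight.transpose {w : ℤ → ℤ → ℝ} (hw : IsWeight w) : IsWeight fun i j => w j i where
  nonneg i j := hw.nonneg j i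
  zero := hw.zero
  sum_lt := by have := hw.sum_lt; linarith
  small i j h := (hw.small j i h).symm
  nonsing α β h := by
    obtain ⟨i, j, h1, h2⟩ := hw.nonsing β α (by simpa [and_comm] using h)
    exact ⟨j, i, h1, by linarith⟩

lemma IsWeight.reflect {w : ℤ → ℤ → ℝ} (hw : IsWeight w) : IsWeight fun i j => w (-i) j where
  nonneg i j := hw.nonneg (-i) j
  zero := by simpa using hw.zero
  sum_lt := by have := hw.sum_lt; simp; linarith
  small i j h := by have := hw.small (-i) j h; omega
  nonsing α β h := by
    obtain ⟨i, j, h1, h2⟩ := hw.nonsing (-α) β (by simpa using h)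
    exact ⟨-i, j, by simpa using h1, by push_cast; linarith⟩

lemma IsWeight.exists_of_lin {w : ℤ → ℤ → ℝ} (hw : IsWeight w) (α β : ℤ) (h : (α, β) ≠ (0, 0)) :
    ∃ i j : ℤ, 0 < w i j ∧ (-1 ≤ i ∧ i ≤ 1) ∧ (-1 ≤ j ∧ j ≤ 1) ∧ α * i + β * j < 0 := by
  obtain ⟨i, j, h1, h2⟩ := hw.nonsing α β (by
    intro h'
    apply h
    simp only [Prod.mk.injEq, Int.cast_eq_zero] at h' ⊢
    exact h')
  exact ⟨i, j, lt_of_le_of_ne (hw.nonneg i j) h1.symm, (hw.small i j h1).1, (hw.small i j h1).2,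
    by exact_mod_cast h2⟩

/-- The coefficient of `y ^ (j + 1)` in the kernel of the weights `w`, without the contribution of
the term `-x y`. -/
def wcoeff (w : ℤ → ℤ → ℝ) (j : ℤ) : ℝ[X] :=
  C (w (-1) j) + C (w 0 j) * X + C (w 1 j) * X ^ 2

/-- The discriminant in `y` of the kernel of the weights `w`. -/
def wdisc (w : ℤ → ℤ → ℝ) : ℝ[X] :=
  (-X + wcoeff w 0) ^ 2 - 4 * wcoeff w 1 * wcoeff w (-1)

/-- The kernel of the weights `w`. -/
def wker (w : ℤ → ℤ → ℝ) (x y : ℂ) : ℂ :=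
  aeval x (wcoeff w 1) * y ^ 2 + (-x + aeval x (wcoeff w 0)) * y + aeval x (wcoeff w (-1))

lemma eval_wcoeff (w : ℤ → ℤ → ℝ) (j : ℤ) (t : ℝ) :
    (wcoeff w j).eval t = w (-1) j + w 0 j * t + w 1 j * t ^ 2 := by
  simp [wcoeff]

lemma aeval_wcoeff (w : ℤ → ℤ → ℝ) (j : ℤ) (t : ℂ) :
    aeval t (wcoeff w j) = w (-1) j + w 0 j * t + w 1 j * t ^ 2 := by
  simp [wcoeff]

lemma eval_wdisc (w : ℤ → ℤ → ℝ) (t : ℝ) :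
    (wdisc w).eval t = (-t + (wcoeff w 0).eval t) ^ 2
      - 4 * (wcoeff w 1).eval t * (wcoeff w (-1)).eval t := by
  simp [wdisc]

lemma aeval_wdisc (w : ℤ → ℤ → ℝ) (t : ℂ) :
    aeval t (wdisc w) = (-t + aeval t (wcoeff w 0)) ^ 2
      - 4 * aeval t (wcoeff w 1) * aeval t (wcoeff w (-1)) := by
  simp only [wdisc, map_sub, map_mul, map_add, map_pow, map_neg, aeval_X, map_ofNat]

/-- The coefficients of the discriminant. -/
def wdcoeff (w : ℤ → ℤ → ℝ) : ℕ → ℝ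
  | 0 => w (-1) 0 ^ 2 - 4 * w (-1) 1 * w (-1) (-1)
  | 1 => 2 * w (-1) 0 * (w 0 0 - 1) - 4 * (w (-1) 1 * w 0 (-1) + w 0 1 * w (-1) (-1))
  | 2 => (w 0 0 - 1) ^ 2 + 2 * w (-1) 0 * w 1 0
      - 4 * (w (-1) 1 * w 1 (-1) + w 0 1 * w 0 (-1) + w 1 1 * w (-1) (-1))
  | 3 => 2 * (w 0 0 - 1) * w 1 0 - 4 * (w 0 1 * w 1 (-1) + w 1 1 * w 0 (-1))
  | 4 => w 1 0 ^ 2 - 4 * w 1 1 * w 1 (-1)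
  | _ => 0

lemma wdisc_eq (w : ℤ → ℤ → ℝ) :
    wdisc w = C (wdcoeff w 0) + C (wdcoeff w 1) * X + C (wdcoeff w 2) * X ^ 2
      + C (wdcoeff w 3) * X ^ 3 + C (wdcoeff w 4) * X ^ 4 := by
  simp only [wdisc, wcoeff, wdcoeff, map_add, map_sub, map_mul, map_pow, map_one, map_ofNat]
  ring

lemma coeff_wdisc (w : ℤ → ℤ → ℝ) (n : ℕ) : (wdisc w).coeff n = wdcoeff w n := by
  rw [wdisc_eq]
  simp only [coeff_add, coeff_C_mul, coeff_X_pow, coeff_C, coeff_X]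
  rcases n with _ | _ | _ | _ | _ | n <;> simp [wdcoeff]

lemma natDegree_wdisc_le (w : ℤ → ℤ → ℝ) : (wdisc w).natDegree ≤ 4 := by
  rw [wdisc_eq]
  compute_degree

lemma wdcoeff_reflect (w : ℤ → ℤ → ℝ) (n : ℕ) (hn : n ≤ 4) :
    wdcoeff (fun i j => w (-i) j) n = wdcoeff w (4 - n) := by
  interval_cases n <;> simp [wdcoeff] <;> ring

lemma eval_wdisc_reflect (w : ℤ → ℤ → ℝ) {t : ℝ} (ht : t ≠ 0) :
    (wdisc fun i j => w (-i) j).eval t = t ^ 4 * (wdisc w).eval t⁻¹ := by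
  rw [wdisc_eq, wdisc_eq]
  simp only [eval_add, eval_mul, eval_C, eval_pow, eval_X]
  rw [wdcoeff_reflect w 0 (by norm_num), wdcoeff_reflect w 1 (by norm_num),
    wdcoeff_reflect w 2 (by norm_num), wdcoeff_reflect w 3 (by norm_num),
    wdcoeff_reflect w 4 (by norm_num)]
  norm_num
  field_simp
  ring

/-! ### The kernel on the unit circle -/

section UnitCircle

variable {w : ℤ → ℤ → ℝ}

lemma norm_aeval_wcoeff_le (hw : IsWeight w) (j : ℤ) {t : ℂ} (ht : ‖t‖ = 1) :
    ‖aeval t (wcoeff w j)‖ ≤ w (-1) j + w 0 j + w 1 j := by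
  rw [aeval_wcoeff]
  refine (norm_add₃_le).trans ?_
  simp [ht, abs_of_nonneg (hw.nonneg _ _)]

/-- The kernel has no zero on the torus `|x| = |y| = 1`, since the term `x y` dominates. -/
lemma wker_ne_zero_of_norm_eq_one (hw : IsWeight w) {x y : ℂ} (hx : ‖x‖ = 1) (hy : ‖y‖ = 1) :
    wker w x y ≠ 0 := by
  intro h
  have h1 : x * y = aeval x (wcoeff w 1) * y ^ 2 + aeval x (wcoeff w 0) * y
      + aeval x (wcoeff w (-1)) := by
    rw [wker] at h
    linear_combination -h
  have h2 := congrArg norm h1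
  rw [norm_mul, hx, hy] at h2
  have h3 : ‖aeval x (wcoeff w 1) * y ^ 2 + aeval x (wcoeff w 0) * y
      + aeval x (wcoeff w (-1))‖ ≤ (w (-1) 1 + w 0 1 + w 1 1) + (w (-1) 0 + w 0 0 + w 1 0)
        + (w (-1) (-1) + w 0 (-1) + w 1 (-1)) := by
    refine norm_add₃_le.trans ?_
    rw [norm_mul, norm_mul, norm_pow, hy, one_pow, mul_one, mul_one]
    exact add_le_add (add_le_add (norm_aeval_wcoeff_le hw 1 hx) (norm_aeval_wcoeff_le hw 0 hx))
      (norm_aeval_wcoeff_le hw (-1) hx)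
  have := hw.sum_lt
  have := hw.zero
  linarith

/-- On the unit circle `d(x) / x²` avoids the negative real axis: it is the product of two numbers
with positive real parts. -/
lemma wdisc_div_sq_ne (hw : IsWeight w) {x : ℂ} (hx : ‖x‖ = 1) {r : ℝ} (hr : r ≤ 0) :
    aeval x (wdisc w) ≠ r * x ^ 2 := by
  intro h
  have hx0 : x ≠ 0 := by rintro rfl; simp at hx
  obtain ⟨s, hs⟩ := IsAlgClosed.exists_eq_mul_self
    (aeval x (wcoeff w 1) * aeval x (wcoeff w (-1)))
  set a := aeval x (wcoeff w 1) with ha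
  set c := aeval x (wcoeff w (-1)) with hc
  set b := aeval x (wcoeff w 0) with hb
  have hna : ‖a‖ ≤ _ := norm_aeval_wcoeff_le hw 1 hx
  have hnb : ‖b‖ ≤ _ := norm_aeval_wcoeff_le hw 0 hx
  have hnc : ‖c‖ ≤ _ := norm_aeval_wcoeff_le hw (-1) hx
  have hs2 : 2 * ‖s‖ ≤ ‖a‖ + ‖c‖ := by
    have : ‖s‖ * ‖s‖ = ‖a‖ * ‖c‖ := by rw [← norm_mul, ← norm_mul, hs]
    nlinarith [sq_nonneg (‖a‖ - ‖c‖), norm_nonneg a, norm_nonneg c, norm_nonneg s]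
  have hsum : ‖b‖ + 2 * ‖s‖ < 1 := by
    have := hw.sum_lt
    have := hw.zero
    linarith
  have hpos : ∀ v : ℂ, ‖v‖ < 1 → 0 < (1 - v).re := fun v hv => by
    have := Complex.re_le_norm v
    simp; linarith
  have h1 : 0 < (1 - (b - 2 * s) / x).re := hpos _ (by
    rw [norm_div, hx, div_one]
    refine (norm_sub_le _ _).trans_lt ?_
    simpa using hsum)
  have h2 : 0 < (1 - (b + 2 * s) / x).re := hpos _ (by
    rw [norm_div, hx, div_one]
    refine (norm_add_le _ _).trans_lt ?_
    simpa using hsum)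
  have h3 : (1 - (b - 2 * s) / x) * (1 - (b + 2 * s) / x) = r := by
    rw [aeval_wdisc, ← ha, ← hb, ← hc] at h
    field_simp
    linear_combination h + 4 * hs
  set u := 1 - (b - 2 * s) / x
  set v := 1 - (b + 2 * s) / x
  have hre := congrArg Complex.re h3
  have him := congrArg Complex.im h3
  simp only [Complex.mul_re, Complex.mul_im, Complex.ofReal_re, Complex.ofReal_im] at hre him
  -- `u = r / v` has real part `r * re v / |v|² ≤ 0`
  have key : u.re * (v.re ^ 2 + v.im ^ 2) = r * v.re := by
    linear_combination v.re * hre + v.im * him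
  have hl : 0 < u.re * (v.re ^ 2 + v.im ^ 2) := by positivity
  have := mul_nonneg (neg_nonneg.2 hr) h2.le
  linarith

end UnitCircle

/-! ### The branch points -/

section Branch

variable {w : ℤ → ℤ → ℝ}

lemma eval_wcoeff_pos (hw : IsWeight w) {t : ℝ} (ht : 0 < t) {j : ℤ} (hj : j = 1 ∨ j = -1) :
    0 < (wcoeff w j).eval t := by
  rw [eval_wcoeff]
  obtain ⟨i, k, h1, h2, h3, h4⟩ := hw.exists_of_lin 0 (-j) (by rcases hj with rfl | rfl <;> simp)
  have hk : k = j := by rcases hj with rfl | rfl <;> omega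
  subst hk
  have a1 := hw.nonneg (-1) k
  have a2 := mul_nonneg (hw.nonneg 0 k) ht.le
  have a3 := mul_nonneg (hw.nonneg 1 k) (sq_nonneg t)
  obtain ⟨h5, h6⟩ := h2
  interval_cases i
  · linarith
  · have := mul_pos h1 ht; linarith
  · have := mul_pos h1 (pow_pos ht 2); linarith

lemma eval_wdisc_one_pos (hw : IsWeight w) : 0 < (wdisc w).eval 1 := by
  rw [eval_wdisc]
  have ha := eval_wcoeff_pos hw one_pos (j := 1) (by simp)
  have hc := eval_wcoeff_pos hw one_pos (j := -1) (by simp)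
  have hb : -1 + (wcoeff w 0).eval 1 < -((wcoeff w 1).eval 1 + (wcoeff w (-1)).eval 1) := by
    simp only [eval_wcoeff]
    have := hw.sum_lt
    have := hw.zero
    linarith
  nlinarith [sq_nonneg ((wcoeff w 1).eval 1 - (wcoeff w (-1)).eval 1)]

lemma eval_wdisc_neg_one_pos (hw : IsWeight w) : 0 < (wdisc w).eval (-1) := by
  rw [eval_wdisc]
  have n := hw.nonneg
  have ha : |(wcoeff w 1).eval (-1)| ≤ w (-1) 1 + w 0 1 + w 1 1 := by
    rw [eval_wcoeff, abs_le]
    constructor <;> linarith [n (-1) 1, n 0 1, n 1 1]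
  have hc : |(wcoeff w (-1)).eval (-1)| ≤ w (-1) (-1) + w 0 (-1) + w 1 (-1) := by
    rw [eval_wcoeff, abs_le]
    constructor <;> linarith [n (-1) (-1), n 0 (-1), n 1 (-1)]
  have hb : 1 ≤ -(-1) + (wcoeff w 0).eval (-1) := by
    rw [eval_wcoeff, hw.zero]
    linarith [n (-1) 0, n 1 0]
  have hs : |(wcoeff w 1).eval (-1)| + |(wcoeff w (-1)).eval (-1)| < 1 := by
    have := hw.sum_lt
    linarith [n (-1) 0, n 1 0]
  have h1 : (wcoeff w 1).eval (-1) * (wcoeff w (-1)).eval (-1) ≤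
      |(wcoeff w 1).eval (-1)| * |(wcoeff w (-1)).eval (-1)| := by
    rw [← abs_mul]; exact le_abs_self _
  nlinarith [sq_nonneg (|(wcoeff w 1).eval (-1)| - |(wcoeff w (-1)).eval (-1)|),
    abs_nonneg ((wcoeff w 1).eval (-1)), abs_nonneg ((wcoeff w (-1)).eval (-1))]

/-- On the positive axis the discriminant is the product of the increasing and decreasing
combinations `b ± 2 √(a c)`. -/
lemma eval_wdisc_eq_mul (hw : IsWeight w) {t : ℝ} (ht : 0 ≤ t) :
    (wdisc w).eval t =
      ((-t + (wcoeff w 0).eval t) - 2 * √((wcoeff w 1).eval t * (wcoeff w (-1)).eval t)) *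
      ((-t + (wcoeff w 0).eval t) + 2 * √((wcoeff w 1).eval t * (wcoeff w (-1)).eval t)) := by
  rw [eval_wdisc]
  have h : 0 ≤ (wcoeff w 1).eval t * (wcoeff w (-1)).eval t := by
    have n := hw.nonneg
    rw [eval_wcoeff, eval_wcoeff]
    have := n (-1) 1
    have := n 0 1
    have := n 1 1
    have := n (-1) (-1)
    have := n 0 (-1)
    have := n 1 (-1)
    positivity
  have := Real.sq_sqrt h
  linear_combination 4 * this

/-- Near the origin, non-singularity makes `b + 2 √(a c)` positive. -/
lemma exists_pos_of_isWeight (hw : IsWeight w) : ∃ t : ℝ, 0 ≤ t ∧ t < 1 ∧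
    0 < (-t + (wcoeff w 0).eval t) + 2 * √((wcoeff w 1).eval t * (wcoeff w (-1)).eval t) := by
  have n := hw.nonneg
  by_cases h0 : 0 < w (-1) 0
  · refine ⟨0, le_rfl, one_pos, ?_⟩
    have := Real.sqrt_nonneg ((wcoeff w 1).eval 0 * (wcoeff w (-1)).eval 0)
    have h : (wcoeff w 0).eval 0 = w (-1) 0 := by simp [eval_wcoeff]
    rw [h]
    linarith
  have h0' : w (-1) 0 = 0 := le_antisymm (not_lt.1 h0) (n _ _)
  by_cases h1 : 0 < w (-1) 1 * w (-1) (-1)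
  · refine ⟨0, le_rfl, one_pos, ?_⟩
    have := Real.sqrt_pos.2 h1
    simp only [eval_wcoeff]
    simp only [h0', mul_zero, add_zero, neg_zero, ne_eq, OfNat.ofNat_ne_zero, not_false_eq_true,
      zero_pow]
    linarith
  have h1' : w (-1) 1 * w (-1) (-1) = 0 :=
    le_antisymm (not_lt.1 h1) (mul_nonneg (n _ _) (n _ _))
  -- now `d(0) = 0`, and non-singularity gives `d'(0) < 0`
  have hm : 0 < w (-1) 1 * w 0 (-1) + w 0 1 * w (-1) (-1) := by
    obtain ⟨i, j, p1, p2, p3, p4⟩ := hw.exists_of_lin 1 0 (by simp)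
    have hi : i = -1 := by omega
    subst hi
    obtain ⟨p5, p6⟩ := p3
    rcases mul_eq_zero.1 h1' with h2 | h2
    · have hj : j = -1 := by
        interval_cases j
        · rfl
        · linarith
        · linarith
      subst hj
      obtain ⟨i, k, q1, q2, q3, q4⟩ := hw.exists_of_lin 1 (-1) (by simp)
      have h01 : 0 < w 0 1 := by
        have hcases : (i = -1 ∧ k = 0) ∨ (i = -1 ∧ k = 1) ∨ (i = 0 ∧ k = 1) := by omega
        rcases hcases with ⟨rfl, rfl⟩ | ⟨rfl, rfl⟩ | ⟨rfl, rfl⟩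
        · linarith
        · linarith
        · exact q1
      have := mul_pos h01 p1
      have := mul_nonneg (n (-1) 1) (n 0 (-1))
      linarith
    · have hj : j = 1 := by
        interval_cases j
        · linarith
        · linarith
        · rfl
      subst hj
      obtain ⟨i, k, q1, q2, q3, q4⟩ := hw.exists_of_lin 1 1 (by simp)
      have h01 : 0 < w 0 (-1) := by
        have hcases : (i = -1 ∧ k = 0) ∨ (i = -1 ∧ k = -1) ∨ (i = 0 ∧ k = -1) := by omega
        rcases hcases with ⟨rfl, rfl⟩ | ⟨rfl, rfl⟩ | ⟨rfl, rfl⟩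
        · linarith
        · linarith
        · exact q1
      have := mul_pos p1 h01
      have := mul_nonneg (n 0 1) (n (-1) (-1))
      linarith
  set m := w (-1) 1 * w 0 (-1) + w 0 1 * w (-1) (-1) with hmdef
  have hm1 : m < 1 := by
    have := hw.sum_lt
    nlinarith [n (-1) (-1), n (-1) 0, n (-1) 1, n 0 (-1), n 0 1, n 1 (-1), n 1 0, n 1 1]
  refine ⟨m, hm.le, hm1, ?_⟩
  have hac : m * m ≤ (wcoeff w 1).eval m * (wcoeff w (-1)).eval m := by
    have e : (wcoeff w 1).eval m * (wcoeff w (-1)).eval m = w (-1) 1 * w (-1) (-1) + m * m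
        + m ^ 2 * (w (-1) 1 * w 1 (-1) + w 0 1 * w 0 (-1) + w 1 1 * w (-1) (-1))
        + m ^ 3 * (w 0 1 * w 1 (-1) + w 1 1 * w 0 (-1)) + m ^ 4 * (w 1 1 * w 1 (-1)) := by
      rw [eval_wcoeff, eval_wcoeff]
      linear_combination (-m) * hmdef
    rw [e]
    have := n (-1) 1
    have := n 0 1
    have := n 1 1
    have := n (-1) (-1)
    have := n 0 (-1)
    have := n 1 (-1)
    have h5 : 0 ≤ m ^ 2 * (w (-1) 1 * w 1 (-1) + w 0 1 * w 0 (-1) + w 1 1 * w (-1) (-1)) := by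
      positivity
    have h6 : 0 ≤ m ^ 3 * (w 0 1 * w 1 (-1) + w 1 1 * w 0 (-1)) := by positivity
    have h7 : 0 ≤ m ^ 4 * (w 1 1 * w 1 (-1)) := by positivity
    linarith
  have hsq : m ≤ √((wcoeff w 1).eval m * (wcoeff w (-1)).eval m) := by
    apply Real.le_sqrt_of_sq_le
    linarith
  have hb : 0 ≤ (wcoeff w 0).eval m := by
    rw [eval_wcoeff]
    have := n (-1) 0
    have := n 0 0
    have := n 1 0
    positivity
  linarith

/-- The discriminant has two roots of modulus less than one. The larger one is positive, and
`b ≥ 0` at the smaller one if that is positive, too. -/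
lemma exists_two_roots (hw : IsWeight w) : ∃ x₁ x₂ : ℝ, -1 < x₁ ∧ x₁ < x₂ ∧ 0 < x₂ ∧ x₂ < 1 ∧
    (wdisc w).eval x₁ = 0 ∧ (wdisc w).eval x₂ = 0 ∧
    (0 < x₁ → 0 ≤ -x₁ + (wcoeff w 0).eval x₁) := by
  obtain ⟨t, ht0, ht1, htp⟩ := exists_pos_of_isWeight hw
  have hcont : Continuous fun t : ℝ => (-t + (wcoeff w 0).eval t)
      + 2 * √((wcoeff w 1).eval t * (wcoeff w (-1)).eval t) := by
    fun_prop
  have hcont' : Continuous fun t : ℝ => (-t + (wcoeff w 0).eval t)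
      - 2 * √((wcoeff w 1).eval t * (wcoeff w (-1)).eval t) := by
    fun_prop
  have h1 : (-1 + (wcoeff w 0).eval 1)
      + 2 * √((wcoeff w 1).eval 1 * (wcoeff w (-1)).eval 1) < 0 := by
    have ha := eval_wcoeff_pos hw one_pos (j := 1) (by simp)
    have hc := eval_wcoeff_pos hw one_pos (j := -1) (by simp)
    have hb : -1 + (wcoeff w 0).eval 1 < -((wcoeff w 1).eval 1 + (wcoeff w (-1)).eval 1) := by
      simp only [eval_wcoeff]
      have := hw.sum_lt
      have := hw.zero
      linarith
    have hs : √((wcoeff w 1).eval 1 * (wcoeff w (-1)).eval 1) ≤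
        ((wcoeff w 1).eval 1 + (wcoeff w (-1)).eval 1) / 2 := by
      rw [Real.sqrt_le_left (by linarith)]
      nlinarith [sq_nonneg ((wcoeff w 1).eval 1 - (wcoeff w (-1)).eval 1)]
    linarith
  obtain ⟨x₂, ⟨hx2a, hx2b⟩, hx2⟩ := intermediate_value_Ioo' ht1.le hcont.continuousOn
    (show (0 : ℝ) ∈ Set.Ioo _ _ from ⟨h1, htp⟩)
  simp only at hx2
  have hx20 : 0 < x₂ := ht0.trans_lt hx2a
  have hd2 : (wdisc w).eval x₂ = 0 := by rw [eval_wdisc_eq_mul hw hx20.le, hx2, mul_zero]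
  rcases lt_trichotomy ((wdisc w).eval 0) 0 with hd0 | hd0 | hd0
  · obtain ⟨x₁, ⟨hx1a, hx1b⟩, hx1⟩ := intermediate_value_Ioo' (show (-1 : ℝ) ≤ 0 by norm_num)
      (wdisc w).continuous.continuousOn
      (show (0 : ℝ) ∈ Set.Ioo _ _ from ⟨hd0, eval_wdisc_neg_one_pos hw⟩)
    exact ⟨x₁, x₂, hx1a, hx1b.trans hx20, hx20, hx2b, hx1, hd2, fun h => by linarith⟩
  · exact ⟨0, x₂, by norm_num, hx20, hx20, hx2b, hd0, hd2, fun h => by linarith⟩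
  · have hg2 : (-x₂ + (wcoeff w 0).eval x₂)
        - 2 * √((wcoeff w 1).eval x₂ * (wcoeff w (-1)).eval x₂) < 0 := by
      have ha := eval_wcoeff_pos hw hx20 (j := 1) (by simp)
      have hc := eval_wcoeff_pos hw hx20 (j := -1) (by simp)
      have := Real.sqrt_pos.2 (mul_pos ha hc)
      linarith
    have hg0 : 0 < (-0 + (wcoeff w 0).eval 0)
        - 2 * √((wcoeff w 1).eval 0 * (wcoeff w (-1)).eval 0) := by
      rw [eval_wdisc_eq_mul hw le_rfl] at hd0
      have hb : 0 ≤ -0 + (wcoeff w 0).eval 0 := by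
        rw [eval_wcoeff]; have := hw.nonneg (-1) 0; simpa using this
      have := Real.sqrt_nonneg ((wcoeff w 1).eval 0 * (wcoeff w (-1)).eval 0)
      exact pos_of_mul_pos_left hd0 (by linarith)
    obtain ⟨x₁, ⟨hx1a, hx1b⟩, hx1⟩ := intermediate_value_Ioo' hx20.le hcont'.continuousOn
      (show (0 : ℝ) ∈ Set.Ioo _ _ from ⟨hg2, hg0⟩)
    simp only at hx1
    refine ⟨x₁, x₂, by linarith, hx1b, hx20, hx2b, ?_, hd2, fun _ => ?_⟩
    · rw [eval_wdisc_eq_mul hw hx1a.le, hx1, zero_mul]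
    · have := Real.sqrt_nonneg ((wcoeff w 1).eval x₁ * (wcoeff w (-1)).eval x₁)
      linarith

end Branch

/-! ### Quartics with the configuration of branch points -/

/-- The quartic (or cubic) `p = (μ t - ν) (t - x₁) (t - x₂) (t - x₃)` with `-1 < x₁ < x₂ < 1 < x₃`
and with its last root `ν / μ` (infinite if `μ = 0`) on the arc from `x₃` to `-1` through
infinity. -/
structure IsBranched (p : ℝ[X]) (x₁ x₂ x₃ μ ν : ℝ) : Prop where
  fac : p = (C μ * X - C ν) * (X - C x₁) * (X - C x₂) * (X - C x₃)
  neg_one_lt : -1 < x₁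
  lt₁₂ : x₁ < x₂
  pos : 0 < x₂
  lt_one : x₂ < 1
  one_lt : 1 < x₃
  neg_lt : -μ < ν
  mul_lt : μ * x₃ < ν

namespace IsBranched

variable {p : ℝ[X]} {x₁ x₂ x₃ μ ν : ℝ}

lemma eval_eq (h : IsBranched p x₁ x₂ x₃ μ ν) (t : ℝ) :
    p.eval t = (μ * t - ν) * (t - x₁) * (t - x₂) * (t - x₃) := by
  rw [h.fac]; simp

lemma nu_pos (h : IsBranched p x₁ x₂ x₃ μ ν) : 0 < ν := by
  have := h.neg_lt
  have := h.mul_lt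
  have := h.one_lt
  rcases le_total 0 μ with h0 | h0
  · nlinarith
  · linarith

lemma lin_neg (h : IsBranched p x₁ x₂ x₃ μ ν) {t : ℝ} (h1 : -1 ≤ t) (h2 : t ≤ x₃) :
    μ * t - ν < 0 := by
  have := h.neg_lt
  have := h.mul_lt
  have := h.one_lt
  rcases le_total 0 μ with h0 | h0
  · nlinarith
  · nlinarith

lemma eval_pos (h : IsBranched p x₁ x₂ x₃ μ ν) {t : ℝ} (h1 : x₂ < t) (h2 : t < x₃) :
    0 < p.eval t := by
  have h3 := h.lin_neg (t := t) (by linarith [h.neg_one_lt, h.lt₁₂]) h2.le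
  rw [h.eval_eq]
  have h4 : 0 < (t - x₁) * (t - x₂) := mul_pos (by linarith [h.lt₁₂]) (by linarith)
  have h5 : 0 < (μ * t - ν) * (t - x₃) := mul_pos_of_neg_of_neg h3 (by linarith)
  nlinarith

lemma eval_eq_zero_iff (h : IsBranched p x₁ x₂ x₃ μ ν) (t : ℝ) :
    p.eval t = 0 ↔ μ * t = ν ∨ t = x₁ ∨ t = x₂ ∨ t = x₃ := by
  rw [h.eval_eq]
  simp [sub_eq_zero, or_assoc]

lemma branch1_eq (h : IsBranched p x₁ x₂ x₃ μ ν) : branch1 p = x₁ := by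
  have hs : {t : ℝ | |t| < 1 ∧ p.eval t = 0} = {x₁, x₂} := by
    ext t
    simp only [Set.mem_ofPred_eq, h.eval_eq_zero_iff, Set.mem_insert_iff, Set.mem_singleton_iff,
      abs_lt]
    have := h.neg_one_lt; have := h.lt₁₂; have := h.lt_one; have := h.one_lt
    constructor
    · rintro ⟨⟨h1, h2⟩, h3 | h3 | h3 | h3⟩
      · have := h.lin_neg (t := t) h1.le (by linarith); linarith
      · exact Or.inl h3
      · exact Or.inr h3
      · linarith
    · rintro (rfl | rfl)
      · exact ⟨⟨by linarith, by linarith⟩, by simp⟩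
      · exact ⟨⟨by linarith, by linarith⟩, by simp⟩
  rw [branch1, hs, csInf_pair, min_eq_left h.lt₁₂.le]

lemma branch2_eq (h : IsBranched p x₁ x₂ x₃ μ ν) : branch2 p = x₂ := by
  have hs : {t : ℝ | |t| < 1 ∧ p.eval t = 0} = {x₁, x₂} := by
    ext t
    simp only [Set.mem_ofPred_eq, h.eval_eq_zero_iff, Set.mem_insert_iff, Set.mem_singleton_iff,
      abs_lt]
    have := h.neg_one_lt; have := h.lt₁₂; have := h.lt_one; have := h.one_lt
    constructor
    · rintro ⟨⟨h1, h2⟩, h3 | h3 | h3 | h3⟩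
      · have := h.lin_neg (t := t) h1.le (by linarith); linarith
      · exact Or.inl h3
      · exact Or.inr h3
      · linarith
    · rintro (rfl | rfl)
      · exact ⟨⟨by linarith, by linarith⟩, by simp⟩
      · exact ⟨⟨by linarith, by linarith⟩, by simp⟩
  rw [branch2, hs, csSup_pair, max_eq_right h.lt₁₂.le]

lemma branch3_eq (h : IsBranched p x₁ x₂ x₃ μ ν) : branch3 p = x₃ := by
  have := h.neg_one_lt; have := h.lt₁₂; have := h.lt_one; have := h.one_lt
  refine IsLeast.csInf_eq ⟨⟨h.one_lt, (h.eval_eq_zero_iff _).2 (by simp)⟩, ?_⟩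
  rintro t ⟨h1, h2⟩
  rcases (h.eval_eq_zero_iff t).1 h2 with h3 | h3 | h3 | h3
  · by_contra h4
    have := h.lin_neg (t := t) (by linarith) (by linarith)
    linarith
  · linarith
  · linarith
  · exact h3.ge

lemma branch4_eq_some (h : IsBranched p x₁ x₂ x₃ μ ν) (hμ : μ ≠ 0) :
    branch4 p = ((ν / μ : ℝ) : OnePoint ℝ) := by
  have := h.neg_one_lt; have := h.lt₁₂; have := h.lt_one; have := h.one_lt
  have hroot : μ * (ν / μ) = ν := by field_simp
  have hex : ∃ t : ℝ, 1 < |t| ∧ p.eval t = 0 ∧ t ≠ branch3 p := by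
    refine ⟨ν / μ, ?_, (h.eval_eq_zero_iff _).2 (Or.inl hroot), ?_⟩
    · by_contra h1
      have h1' := abs_le.1 (not_lt.1 h1)
      have := h.lin_neg h1'.1 (by linarith)
      linarith
    · rw [h.branch3_eq]
      intro h1
      have := h.mul_lt
      rw [← h1, hroot] at this
      exact lt_irrefl _ this
  rw [branch4, dif_pos hex]
  obtain ⟨h1, h2, h3'⟩ := hex.choose_spec
  have h3 : hex.choose ≠ x₃ := fun hh => h3' (hh.trans h.branch3_eq.symm)
  congr 1
  rcases (h.eval_eq_zero_iff _).1 h2 with h4 | h4 | h4 | h4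
  · field_simp; linarith
  · rw [h4, lt_abs] at h1
    rcases h1 with h1 | h1 <;> linarith
  · rw [h4, lt_abs] at h1
    rcases h1 with h1 | h1 <;> linarith
  · exact absurd h4 h3

lemma branch4_eq_infty (h : IsBranched p x₁ x₂ x₃ μ ν) (hμ : μ = 0) :
    branch4 p = OnePoint.infty := by
  have := h.neg_one_lt; have := h.lt₁₂; have := h.lt_one; have := h.one_lt
  rw [branch4, dif_neg]
  rintro ⟨t, h1, h2, h3⟩
  rw [h.branch3_eq] at h3
  rcases (h.eval_eq_zero_iff _).1 h2 with h4 | h4 | h4 | h4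
  · have := h.nu_pos
    rw [hμ] at h4
    linarith
  · rw [h4, lt_abs] at h1
    rcases h1 with h1 | h1 <;> linarith
  · rw [h4, lt_abs] at h1
    rcases h1 with h1 | h1 <;> linarith
  · exact absurd h4 h3

end IsBranched

lemma exists_factor_of_root {p : ℝ[X]} {n : ℕ} (hp : p.natDegree ≤ n + 1) {r : ℝ}
    (hr : p.eval r = 0) : ∃ q : ℝ[X], q.natDegree ≤ n ∧ p = q * (X - C r) := by
  obtain ⟨q, hq⟩ := dvd_iff_isRoot.2 hr
  refine ⟨q, ?_, by rw [hq, mul_comm]⟩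
  by_cases hq0 : q = 0
  · simp [hq0]
  have h1 := natDegree_mul (X_sub_C_ne_zero r) hq0
  rw [← hq, natDegree_X_sub_C] at h1
  omega

/-- The branch points of a non-singular model. The two roots outside the unit disc are the
inverses of those of the reflected model. -/
theorem exists_isBranched {w : ℤ → ℤ → ℝ} (hw : IsWeight w) : ∃ x₁ x₂ x₃ μ ν : ℝ,
    IsBranched (wdisc w) x₁ x₂ x₃ μ ν ∧ (0 < x₁ → 0 ≤ -x₁ + (wcoeff w 0).eval x₁) := by
  obtain ⟨x₁, x₂, h1, h2, h3, h4, hx1, hx2, hb⟩ := exists_two_roots hw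
  obtain ⟨r₁, r₂, g1, g2, g3, g4, hr1, hr2, -⟩ := exists_two_roots hw.reflect
  have hx3 : (wdisc w).eval r₂⁻¹ = 0 := by
    rw [eval_wdisc_reflect w g3.ne'] at hr2
    exact (mul_eq_zero.1 hr2).resolve_left (pow_ne_zero _ g3.ne')
  have h5 : 1 < r₂⁻¹ := (one_lt_inv₀ g3).2 g4
  obtain ⟨q1, hq1, e1⟩ := exists_factor_of_root (n := 3) (natDegree_wdisc_le w) hx3
  have hx2' : q1.eval x₂ = 0 := by
    rw [e1] at hx2
    simp only [eval_mul, eval_sub, eval_X, eval_C] at hx2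
    exact (mul_eq_zero.1 hx2).resolve_right (by intro; linarith)
  obtain ⟨q2, hq2, e2⟩ := exists_factor_of_root (n := 2) hq1 hx2'
  have hx1' : q2.eval x₁ = 0 := by
    rw [e1, e2] at hx1
    simp only [eval_mul, eval_sub, eval_X, eval_C] at hx1
    exact ((mul_eq_zero.1 ((mul_eq_zero.1 hx1).resolve_right (by intro; linarith))).resolve_right
      (by intro; linarith))
  obtain ⟨q3, hq3, e3⟩ := exists_factor_of_root (n := 1) hq2 hx1'
  obtain ⟨μ, ν', e4⟩ := exists_eq_X_add_C_of_natDegree_le_one hq3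
  obtain ⟨ν, rfl⟩ : ∃ ν, ν' = -ν := ⟨-ν', by ring⟩
  have fac : wdisc w = (C μ * X - C ν) * (X - C x₁) * (X - C x₂) * (X - C r₂⁻¹) := by
    rw [e1, e2, e3, e4, C_neg]; ring
  have ev : ∀ t, (wdisc w).eval t = (μ * t - ν) * (t - x₁) * (t - x₂) * (t - r₂⁻¹) := by
    intro t; rw [fac]; simp
  have hp1 := eval_wdisc_one_pos hw
  have hm1 := eval_wdisc_neg_one_pos hw
  rw [ev] at hp1 hm1
  have hp1' : μ < ν := by
    have a1 : 0 < (1 - x₁) * (1 - x₂) := mul_pos (by linarith) (by linarith)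
    have a2 : r₂⁻¹ - 1 > 0 := by linarith
    have a3 := mul_pos a1 a2
    by_contra hc
    have a4 : 0 ≤ μ - ν := by linarith
    nlinarith [mul_nonneg a4 a3.le]
  have hm1' : -μ < ν := by
    have a1 : 0 < (1 + x₁) * (1 + x₂) := mul_pos (by linarith) (by linarith)
    have a3 := mul_pos a1 (show 0 < 1 + r₂⁻¹ by linarith)
    by_contra hc
    have a4 : 0 ≤ -(μ + ν) := by linarith
    nlinarith [mul_nonneg a4 a3.le]
  have hν : 0 < ν := by linarith
  -- the reversed polynomial is `(μ - ν t) (1 - x₁ t) (1 - x₂ t) (1 - t / r₂)`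
  have hμ : μ = ν * r₁ := by
    rcases eq_or_ne r₁ 0 with h0 | h0
    · have := coeff_wdisc w 4
      have h6 : wdcoeff w 4 = 0 := by
        have := wdcoeff_reflect w 0 (by norm_num)
        rw [Nat.sub_zero] at this
        rw [h0] at hr1
        rw [← this, ← coeff_wdisc, coeff_zero_eq_eval_zero, hr1]
      have h7 : (wdisc w).coeff 4 = μ := by
        have : wdisc w = C μ * X ^ 4 + C (-μ * (x₁ + x₂ + r₂⁻¹) - ν) * X ^ 3
            + C (μ * (x₁ * x₂ + x₁ * r₂⁻¹ + x₂ * r₂⁻¹) + ν * (x₁ + x₂ + r₂⁻¹)) * X ^ 2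
            + C (-μ * (x₁ * x₂ * r₂⁻¹) - ν * (x₁ * x₂ + x₁ * r₂⁻¹ + x₂ * r₂⁻¹)) * X
            + C (ν * (x₁ * x₂ * r₂⁻¹)) := by
          rw [fac]
          simp only [map_add, map_sub, map_mul, map_neg]
          ring
        rw [this]
        simp only [coeff_add, coeff_C_mul, coeff_X_pow, coeff_X, coeff_C]
        norm_num
      rw [h0, mul_zero, ← h7, this, h6]
    · rw [eval_wdisc_reflect w h0, ev] at hr1
      have h6 : (μ * r₁⁻¹ - ν) * (r₁⁻¹ - x₁) * (r₁⁻¹ - x₂) * (r₁⁻¹ - r₂⁻¹) = 0 :=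
        (mul_eq_zero.1 hr1).resolve_left (pow_ne_zero _ h0)
      have h7 : r₁⁻¹ - r₂⁻¹ ≠ 0 := by
        rw [sub_ne_zero]
        exact fun h => g2.ne (inv_injective h)
      have h8 : 1 < |r₁⁻¹| := by
        rw [abs_inv]
        exact (one_lt_inv₀ (abs_pos.2 h0)).2 (abs_lt.2 ⟨g1, g2.trans g4⟩)
      have h9 : r₁⁻¹ - x₁ ≠ 0 := by
        rw [sub_ne_zero]
        intro h
        rw [h, lt_abs] at h8
        rcases h8 with h8 | h8 <;> linarith
      have h10 : r₁⁻¹ - x₂ ≠ 0 := by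
        rw [sub_ne_zero]
        intro h
        rw [h, lt_abs] at h8
        rcases h8 with h8 | h8 <;> linarith
      have h11 : μ * r₁⁻¹ - ν = 0 := by
        simpa [h7, h9, h10] using h6
      field_simp at h11
      linarith
  refine ⟨x₁, x₂, r₂⁻¹, μ, ν, ⟨fac, h1, h2, h3, h4, h5, hm1', ?_⟩, hb⟩
  rw [hμ, ← div_eq_mul_inv, div_lt_iff₀ g3]
  exact mul_lt_mul_of_pos_left g2 hν

/-! ### The Weierstrass form of a quartic -/

/-- The invariant `g₂` of the curve `s² = 4 p(t)`. -/
def quarticG2 (p : ℝ[X]) : ℝ :=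
  16 * (p.coeff 4 * p.coeff 0 - p.coeff 3 * p.coeff 1 / 4 + p.coeff 2 ^ 2 / 12)

/-- The invariant `g₃` of the curve `s² = 4 p(t)`. -/
def quarticG3 (p : ℝ[X]) : ℝ :=
  64 * (p.coeff 4 * p.coeff 2 * p.coeff 0 / 6 + p.coeff 3 * p.coeff 2 * p.coeff 1 / 48
    - p.coeff 2 ^ 3 / 216 - p.coeff 4 * p.coeff 1 ^ 2 / 16 - p.coeff 3 ^ 2 * p.coeff 0 / 16)

/-- The two discriminants of a biquadratic kernel have the same invariants. -/
lemma quarticG2_transpose (w : ℤ → ℤ → ℝ) :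
    quarticG2 (wdisc fun i j => w j i) = quarticG2 (wdisc w) := by
  simp only [quarticG2, coeff_wdisc, wdcoeff]
  ring

lemma quarticG3_transpose (w : ℤ → ℤ → ℝ) :
    quarticG3 (wdisc fun i j => w j i) = quarticG3 (wdisc w) := by
  simp only [quarticG3, coeff_wdisc, wdcoeff]
  ring

/-- The homogeneous form of degree four attached to `p`. -/
def homEval (p : ℝ[X]) (s t : ℂ) : ℂ :=
  p.coeff 0 * t ^ 4 + p.coeff 1 * s * t ^ 3 + p.coeff 2 * s ^ 2 * t ^ 2 + p.coeff 3 * s ^ 3 * t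
    + p.coeff 4 * s ^ 4

lemma eq_sum_coeff_of_natDegree_le {p : ℝ[X]} (hp : p.natDegree ≤ 4) :
    p = C (p.coeff 0) + C (p.coeff 1) * X + C (p.coeff 2) * X ^ 2 + C (p.coeff 3) * X ^ 3
      + C (p.coeff 4) * X ^ 4 := by
  conv_lhs => rw [p.as_sum_range_C_mul_X_pow' (n := 5) (by omega)]
  simp [Finset.sum_range_succ]

lemma homEval_eq {p : ℝ[X]} (hp : p.natDegree ≤ 4) (s : ℂ) {t : ℂ} (ht : t ≠ 0) :
    homEval p s t = t ^ 4 * aeval (s / t) p := by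
  conv_rhs => rw [eq_sum_coeff_of_natDegree_le hp]
  simp only [homEval, map_add, map_mul, aeval_C, map_pow, aeval_X, Complex.coe_algebraMap]
  field_simp

lemma aeval_ofReal_eq (p : ℝ[X]) (t : ℝ) : aeval (t : ℂ) p = (p.eval t : ℝ) := by
  rw [← Complex.coe_algebraMap, aeval_algebraMap_apply, coe_aeval_eq_eval]

/-- The inverse of `g(t) = p''(t₄) / 6 + p'(t₄) / (t - t₄)`, or of
`g(t) = p''(0) / 6 + p'''(0) t / 6`, is the Möbius transformation `u ↦ (A u + B) / (Γ u + D)`. It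
transforms `4 p` into the Weierstrass cubic. -/
structure IsUniformizer (p : ℝ[X]) (μ ν A B Γ D : ℝ) : Prop where
  det_neg : A * D - B * Γ < 0
  prop : ∃ k : ℝ, k ≠ 0 ∧ A = k * ν ∧ Γ = k * μ
  gInv_infty : gInv p (branch4 p) OnePoint.infty =
    if Γ = 0 then OnePoint.infty else (((A : ℂ) / Γ : ℂ) : OnePoint ℂ)
  gInv_coe : ∀ u : ℂ, gInv p (branch4 p) (u : OnePoint ℂ) =
    if Γ * u + D = 0 then OnePoint.infty else (((A * u + B) / (Γ * u + D) : ℂ) : OnePoint ℂ)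
  homEval_eq : ∀ u : ℂ, 4 * homEval p (A * u + B) (Γ * u + D) =
    (A * D - B * Γ) ^ 2 * (4 * u ^ 3 - quarticG2 p * u - quarticG3 p)

lemma eval_derivative_of_natDegree_le {p : ℝ[X]} (hp : p.natDegree ≤ 4) (t : ℝ) :
    (derivative p).eval t = p.coeff 1 + 2 * p.coeff 2 * t + 3 * p.coeff 3 * t ^ 2
      + 4 * p.coeff 4 * t ^ 3 := by
  conv_lhs => rw [eq_sum_coeff_of_natDegree_le hp]
  simp only [derivative_add, derivative_C, derivative_C_mul, derivative_X, derivative_X_pow,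
    eval_add, eval_mul, eval_C, eval_pow, eval_X, eval_zero, eval_one]
  norm_num
  ring

lemma eval_derivative_two_of_natDegree_le {p : ℝ[X]} (hp : p.natDegree ≤ 4) (t : ℝ) :
    (derivative^[2] p).eval t = 2 * p.coeff 2 + 6 * p.coeff 3 * t
      + 12 * p.coeff 4 * t ^ 2 := by
  conv_lhs => rw [eq_sum_coeff_of_natDegree_le hp]
  simp only [Function.iterate_succ, Function.iterate_zero, Function.comp, id,
    derivative_add, derivative_C, derivative_C_mul, derivative_X, derivative_X_pow,
    eval_add, eval_mul, eval_C, eval_pow, eval_X]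
  norm_num
  ring

lemma eval_derivative_three_of_natDegree_le {p : ℝ[X]} (hp : p.natDegree ≤ 4) (t : ℝ) :
    (derivative^[3] p).eval t = 6 * p.coeff 3 + 24 * p.coeff 4 * t := by
  conv_lhs => rw [eq_sum_coeff_of_natDegree_le hp]
  simp only [Function.iterate_succ, Function.iterate_zero, Function.comp, id,
    derivative_add, derivative_C, derivative_C_mul, derivative_X, derivative_X_pow,
    eval_add, eval_mul, eval_C, eval_pow, eval_X]
  norm_num
  ring

namespace IsBranched

variable {p : ℝ[X]} {x₁ x₂ x₃ μ ν : ℝ}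

lemma eq_sum (h : IsBranched p x₁ x₂ x₃ μ ν) :
    p = C (ν * (x₁ * x₂ * x₃))
      + C (-μ * (x₁ * x₂ * x₃) - ν * (x₁ * x₂ + x₁ * x₃ + x₂ * x₃)) * X
      + C (μ * (x₁ * x₂ + x₁ * x₃ + x₂ * x₃) + ν * (x₁ + x₂ + x₃)) * X ^ 2
      + C (-μ * (x₁ + x₂ + x₃) - ν) * X ^ 3 + C μ * X ^ 4 := by
  rw [h.fac]
  simp only [map_add, map_sub, map_mul, map_neg]
  ring

lemma natDegree_le (h : IsBranched p x₁ x₂ x₃ μ ν) : p.natDegree ≤ 4 := by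
  rw [h.eq_sum]
  compute_degree

lemma coeff_three (h : IsBranched p x₁ x₂ x₃ μ ν) :
    p.coeff 3 = -μ * (x₁ + x₂ + x₃) - ν := by
  rw [h.eq_sum]
  simp only [coeff_add, coeff_C_mul, coeff_X_pow, coeff_X, coeff_C]
  norm_num

lemma coeff_four (h : IsBranched p x₁ x₂ x₃ μ ν) : p.coeff 4 = μ := by
  rw [h.eq_sum]
  simp only [coeff_add, coeff_C_mul, coeff_X_pow, coeff_X, coeff_C]
  norm_num

lemma eval_derivative_root (h : IsBranched p x₁ x₂ x₃ μ ν) {t : ℝ} (ht : μ * t = ν) :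
    (derivative p).eval t = μ * ((t - x₁) * (t - x₂) * (t - x₃)) := by
  rw [h.fac]
  simp only [derivative_mul, derivative_sub, derivative_C, derivative_X, eval_add,
    eval_mul, eval_sub, eval_X, eval_C, eval_zero, eval_one]
  rw [ht]
  ring

end IsBranched

lemma exists_isUniformizer {p : ℝ[X]} {x₁ x₂ x₃ μ ν : ℝ} (h : IsBranched p x₁ x₂ x₃ μ ν) :
    ∃ A B Γ D : ℝ, IsUniformizer p μ ν A B Γ D := by
  have hdeg := h.natDegree_le
  have hν := h.nu_pos
  have h1 := h.neg_one_lt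
  have h2 := h.lt₁₂
  have h3 := h.lt_one
  have h4 := h.one_lt
  by_cases hμ : μ = 0
  · have c4 : p.coeff 4 = 0 := by rw [h.coeff_four, hμ]
    have c3 : p.coeff 3 = -ν := by rw [h.coeff_three, hμ]; ring
    have c3' : (p.coeff 3 : ℂ) ≠ 0 := by rw [c3]; exact_mod_cast (neg_ne_zero.2 hν.ne')
    have d2 : (derivative^[2] p).eval 0 = 2 * p.coeff 2 := by
      rw [eval_derivative_two_of_natDegree_le hdeg]; ring
    have d3 : (derivative^[3] p).eval 0 = 6 * p.coeff 3 := by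
      rw [eval_derivative_three_of_natDegree_le hdeg]; ring
    refine ⟨6, -(2 * p.coeff 2), 0, 6 * p.coeff 3, ?_, ⟨6 / ν, by positivity, ?_, ?_⟩, ?_, ?_, ?_⟩
    · rw [c3]; linarith
    · field_simp
    · rw [hμ, mul_zero]
    · rw [h.branch4_eq_infty hμ, if_pos rfl]
      rfl
    · intro u
      have hne : ¬ (((0 : ℝ) : ℂ) * u + ((6 * p.coeff 3 : ℝ) : ℂ) = 0) := by
        push_cast
        simpa using c3'
      rw [h.branch4_eq_infty hμ, if_neg hne]
      change (((6 * u - ((derivative^[2] p).eval 0 : ℝ)) / ((derivative^[3] p).eval 0 : ℝ) : ℂ) :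
        OnePoint ℂ) = _
      rw [d2, d3]
      congr 1
      push_cast
      ring
    · intro u
      simp only [homEval, quarticG2, quarticG3, c4]
      push_cast
      ring
  · set t := ν / μ with ht
    have hroot : μ * t = ν := by rw [ht]; field_simp
    have hev : p.eval t = 0 := (h.eval_eq_zero_iff t).2 (Or.inl hroot)
    have hder : 0 < (derivative p).eval t := by
      rw [h.eval_derivative_root hroot]
      rcases lt_or_gt_of_ne hμ with hm | hm
      · have : t < -1 := by
          rw [ht, div_lt_iff_of_neg hm]
          linarith [h.neg_lt]
        have e1 : 0 < (t - x₁) * (t - x₂) := mul_pos_of_neg_of_neg (by linarith) (by linarith)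
        exact mul_pos_of_neg_of_neg hm (mul_neg_of_pos_of_neg e1 (by linarith))
      · have : x₃ < t := by
          rw [ht, lt_div_iff₀ hm]
          linarith [h.mul_lt]
        have e1 : 0 < (t - x₁) * (t - x₂) := mul_pos (by linarith) (by linarith)
        exact mul_pos hm (mul_pos e1 (by linarith))
    have hev' : p.coeff 0 = -(p.coeff 1 * t + p.coeff 2 * t ^ 2 + p.coeff 3 * t ^ 3
        + p.coeff 4 * t ^ 4) := by
      rw [eq_sum_coeff_of_natDegree_le hdeg] at hev
      simp only [eval_add, eval_mul, eval_C, eval_pow, eval_X] at hev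
      linarith
    set q1 := (derivative p).eval t with hq1
    set q2 := (derivative^[2] p).eval t with hq2
    refine ⟨t, q1 - t * (q2 / 6), 1, -(q2 / 6), ?_, ⟨μ⁻¹, inv_ne_zero hμ, ?_, ?_⟩, ?_, ?_, ?_⟩
    · linarith
    · rw [ht]; field_simp
    · field_simp
    · rw [h.branch4_eq_some hμ, if_neg one_ne_zero]
      change ((t : ℂ) : OnePoint ℂ) = _
      simp
    · intro u
      rw [h.branch4_eq_some hμ]
      change (if u = ((q2 / 6 : ℝ) : ℂ) then OnePoint.infty
        else ((t + (q1 : ℝ) / (u - (q2 / 6 : ℝ)) : ℂ) : OnePoint ℂ)) = _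
      have hiff : u = ((q2 / 6 : ℝ) : ℂ) ↔ ((1 : ℝ) : ℂ) * u + ((-(q2 / 6) : ℝ) : ℂ) = 0 := by
        push_cast
        rw [one_mul, ← sub_eq_add_neg, sub_eq_zero]
      by_cases hu : u = ((q2 / 6 : ℝ) : ℂ)
      · rw [if_pos hu, if_pos (hiff.1 hu)]
      · rw [if_neg hu, if_neg (fun hh => hu (hiff.2 hh))]
        congr 1
        have hu' : u - ((q2 / 6 : ℝ) : ℂ) ≠ 0 := sub_ne_zero.2 hu
        have e : ((1 : ℝ) : ℂ) * u + ((-(q2 / 6) : ℝ) : ℂ) = u - ((q2 / 6 : ℝ) : ℂ) := by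
          push_cast; ring
        rw [e, eq_div_iff hu', add_mul, div_mul_cancel₀ _ hu']
        push_cast
        ring
    · intro u
      rw [eval_derivative_of_natDegree_le hdeg] at hq1
      rw [eval_derivative_two_of_natDegree_le hdeg] at hq2
      simp only [homEval, quarticG2, quarticG3, hev', hq1, hq2]
      push_cast
      ring

/-! ### Roots of Weierstrass cubics -/

lemma cubic_of_roots {F : Type*} [Field F] {g₂ g₃ r₁ r₂ r₃ : F}
    (h₁ : 4 * r₁ ^ 3 - g₂ * r₁ - g₃ = 0) (h₂ : 4 * r₂ ^ 3 - g₂ * r₂ - g₃ = 0)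
    (h₃ : 4 * r₃ ^ 3 - g₂ * r₃ - g₃ = 0) (h₁₂ : r₁ ≠ r₂) (h₁₃ : r₁ ≠ r₃) (h₂₃ : r₂ ≠ r₃)
    (h4 : (4 : F) ≠ 0) :
    r₁ + r₂ + r₃ = 0 ∧ ∀ u, 4 * u ^ 3 - g₂ * u - g₃ = 4 * (u - r₁) * (u - r₂) * (u - r₃) := by
  have a1 : 4 * (r₁ ^ 2 + r₁ * r₂ + r₂ ^ 2) = g₂ :=
    mul_left_cancel₀ (sub_ne_zero.2 h₁₂) (by linear_combination h₁ - h₂)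
  have a2 : 4 * (r₁ ^ 2 + r₁ * r₃ + r₃ ^ 2) = g₂ :=
    mul_left_cancel₀ (sub_ne_zero.2 h₁₃) (by linear_combination h₁ - h₃)
  have a3 : r₁ + r₂ + r₃ = 0 :=
    mul_left_cancel₀ h4 (mul_left_cancel₀ (sub_ne_zero.2 h₂₃) (by linear_combination a1 - a2))
  refine ⟨a3, fun u => ?_⟩
  have a4 : r₃ = -r₁ - r₂ := by linear_combination a3
  have a5 : g₃ = 4 * r₁ ^ 3 - g₂ * r₁ := by linear_combination -h₁
  rw [a5, ← a1, a4]
  ring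

/-- A strictly decreasing triple of reals with sum zero: the roots of a Weierstrass cubic. -/
structure IsRootTriple (e₁ e₂ e₃ : ℝ) : Prop where
  lt₁₂ : e₂ < e₁
  lt₂₃ : e₃ < e₂
  sum : e₁ + e₂ + e₃ = 0

/-- The Weierstrass cubic with roots `e₁, e₂, e₃`. -/
def cubic (e₁ e₂ e₃ u : ℝ) : ℝ := 4 * (u - e₁) * (u - e₂) * (u - e₃)

lemma IsRootTriple.unique {e₁ e₂ e₃ f₁ f₂ f₃ : ℝ} (he : IsRootTriple e₁ e₂ e₃)
    (hf : IsRootTriple f₁ f₂ f₃) (h : ∀ u, cubic e₁ e₂ e₃ u = cubic f₁ f₂ f₃ u) :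
    e₁ = f₁ ∧ e₂ = f₂ ∧ e₃ = f₃ := by
  have key : ∀ u, cubic f₁ f₂ f₃ u = 0 → u = e₁ ∨ u = e₂ ∨ u = e₃ := by
    intro u hu
    rw [← h] at hu
    simpa [cubic, sub_eq_zero, or_assoc] using hu
  have a1 := key f₁ (by simp [cubic])
  have a2 := key f₂ (by simp [cubic])
  have a3 := key f₃ (by simp [cubic])
  have := he.lt₁₂; have := he.lt₂₃; have := hf.lt₁₂; have := hf.lt₂₃
  rcases a1 with a1 | a1 | a1 <;> rcases a2 with a2 | a2 | a2 <;> rcases a3 with a3 | a3 | a3 <;>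
    first
    | exact ⟨a1.symm, a2.symm, a3.symm⟩
    | (exfalso; linarith)

/-! ### The finite branch points in Weierstrass coordinates -/

section Inverse

variable {p : ℝ[X]} {x₁ x₂ x₃ μ ν A B Γ D : ℝ}

/-- The real Möbius transformation `g` with inverse `u ↦ (A u + B) / (Γ u + D)`. -/
def mobInv (A B Γ D t : ℝ) : ℝ := (D * t - B) / (A - Γ * t)

lemma IsUniformizer.lin_mul_pos (h : IsBranched p x₁ x₂ x₃ μ ν) (hu : IsUniformizer p μ ν A B Γ D)
    {s t : ℝ} (hs : -1 ≤ s) (hs' : s ≤ x₃) (ht : -1 ≤ t) (ht' : t ≤ x₃) :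
    0 < (A - Γ * s) * (A - Γ * t) := by
  obtain ⟨k, hk, rfl, rfl⟩ := hu.prop
  have h1 := h.lin_neg hs hs'
  have h2 := h.lin_neg ht ht'
  have : (k * ν - k * μ * s) * (k * ν - k * μ * t) = k ^ 2 * ((μ * s - ν) * (μ * t - ν)) := by ring
  rw [this]
  have := mul_pos_of_neg_of_neg h1 h2
  positivity

lemma IsUniformizer.lin_ne_zero (h : IsBranched p x₁ x₂ x₃ μ ν)
    (hu : IsUniformizer p μ ν A B Γ D) {t : ℝ} (ht : -1 ≤ t) (ht' : t ≤ x₃) : A - Γ * t ≠ 0 :=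
  left_ne_zero_of_mul (hu.lin_mul_pos h ht ht' ht ht').ne'

lemma mobInv_sub {s t : ℝ} (hs : A - Γ * s ≠ 0) (ht : A - Γ * t ≠ 0) :
    mobInv A B Γ D s - mobInv A B Γ D t =
      (A * D - B * Γ) * (s - t) / ((A - Γ * s) * (A - Γ * t)) := by
  rw [mobInv, mobInv, div_sub_div _ _ hs ht]
  congr 1
  ring

lemma IsUniformizer.strictAntiOn (h : IsBranched p x₁ x₂ x₃ μ ν)
    (hu : IsUniformizer p μ ν A B Γ D) : StrictAntiOn (mobInv A B Γ D) (Set.Icc (-1) x₃) := by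
  intro s hs t ht hst
  rw [← sub_pos, mobInv_sub (hu.lin_ne_zero h hs.1 hs.2) (hu.lin_ne_zero h ht.1 ht.2)]
  exact div_pos (mul_pos_of_neg_of_neg hu.det_neg (by linarith))
    (hu.lin_mul_pos h hs.1 hs.2 ht.1 ht.2)

lemma hasDerivAt_mobInv {t : ℝ} (ht : A - Γ * t ≠ 0) :
    HasDerivAt (mobInv A B Γ D) ((A * D - B * Γ) / (A - Γ * t) ^ 2) t := by
  have h1 : HasDerivAt (fun t : ℝ => D * t - B) D t := by
    simpa using ((hasDerivAt_id t).const_mul D).sub_const B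
  have h2 : HasDerivAt (fun t : ℝ => A - Γ * t) (-Γ) t := by
    simpa using ((hasDerivAt_id t).const_mul Γ).const_sub A
  have h3 := h1.div h2 ht
  convert! h3 using 1
  congr 1
  ring

/-- The real form of the Weierstrass equation. -/
lemma IsUniformizer.cubic_mobInv (hp : p.natDegree ≤ 4) (hu : IsUniformizer p μ ν A B Γ D)
    {t : ℝ} (ht : A - Γ * t ≠ 0) :
    4 * mobInv A B Γ D t ^ 3 - quarticG2 p * mobInv A B Γ D t - quarticG3 p =
      4 * p.eval t * ((A * D - B * Γ) / (A - Γ * t) ^ 2) ^ 2 := by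
  have h1 := hu.homEval_eq (mobInv A B Γ D t : ℝ)
  have hd : A * D - B * Γ ≠ 0 := hu.det_neg.ne
  have e1 : (A : ℂ) * (mobInv A B Γ D t : ℝ) + B
      = (((A * D - B * Γ) / (A - Γ * t) * t : ℝ) : ℂ) := by
    rw [mobInv, ← Complex.ofReal_mul, ← Complex.ofReal_add]
    congr 1
    rw [mul_div_assoc', div_mul_eq_mul_div, div_add' _ _ _ ht]
    congr 1
    ring
  have e2 : (Γ : ℂ) * (mobInv A B Γ D t : ℝ) + D = (((A * D - B * Γ) / (A - Γ * t) : ℝ) : ℂ) := by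
    rw [mobInv, ← Complex.ofReal_mul, ← Complex.ofReal_add]
    congr 1
    rw [mul_div_assoc', div_add' _ _ _ ht]
    congr 1
    ring
  have e3 : (((A * D - B * Γ) / (A - Γ * t) : ℝ) : ℂ) ≠ 0 := by
    exact_mod_cast div_ne_zero hd ht
  rw [e1, e2, QuarterPlane.homEval_eq hp _ e3, ← Complex.ofReal_div, mul_div_cancel_left₀ _
    (div_ne_zero hd ht), aeval_ofReal_eq] at h1
  have h2 : 4 * (((A * D - B * Γ) / (A - Γ * t)) ^ 4 * p.eval t) = (A * D - B * Γ) ^ 2 *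
      (4 * mobInv A B Γ D t ^ 3 - quarticG2 p * mobInv A B Γ D t - quarticG3 p) := by
    exact_mod_cast h1
  have hd2 : (A * D - B * Γ) ^ 2 ≠ 0 := pow_ne_zero _ hd
  apply mul_left_cancel₀ hd2
  rw [← h2]
  field_simp

/-- The images of the finite branch points are the roots of the Weierstrass cubic. -/
lemma IsUniformizer.isRootTriple (h : IsBranched p x₁ x₂ x₃ μ ν)
    (hu : IsUniformizer p μ ν A B Γ D) :
    IsRootTriple (mobInv A B Γ D x₁) (mobInv A B Γ D x₂) (mobInv A B Γ D x₃) ∧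
    ∀ u, 4 * u ^ 3 - quarticG2 p * u - quarticG3 p =
      cubic (mobInv A B Γ D x₁) (mobInv A B Γ D x₂) (mobInv A B Γ D x₃) u := by
  have h1 := h.neg_one_lt
  have h2 := h.lt₁₂
  have h3 := h.lt_one
  have h4 := h.one_lt
  have m1 : x₁ ∈ Set.Icc (-1) x₃ := ⟨by linarith, by linarith⟩
  have m2 : x₂ ∈ Set.Icc (-1) x₃ := ⟨by linarith, by linarith⟩
  have m3 : x₃ ∈ Set.Icc (-1) x₃ := ⟨by linarith, by linarith⟩
  have l12 := hu.strictAntiOn h m1 m2 h2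
  have l23 := hu.strictAntiOn h m2 m3 (by linarith)
  have root : ∀ t ∈ Set.Icc (-1) x₃, p.eval t = 0 →
      4 * mobInv A B Γ D t ^ 3 - quarticG2 p * mobInv A B Γ D t - quarticG3 p = 0 := by
    intro t ht h0
    rw [hu.cubic_mobInv h.natDegree_le (hu.lin_ne_zero h ht.1 ht.2), h0]
    ring
  obtain ⟨s1, s2⟩ := cubic_of_roots (root x₁ m1 ((h.eval_eq_zero_iff _).2 (by simp)))
    (root x₂ m2 ((h.eval_eq_zero_iff _).2 (by simp)))
    (root x₃ m3 ((h.eval_eq_zero_iff _).2 (by simp))) l12.ne' (l23.trans l12).ne' l23.ne'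
    (by norm_num)
  exact ⟨⟨l12, l23, s1⟩, s2⟩

lemma IsUniformizer.image_Ioo (h : IsBranched p x₁ x₂ x₃ μ ν)
    (hu : IsUniformizer p μ ν A B Γ D) {s t : ℝ} (hs : -1 ≤ s) (hst : s ≤ t) (ht : t ≤ x₃) :
    mobInv A B Γ D '' Set.Ioo s t = Set.Ioo (mobInv A B Γ D t) (mobInv A B Γ D s) := by
  have hsub : Set.Icc s t ⊆ Set.Icc (-1) x₃ := Set.Icc_subset_Icc hs ht
  have hanti := (hu.strictAntiOn h).mono hsub
  apply Set.Subset.antisymm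
  · rintro _ ⟨r, hr, rfl⟩
    exact ⟨hanti (Set.Ioo_subset_Icc_self hr) (Set.right_mem_Icc.2 hst) hr.2,
      hanti (Set.left_mem_Icc.2 hst) (Set.Ioo_subset_Icc_self hr) hr.1⟩
  · exact intermediate_value_Ioo' hst fun r hr =>
      (hasDerivAt_mobInv (hu.lin_ne_zero h (hsub hr).1 (hsub hr).2)).continuousAt.continuousWithinAt

/-- Change of variables from the `t`-line to the `u`-line in the period integrals. -/
lemma integral_mobInv {s : Set ℝ} (hs : MeasurableSet s) (hp : p.natDegree ≤ 4)
    (hu : IsUniformizer p μ ν A B Γ D)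
    (hlin : ∀ t ∈ s, A - Γ * t ≠ 0) (σ : ℝ) :
    ∫ u in mobInv A B Γ D '' s,
      2 / √(σ * (4 * u ^ 3 - quarticG2 p * u - quarticG3 p)) =
    ∫ t in s, 1 / √(σ * p.eval t) := by
  have hinj : Set.InjOn (mobInv A B Γ D) s := by
    intro a ha b hb hab
    have h1 := mobInv_sub (B := B) (D := D) (hlin a ha) (hlin b hb)
    rw [hab, sub_self] at h1
    have h2 := (div_eq_zero_iff.1 h1.symm).resolve_right
      (mul_ne_zero (hlin a ha) (hlin b hb))
    exact sub_eq_zero.1 ((mul_eq_zero.1 h2).resolve_left hu.det_neg.ne)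
  rw [integral_image_eq_integral_abs_deriv_smul hs
    (fun t ht => (hasDerivAt_mobInv (hlin t ht)).hasDerivWithinAt) hinj]
  refine setIntegral_congr_fun hs fun t ht => ?_
  simp only [smul_eq_mul]
  rw [hu.cubic_mobInv hp (hlin t ht)]
  set m := (A * D - B * Γ) / (A - Γ * t) ^ 2
  have hm : |m| ≠ 0 := abs_ne_zero.2 (div_ne_zero hu.det_neg.ne (pow_ne_zero _ (hlin t ht)))
  have e : σ * (4 * p.eval t * m ^ 2) = (2 * |m|) ^ 2 * (σ * p.eval t) := by
    rw [mul_pow, sq_abs]; ring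
  rw [e, Real.sqrt_mul (by positivity), Real.sqrt_sq (by positivity)]
  field_simp

end Inverse

/-! ### Injectivity of the real period map -/

/-- The complete elliptic integral `∫₀¹ dw / √(w (1 - w) (1 - m w))`. -/
def ellipticIntegral (m : ℝ) : ℝ := ∫ w in Set.Ioo (0 : ℝ) 1, 1 / √(w * (1 - w) * (1 - m * w))

lemma integrableOn_ellipticIntegral {m : ℝ} (h1 : m < 1) :
    IntegrableOn (fun w : ℝ => 1 / √(w * (1 - w) * (1 - m * w))) (Set.Ioo 0 1) := by
  have i1 : IntegrableOn (fun w : ℝ => w ^ (-(1 / 2) : ℝ)) (Set.Ioo 0 1) := by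
    have := intervalIntegral.intervalIntegrable_rpow' (a := 0) (b := 1)
      (r := -(1 / 2 : ℝ)) (by norm_num)
    rw [intervalIntegrable_iff_integrableOn_Ioo_of_le zero_le_one] at this
    exact this
  have i2 : IntegrableOn (fun w : ℝ => (1 - w) ^ (-(1 / 2) : ℝ)) (Set.Ioo 0 1) := by
    have := (intervalIntegral.intervalIntegrable_rpow' (a := 0) (b := 1)
      (r := -(1 / 2 : ℝ)) (by norm_num)).comp_sub_left 1
    rw [sub_zero, sub_self] at this
    have := this.symm
    rw [intervalIntegrable_iff_integrableOn_Ioo_of_le zero_le_one] at this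
    exact this
  set M := min 1 (1 - m) with hM
  have hM0 : 0 < M := lt_min one_pos (by linarith)
  refine Integrable.mono' ((i1.add i2).const_mul (1 / √M)) ?_ ?_
  · refine Measurable.aestronglyMeasurable ?_
    fun_prop
  · refine (ae_restrict_iff' measurableSet_Ioo).2 (Filter.Eventually.of_forall fun w hw => ?_)
    obtain ⟨hw0, hw1⟩ := hw
    have hw1' : 0 < 1 - w := by linarith
    have hmw : M ≤ 1 - m * w := by
      rcases le_total m 0 with hm | hm
      · exact (min_le_left _ _).trans (by nlinarith)
      · exact (min_le_right _ _).trans (by nlinarith)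
    have e1 : w ^ (-(1 / 2) : ℝ) = 1 / √w := by
      rw [Real.rpow_neg hw0.le, Real.sqrt_eq_rpow, ← one_div]
    have e2 : (1 - w) ^ (-(1 / 2) : ℝ) = 1 / √(1 - w) := by
      rw [Real.rpow_neg hw1'.le, Real.sqrt_eq_rpow, ← one_div]
    simp only [Pi.add_apply]
    rw [e1, e2, Real.norm_of_nonneg (by positivity), Real.sqrt_mul (by positivity),
      Real.sqrt_mul hw0.le]
    have s1 := Real.sqrt_pos.2 hw0
    have s2 := Real.sqrt_pos.2 hw1'
    have s3 := Real.sqrt_pos.2 hM0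
    have s4 : √M ≤ √(1 - m * w) := Real.sqrt_le_sqrt hmw
    have s5 : 1 ≤ √w + √(1 - w) := by
      have a1 := Real.sq_sqrt hw0.le
      have a2 := Real.sq_sqrt hw1'.le
      nlinarith [mul_pos s1 s2]
    calc 1 / (√w * √(1 - w) * √(1 - m * w)) ≤ 1 / (√w * √(1 - w) * √M) := by gcongr
      _ ≤ (√w + √(1 - w)) / (√w * √(1 - w) * √M) := by gcongr
      _ = _ := by field_simp; ring

lemma ellipticIntegral_pos {m : ℝ} (h1 : m < 1) : 0 < ellipticIntegral m := by
  rw [ellipticIntegral, setIntegral_pos_iff_support_of_nonneg_ae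
    (Filter.Eventually.of_forall fun w => by positivity) (integrableOn_ellipticIntegral h1)]
  have : Function.support (fun w : ℝ => 1 / √(w * (1 - w) * (1 - m * w))) ∩ Set.Ioo 0 1 =
      Set.Ioo 0 1 := by
    refine Set.inter_eq_right.2 fun w hw => ?_
    obtain ⟨hw0, hw1⟩ := hw
    have hw1' : 0 < 1 - w := by linarith
    have hmw : 0 < 1 - m * w := by nlinarith
    rw [Function.mem_support]
    positivity
  rw [this]
  simp

lemma ellipticIntegral_lt {m m' : ℝ} (h : m < m') (h1 : m' < 1) :
    ellipticIntegral m < ellipticIntegral m' := by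
  have i1 := integrableOn_ellipticIntegral (h.trans h1)
  have i2 := integrableOn_ellipticIntegral h1
  have hlt : ∀ w ∈ Set.Ioo (0 : ℝ) 1,
      1 / √(w * (1 - w) * (1 - m * w)) < 1 / √(w * (1 - w) * (1 - m' * w)) := by
    rintro w ⟨hw0, hw1⟩
    have hw1' : 0 < 1 - w := by linarith
    have hmw : 0 < 1 - m' * w := by nlinarith
    apply one_div_lt_one_div_of_lt (Real.sqrt_pos.2 (by positivity))
    apply Real.sqrt_lt_sqrt (by positivity)
    apply mul_lt_mul_of_pos_left _ (by positivity)
    nlinarith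
  rw [← sub_pos, ellipticIntegral, ellipticIntegral, ← integral_sub i2 i1,
    setIntegral_pos_iff_support_of_nonneg_ae (f := fun w : ℝ => 1 / √(w * (1 - w) * (1 - m' * w))
        - 1 / √(w * (1 - w) * (1 - m * w))) ?_ (i2.sub i1)]
  · have : Function.support (fun w : ℝ => 1 / √(w * (1 - w) * (1 - m' * w))
        - 1 / √(w * (1 - w) * (1 - m * w))) ∩ Set.Ioo 0 1 = Set.Ioo 0 1 := by
      refine Set.inter_eq_right.2 fun w hw => ?_
      rw [Function.mem_support]
      exact (sub_pos.2 (hlt w hw)).ne'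
    rw [this]
    simp
  · refine (ae_restrict_iff' measurableSet_Ioo).2 (Filter.Eventually.of_forall fun w hw => ?_)
    exact (sub_pos.2 (hlt w hw)).le

/-- The real period `∫_{e₃}^{e₂} 2 du / √q(u)` of the cubic `q` with roots `e₁, e₂, e₃`. -/
def realPeriod (e₁ e₂ e₃ : ℝ) : ℝ := ∫ u in Set.Ioo e₃ e₂, 2 / √(cubic e₁ e₂ e₃ u)

/-- The imaginary period `∫_{e₂}^{e₁} 2 du / √(-q(u))` of the cubic `q` with roots
`e₁, e₂, e₃`. -/
def imagPeriod (e₁ e₂ e₃ : ℝ) : ℝ := ∫ u in Set.Ioo e₂ e₁, 2 / √(-cubic e₁ e₂ e₃ u)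

lemma image_affine_Ioo (c l : ℝ) (hl : 0 < l) :
    (fun w : ℝ => c + l * w) '' Set.Ioo 0 1 = Set.Ioo c (c + l) := by
  ext u
  constructor
  · rintro ⟨w, ⟨h0, h1⟩, rfl⟩
    constructor <;> nlinarith
  · rintro ⟨h0, h1⟩
    exact ⟨(u - c) / l, ⟨div_pos (by linarith) hl, (div_lt_one hl).2 (by linarith)⟩, by
      simp only; field_simp; ring⟩

lemma image_affine_neg_Ioo (c l : ℝ) (hl : 0 < l) :
    (fun w : ℝ => c - l * w) '' Set.Ioo 0 1 = Set.Ioo (c - l) c := by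
  ext u
  constructor
  · rintro ⟨w, ⟨h0, h1⟩, rfl⟩
    constructor <;> nlinarith
  · rintro ⟨h0, h1⟩
    exact ⟨(c - u) / l, ⟨div_pos (by linarith) hl, (div_lt_one hl).2 (by linarith)⟩, by
      simp only; field_simp; ring⟩

lemma realPeriod_eq {e₁ e₂ e₃ : ℝ} (h : IsRootTriple e₁ e₂ e₃) :
    realPeriod e₁ e₂ e₃ = ellipticIntegral ((e₂ - e₃) / (e₁ - e₃)) / √(e₁ - e₃) := by
  have h1 : 0 < e₁ - e₃ := by linarith [h.lt₁₂, h.lt₂₃]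
  have h2 : 0 < e₂ - e₃ := by linarith [h.lt₂₃]
  have him := image_affine_Ioo e₃ (e₂ - e₃) h2
  rw [add_sub_cancel] at him
  rw [realPeriod, ← him, integral_image_eq_integral_abs_deriv_smul (f' := fun _ => e₂ - e₃)
    measurableSet_Ioo, ellipticIntegral, ← integral_div]
  · refine setIntegral_congr_fun measurableSet_Ioo fun w hw => ?_
    simp only [smul_eq_mul]
    have e : cubic e₁ e₂ e₃ (e₃ + (e₂ - e₃) * w) = (2 * (e₂ - e₃)) ^ 2 * ((e₁ - e₃) *
        (w * (1 - w) * (1 - (e₂ - e₃) / (e₁ - e₃) * w))) := by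
      rw [cubic]
      have : (e₁ - e₃) * (1 - (e₂ - e₃) / (e₁ - e₃) * w) = (e₁ - e₃) - (e₂ - e₃) * w := by
        field_simp
      linear_combination -4 * (e₂ - e₃) ^ 2 * (w * (1 - w)) * this
    rw [e, Real.sqrt_mul (by positivity), Real.sqrt_sq (by positivity), Real.sqrt_mul h1.le,
      abs_of_pos h2]
    field_simp
  · intro w _
    have := ((hasDerivAt_id w).const_mul (e₂ - e₃)).const_add e₃
    simpa using this.hasDerivWithinAt
  · intro a _ b _ hab
    simpa [h2.ne'] using hab

lemma imagPeriod_eq {e₁ e₂ e₃ : ℝ} (h : IsRootTriple e₁ e₂ e₃) :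
    imagPeriod e₁ e₂ e₃ = ellipticIntegral ((e₁ - e₂) / (e₁ - e₃)) / √(e₁ - e₃) := by
  have h1 : 0 < e₁ - e₃ := by linarith [h.lt₁₂, h.lt₂₃]
  have h2 : 0 < e₁ - e₂ := by linarith [h.lt₁₂]
  have him := image_affine_neg_Ioo e₁ (e₁ - e₂) h2
  rw [sub_sub_cancel] at him
  rw [imagPeriod, ← him, integral_image_eq_integral_abs_deriv_smul (f' := fun _ => -(e₁ - e₂))
    measurableSet_Ioo, ellipticIntegral, ← integral_div]
  · refine setIntegral_congr_fun measurableSet_Ioo fun w hw => ?_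
    simp only [smul_eq_mul]
    have e : -cubic e₁ e₂ e₃ (e₁ - (e₁ - e₂) * w) = (2 * (e₁ - e₂)) ^ 2 * ((e₁ - e₃) *
        (w * (1 - w) * (1 - (e₁ - e₂) / (e₁ - e₃) * w))) := by
      rw [cubic]
      have : (e₁ - e₃) * (1 - (e₁ - e₂) / (e₁ - e₃) * w) = (e₁ - e₃) - (e₁ - e₂) * w := by
        field_simp
      linear_combination -4 * (e₁ - e₂) ^ 2 * (w * (1 - w)) * this
    rw [e, Real.sqrt_mul (by positivity), Real.sqrt_sq (by positivity), Real.sqrt_mul h1.le,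
      abs_neg, abs_of_pos h2]
    field_simp
  · intro w _
    have := ((hasDerivAt_id w).const_mul (e₁ - e₂)).const_sub e₁
    simpa using this.hasDerivWithinAt
  · intro a _ b _ hab
    simpa [h2.ne'] using hab

lemma IsRootTriple.modulus_lt_one {e₁ e₂ e₃ : ℝ} (h : IsRootTriple e₁ e₂ e₃) :
    (e₂ - e₃) / (e₁ - e₃) < 1 ∧ (e₁ - e₂) / (e₁ - e₃) < 1 ∧
      (e₁ - e₂) / (e₁ - e₃) = 1 - (e₂ - e₃) / (e₁ - e₃) := by
  have := h.lt₁₂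
  have := h.lt₂₃
  have h1 : 0 < e₁ - e₃ := by linarith
  refine ⟨(div_lt_one h1).2 (by linarith), (div_lt_one h1).2 (by linarith), ?_⟩
  field_simp
  ring

lemma realPeriod_pos {e₁ e₂ e₃ : ℝ} (h : IsRootTriple e₁ e₂ e₃) : 0 < realPeriod e₁ e₂ e₃ := by
  rw [realPeriod_eq h]
  exact div_pos (ellipticIntegral_pos h.modulus_lt_one.1)
    (Real.sqrt_pos.2 (by linarith [h.lt₁₂, h.lt₂₃]))

lemma imagPeriod_pos {e₁ e₂ e₃ : ℝ} (h : IsRootTriple e₁ e₂ e₃) : 0 < imagPeriod e₁ e₂ e₃ := by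
  rw [imagPeriod_eq h]
  exact div_pos (ellipticIntegral_pos h.modulus_lt_one.2.1)
    (Real.sqrt_pos.2 (by linarith [h.lt₁₂, h.lt₂₃]))

/-- A Weierstrass cubic with real roots is determined by its two periods: one complete elliptic
integral increases with the modulus and the other one decreases. -/
theorem IsRootTriple.eq_of_periods {e₁ e₂ e₃ f₁ f₂ f₃ : ℝ} (he : IsRootTriple e₁ e₂ e₃)
    (hf : IsRootTriple f₁ f₂ f₃) (hr : realPeriod e₁ e₂ e₃ = realPeriod f₁ f₂ f₃)
    (hi : imagPeriod e₁ e₂ e₃ = imagPeriod f₁ f₂ f₃) : e₁ = f₁ ∧ e₂ = f₂ ∧ e₃ = f₃ := by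
  -- a larger modulus forces a larger scale by the first period, and a smaller one by the second
  have key : ∀ {e₁ e₂ e₃ f₁ f₂ f₃ : ℝ}, IsRootTriple e₁ e₂ e₃ → IsRootTriple f₁ f₂ f₃ →
      realPeriod e₁ e₂ e₃ = realPeriod f₁ f₂ f₃ → imagPeriod e₁ e₂ e₃ = imagPeriod f₁ f₂ f₃ →
      ¬ (e₂ - e₃) / (e₁ - e₃) < (f₂ - f₃) / (f₁ - f₃) := by
    intro e₁ e₂ e₃ f₁ f₂ f₃ he hf hr hi hlt
    rw [realPeriod_eq he, realPeriod_eq hf] at hr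
    rw [imagPeriod_eq he, imagPeriod_eq hf] at hi
    obtain ⟨a1, a2, a3⟩ := he.modulus_lt_one
    obtain ⟨b1, b2, b3⟩ := hf.modulus_lt_one
    have s1 := Real.sqrt_pos.2 (show 0 < e₁ - e₃ by linarith [he.lt₁₂, he.lt₂₃])
    have s2 := Real.sqrt_pos.2 (show 0 < f₁ - f₃ by linarith [hf.lt₁₂, hf.lt₂₃])
    have l1 := ellipticIntegral_lt hlt b1
    have l2 := ellipticIntegral_lt (show (f₁ - f₂) / (f₁ - f₃) < (e₁ - e₂) / (e₁ - e₃) by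
      rw [a3, b3]; linarith) a2
    have p1 := ellipticIntegral_pos a1
    have p2 := ellipticIntegral_pos b2
    rw [div_eq_div_iff s1.ne' s2.ne'] at hr hi
    have c1 : √(e₁ - e₃) < √(f₁ - f₃) := by
      by_contra hc
      push Not at hc
      nlinarith
    have c2 : √(f₁ - f₃) < √(e₁ - e₃) := by
      by_contra hc
      push Not at hc
      nlinarith
    exact lt_asymm c1 c2
  have hm : (e₂ - e₃) / (e₁ - e₃) = (f₂ - f₃) / (f₁ - f₃) :=
    le_antisymm (not_lt.1 (key hf he hr.symm hi.symm)) (not_lt.1 (key he hf hr hi))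
  have pe : 0 < e₁ - e₃ := by linarith [he.lt₁₂, he.lt₂₃]
  have pf : 0 < f₁ - f₃ := by linarith [hf.lt₁₂, hf.lt₂₃]
  rw [realPeriod_eq he, realPeriod_eq hf, hm] at hr
  have hne := (ellipticIntegral_pos hf.modulus_lt_one.1).ne'
  have hs : √(e₁ - e₃) = √(f₁ - f₃) := by
    have h1 := (Real.sqrt_pos.2 pe).ne'
    have h2 := (Real.sqrt_pos.2 pf).ne'
    rw [div_eq_div_iff h1 h2] at hr
    exact (mul_left_cancel₀ hne hr).symm
  have hd : e₁ - e₃ = f₁ - f₃ := (Real.sqrt_inj pe.le pf.le).1 hs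
  rw [hd, div_left_inj' pf.ne'] at hm
  have := he.sum
  have := hf.sum
  exact ⟨by linarith, by linarith, by linarith⟩

open Filter Topology PeriodPair

/-! ### Uniqueness for analytic solutions of differential equations -/

/-- An analytic function that vanishes at a point and whose derivative is bounded by a multiple of
the function vanishes near that point. -/
lemma eventually_eq_zero_of_norm_deriv_le {E : Type*} [NormedAddCommGroup E] [NormedSpace ℂ E]
    [CompleteSpace E] {F : ℂ → E} {z₀ : ℂ} (hF : AnalyticAt ℂ F z₀) (h0 : F z₀ = 0) {M : ℝ}
    (hM : ∀ᶠ z in 𝓝 z₀, ‖deriv F z‖ ≤ M * ‖F z‖) : ∀ᶠ z in 𝓝 z₀, F z = 0 := by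
  obtain ⟨ε, hε, hball⟩ := Metric.eventually_nhds_iff_ball.1 (hF.eventually_analyticAt.and hM)
  -- Grönwall's inequality on a real segment
  have hline : ∀ t : ℝ, t ∈ Set.Icc 0 (ε / 2) → F (z₀ + t) = 0 := by
    have hmem : ∀ t : ℝ, t ∈ Set.Icc 0 (ε / 2) → z₀ + t ∈ Metric.ball z₀ ε := by
      intro t ht
      rw [Metric.mem_ball, dist_eq_norm, add_sub_cancel_left, Complex.norm_real,
        Real.norm_of_nonneg ht.1]
      linarith [ht.2]
    have hd : ∀ t : ℝ, t ∈ Set.Icc 0 (ε / 2) →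
        HasDerivAt (fun t : ℝ => F (z₀ + t)) (deriv F (z₀ + t)) t := by
      intro t ht
      have h1 := (hball _ (hmem t ht)).1.differentiableAt.hasDerivAt
      have h2 : HasDerivAt (fun s : ℂ => F (z₀ + s)) (deriv F (z₀ + t)) (t : ℂ) :=
        HasDerivAt.comp_const_add z₀ (t : ℂ) h1
      have h3 := HasDerivAt.scomp t h2 Complex.ofRealCLM.hasDerivAt
      simpa [Function.comp_def] using h3
    refine eq_zero_of_abs_deriv_le_mul_abs_self_of_eq_zero_right (K := M)
      (f' := fun t : ℝ => deriv F (z₀ + t))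
      (fun t ht => (hd t ht).continuousAt.continuousWithinAt)
      (fun t ht => (hd t (Set.Ico_subset_Icc_self ht)).hasDerivWithinAt) (by simpa using h0)
      (fun t ht => (hball _ (hmem t (Set.Ico_subset_Icc_self ht))).2)
  refine hF.frequently_zero_iff_eventually_zero.1 ?_
  have htend : Tendsto (fun t : ℝ => z₀ + (t : ℂ)) (𝓝[>] 0) (𝓝[≠] z₀) := by
    refine tendsto_nhdsWithin_iff.2 ⟨?_, ?_⟩
    · have : Continuous fun t : ℝ => z₀ + (t : ℂ) := by fun_prop
      have := this.tendsto 0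
      simp only [Complex.ofReal_zero, add_zero] at this
      exact this.mono_left nhdsWithin_le_nhds
    · filter_upwards [self_mem_nhdsWithin] with t ht
      simpa using (ne_of_gt (Set.mem_Ioi.1 ht))
  refine htend.frequently (Eventually.frequently ?_)
  filter_upwards [Ioo_mem_nhdsGT (show (0 : ℝ) < ε / 2 by linarith)] with t ht
  exact hline t (Set.Ioo_subset_Icc_self ht)

/-- A meromorphic function on the plane that vanishes near one point vanishes near every point. -/
lemma eventually_nhdsNE_eq_zero {f : ℂ → ℂ} (hf : Meromorphic f) {a : ℂ}
    (ha : ∀ᶠ z in 𝓝[≠] a, f z = 0) (b : ℂ) : ∀ᶠ z in 𝓝[≠] b, f z = 0 := by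
  rw [← meromorphicOrderAt_eq_top_iff] at ha ⊢
  by_contra hb
  exact hf.exists_meromorphicOrderAt_ne_top_iff_forall.1 ⟨b, hb⟩ a ha

/-! ### The Weierstrass function -/

section Weierstrass

variable (L : PeriodPair)

lemma hasDerivAt_weierstrassP {z : ℂ} (hz : z ∉ L.lattice) :
    HasDerivAt ℘[L] (℘'[L] z) z := by
  have := (L.analyticOnNhd_weierstrassP z hz).differentiableAt.hasDerivAt
  rwa [L.deriv_weierstrassP] at this

lemma tendsto_weierstrassP_cobounded {l : ℂ} (hl : l ∈ L.lattice) :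
    Tendsto ℘[L] (𝓝[≠] l) (Bornology.cobounded ℂ) := by
  apply tendsto_cobounded_of_meromorphicOrderAt_neg
  rw [L.order_weierstrassP l hl]
  decide

lemma eventually_notMem_lattice (z : ℂ) : ∀ᶠ u in 𝓝[≠] z, u ∉ L.lattice := by
  filter_upwards [self_mem_nhdsWithin, mem_nhdsWithin_of_mem_nhds
    (L.compl_lattice_sdiff_singleton_mem_nhds z)] with u hu hu' hmem
  exact hu' ⟨hmem, hu⟩

lemma mem_lattice_of_periodic {l : ℂ} (h : ∀ᶠ u in 𝓝[≠] (0 : ℂ), ℘[L] (l + u) = ℘[L] u) :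
    l ∈ L.lattice := by
  by_contra hl
  have h1 : Tendsto (fun u => ℘[L] (l + u)) (𝓝[≠] 0) (𝓝 (℘[L] l)) := by
    have hc : ContinuousAt ℘[L] (l + 0) := by
      rw [add_zero]; exact (hasDerivAt_weierstrassP L hl).continuousAt
    have : ContinuousAt (fun u => ℘[L] (l + u)) 0 :=
      ContinuousAt.comp (f := fun u : ℂ => l + u) hc (by fun_prop)
    have := this.tendsto
    rw [add_zero] at this
    exact this.mono_left nhdsWithin_le_nhds
  have h2 := tendsto_weierstrassP_cobounded L L.lattice.zero_mem
  have h3 := h1.congr' h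
  exact (not_tendsto_nhds_of_tendsto_atTop (tendsto_norm_cobounded_atTop.comp h2) _) h3.norm

lemma isPreconnected_compl_lattice : IsPreconnected (L.lattice : Set ℂ)ᶜ := by
  have hc : (L.lattice : Set ℂ).Countable := by
    have : Countable L.lattice := L.latticeEquivProd.toEquiv.countable_iff.2 inferInstance
    exact Set.countable_coe_iff.1 this
  exact (hc.isConnected_compl_of_one_lt_rank (by simp [Complex.rank_real_complex])).isPreconnected

lemma exists_derivWeierstrassP_ne_zero : ∃ z ∉ L.lattice, ℘'[L] z ≠ 0 := by
  by_contra h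
  push Not at h
  have hconst : ∀ z ∉ L.lattice, ∀ u ∉ L.lattice, ℘[L] z = ℘[L] u := by
    intro z hz u hu
    exact IsOpen.is_const_of_deriv_eq_zero L.isClosed_lattice.isOpen_compl
      (isPreconnected_compl_lattice L) L.differentiableOn_weierstrassP
      (fun v hv => by rw [L.deriv_weierstrassP]; exact h v hv) hz hu
  have h2 := tendsto_weierstrassP_cobounded L L.lattice.zero_mem
  refine not_tendsto_nhds_of_tendsto_atTop (tendsto_norm_cobounded_atTop.comp h2)
    ‖℘[L] (L.ω₁ / 2)‖ ?_
  refine tendsto_const_nhds.congr' ?_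
  filter_upwards [eventually_notMem_lattice L 0] with u hu
  exact congrArg norm (hconst _ L.ω₁_div_two_notMem_lattice u hu)

/-- `℘'' = 6 ℘² - g₂ / 2`. -/
lemma hasDerivAt_derivWeierstrassP {z : ℂ} (hz : z ∉ L.lattice) :
    HasDerivAt ℘'[L] (6 * ℘[L] z ^ 2 - L.g₂ / 2) z := by
  have hopen := L.isClosed_lattice.isOpen_compl
  have hA := L.analyticOnNhd_weierstrassP
  have hA' := L.analyticOnNhd_derivWeierstrassP
  have hmul : ∀ u ∈ (L.lattice : Set ℂ)ᶜ,
      ℘'[L] u * (deriv ℘'[L] u - (6 * ℘[L] u ^ 2 - L.g₂ / 2)) = 0 := by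
    intro u hu
    have d1 := hasDerivAt_weierstrassP L hu
    have d2 := (hA' u hu).differentiableAt.hasDerivAt
    have e1 : (fun v => ℘'[L] v ^ 2) =ᶠ[𝓝 u] fun v => 4 * ℘[L] v ^ 3 - L.g₂ * ℘[L] v - L.g₃ := by
      filter_upwards [hopen.mem_nhds hu] with v hv
      exact L.derivWeierstrassP_sq v hv
    have d3 := (d2.pow 2).congr_of_eventuallyEq e1.symm
    have d4 := (((d1.pow 3).const_mul 4).sub (d1.const_mul L.g₂)).sub_const L.g₃
    have := d3.unique d4
    norm_num at this
    linear_combination this / 2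
  have hsub : AnalyticOnNhd ℂ (fun u => deriv ℘'[L] u - (6 * ℘[L] u ^ 2 - L.g₂ / 2))
      (L.lattice : Set ℂ)ᶜ := by
    intro u hu
    have a1 := hA u hu
    have a2 := (hA' u hu).deriv
    fun_prop
  rcases AnalyticOnNhd.eq_zero_or_eq_zero_of_mul_eq_zero hA' hsub hmul
    (isPreconnected_compl_lattice L) with h | h
  · obtain ⟨v, hv, hv'⟩ := exists_derivWeierstrassP_ne_zero L
    exact absurd (h v hv) hv'
  · have := (hA' z hz).differentiableAt.hasDerivAt
    rwa [sub_eq_zero.1 (h z hz)] at this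

/-- A point of the torus is determined by the values of `℘` and `℘'`: translating one point to the
other gives two solutions of the same differential equation. -/
theorem sub_mem_lattice_of_eq {a b : ℂ} (ha : a ∉ L.lattice) (hb : b ∉ L.lattice)
    (h : ℘[L] a = ℘[L] b) (h' : ℘'[L] a = ℘'[L] b) : a - b ∈ L.lattice := by
  set F : ℂ → ℂ × ℂ := fun s => (℘[L] (a + s) - ℘[L] (b + s), ℘'[L] (a + s) - ℘'[L] (b + s))
    with hFdef
  have hopen := L.isClosed_lattice.isOpen_compl
  have hta : Tendsto (fun s => a + s) (𝓝 0) (𝓝 a) := by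
    have : Continuous fun s : ℂ => a + s := by fun_prop
    simpa using this.tendsto 0
  have htb : Tendsto (fun s => b + s) (𝓝 0) (𝓝 b) := by
    have : Continuous fun s : ℂ => b + s := by fun_prop
    simpa using this.tendsto 0
  have hea : ∀ᶠ s in 𝓝 (0 : ℂ), a + s ∉ L.lattice := hta.eventually (hopen.mem_nhds ha)
  have heb : ∀ᶠ s in 𝓝 (0 : ℂ), b + s ∉ L.lattice := htb.eventually (hopen.mem_nhds hb)
  have hderiv : ∀ s, a + s ∉ L.lattice → b + s ∉ L.lattice →
      HasDerivAt F (℘'[L] (a + s) - ℘'[L] (b + s),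
        (6 * ℘[L] (a + s) ^ 2 - L.g₂ / 2) - (6 * ℘[L] (b + s) ^ 2 - L.g₂ / 2)) s := by
    intro s h1 h2
    exact (((hasDerivAt_weierstrassP L h1).comp_const_add a s).sub
      ((hasDerivAt_weierstrassP L h2).comp_const_add b s)).prodMk
      (((hasDerivAt_derivWeierstrassP L h1).comp_const_add a s).sub
      ((hasDerivAt_derivWeierstrassP L h2).comp_const_add b s))
  have hF : AnalyticAt ℂ F 0 := by
    refine DifferentiableOn.analyticAt (s := {s | a + s ∉ L.lattice ∧ b + s ∉ L.lattice}) ?_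
      (hea.and heb)
    exact fun s hs => (hderiv s hs.1 hs.2).differentiableAt.differentiableWithinAt
  have hF0 : F 0 = 0 := by simp [hFdef, h, h']
  set N := ‖6 * (℘[L] a + ℘[L] b)‖ + 1
  have hbound : ∀ᶠ s in 𝓝 (0 : ℂ), ‖6 * (℘[L] (a + s) + ℘[L] (b + s))‖ < N := by
    have c1 : ContinuousAt (fun s => ‖6 * (℘[L] (a + s) + ℘[L] (b + s))‖) 0 := by
      have d1 := ((hasDerivAt_weierstrassP L (z := a + 0) (by simpa using ha)).comp_const_add
        a 0).continuousAt
      have d2 := ((hasDerivAt_weierstrassP L (z := b + 0) (by simpa using hb)).comp_const_add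
        b 0).continuousAt
      fun_prop
    refine c1.eventually_lt continuousAt_const ?_
    simp only [add_zero, N]
    linarith
  have hzero := eventually_eq_zero_of_norm_deriv_le hF hF0 (M := N) (by
    filter_upwards [hea, heb, hbound] with s h1 h2 h3
    rw [(hderiv s h1 h2).deriv, Prod.norm_def]
    have n1 : ‖℘'[L] (a + s) - ℘'[L] (b + s)‖ ≤ ‖F s‖ := norm_snd_le (F s)
    have n2 : ‖℘[L] (a + s) - ℘[L] (b + s)‖ ≤ ‖F s‖ := norm_fst_le (F s)
    have hN1 : 1 ≤ N := by
      have := norm_nonneg (6 * (℘[L] a + ℘[L] b))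
      simp only [N]; linarith
    apply max_le
    · exact n1.trans (le_mul_of_one_le_left (norm_nonneg _) hN1)
    · have e : (6 * ℘[L] (a + s) ^ 2 - L.g₂ / 2) - (6 * ℘[L] (b + s) ^ 2 - L.g₂ / 2) =
          6 * (℘[L] (a + s) + ℘[L] (b + s)) * (℘[L] (a + s) - ℘[L] (b + s)) := by ring
      simp only
      rw [e, norm_mul]
      gcongr)
  have hmer : Meromorphic fun s => ℘[L] (a + s) - ℘[L] (b + s) := by
    have m1 : Meromorphic fun s => ℘[L] (a + s) := fun s =>
      (L.meromorphic_weierstrassP (a + s)).comp_analyticAt (by fun_prop)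
    have m2 : Meromorphic fun s => ℘[L] (b + s) := fun s =>
      (L.meromorphic_weierstrassP (b + s)).comp_analyticAt (by fun_prop)
    fun_prop
  have hall := eventually_nhdsNE_eq_zero hmer (a := 0) (by
    filter_upwards [mem_nhdsWithin_of_mem_nhds hzero] with s hs
    exact congrArg Prod.fst hs) (-b)
  apply mem_lattice_of_periodic
  have ht : Tendsto (fun u : ℂ => u - b) (𝓝[≠] 0) (𝓝[≠] (-b)) := by
    refine tendsto_nhdsWithin_iff.2 ⟨?_, ?_⟩
    · have : Continuous fun u : ℂ => u - b := by fun_prop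
      have := this.tendsto 0
      rw [zero_sub] at this
      exact this.mono_left nhdsWithin_le_nhds
    · filter_upwards [self_mem_nhdsWithin] with u hu
      simpa [sub_eq_iff_eq_add] using hu
  filter_upwards [ht.eventually hall] with u hu
  have e1 : a + (u - b) = a - b + u := by ring
  have e2 : b + (u - b) = u := by ring
  rw [e1, e2] at hu
  exact sub_eq_zero.1 hu

/-- The zeros of `℘'` are the half-periods. -/
lemma two_mul_mem_lattice_of_derivWeierstrassP_eq_zero {z : ℂ} (hz : z ∉ L.lattice)
    (h : ℘'[L] z = 0) : 2 * z ∈ L.lattice := by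
  have := sub_mem_lattice_of_eq L hz (b := -z) (by simpa using hz) (by simp) (by simp [h])
  rwa [sub_neg_eq_add, ← two_mul] at this

lemma derivWeierstrassP_half {z : ℂ} (h : 2 * z ∈ L.lattice) : ℘'[L] z = 0 := by
  have h1 := L.derivWeierstrassP_add_coe (-z) ⟨2 * z, h⟩
  have h2 : -z + 2 * z = z := by ring
  simp only [h2, L.derivWeierstrassP_neg] at h1
  linear_combination h1 / 2

lemma cubic_half_eq_zero {z : ℂ} (hz : z ∉ L.lattice) (h : 2 * z ∈ L.lattice) :
    4 * ℘[L] z ^ 3 - L.g₂ * ℘[L] z - L.g₃ = 0 := by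
  rw [← L.derivWeierstrassP_sq z hz, derivWeierstrassP_half L h]
  simp

/-- The difference of `℘` and its principal part at the origin is continuous there. -/
lemma exists_weierstrassP_eq_add : ∃ f : ℂ → ℂ, ContinuousAt f 0 ∧ ∀ z, ℘[L] z = f z + 1 / z ^ 2 := by
  refine ⟨weierstrassPExcept L 0, (L.analyticAt_weierstrassPExcept 0).continuousAt, fun z => ?_⟩
  have := L.weierstrassPExcept_add 0 z
  simpa using this.symm

end Weierstrass

/-! ### Rectangular lattices -/

lemma linearIndependent_rect {W₁ W₂ : ℝ} (h₁ : 0 < W₁) (h₂ : 0 < W₂) :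
    LinearIndependent ℝ ![Complex.I * (W₁ : ℂ), (W₂ : ℂ)] := by
  rw [LinearIndependent.pair_iff]
  intro s t h
  have hre := congrArg Complex.re h
  have him := congrArg Complex.im h
  simp at hre him
  exact ⟨him.resolve_right h₁.ne', hre.resolve_right h₂.ne'⟩

/-- The pair of periods `i W₁`, `W₂`. -/
def rectPair {W₁ W₂ : ℝ} (h₁ : 0 < W₁) (h₂ : 0 < W₂) : PeriodPair :=
  ⟨Complex.I * (W₁ : ℂ), (W₂ : ℂ), linearIndependent_rect h₁ h₂⟩

section Rect

variable {W₁ W₂ : ℝ} (h₁ : 0 < W₁) (h₂ : 0 < W₂)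

local notation "L" => rectPair h₁ h₂

lemma mem_rect {z : ℂ} : z ∈ (L).lattice ↔ ∃ m n : ℤ, z.re = n * W₂ ∧ z.im = m * W₁ := by
  rw [PeriodPair.mem_lattice]
  constructor
  · rintro ⟨m, n, rfl⟩
    exact ⟨m, n, by simp [rectPair], by simp [rectPair]⟩
  · rintro ⟨m, n, h1, h2⟩
    refine ⟨m, n, Complex.ext ?_ ?_⟩
    · simp [rectPair, h1]
    · simp [rectPair, h2]

lemma notMem_rect_of_re {z : ℂ} (h0 : 0 < z.re) (h : z.re < W₂) : z ∉ (L).lattice := by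
  rw [mem_rect]
  rintro ⟨m, n, h3, -⟩
  rw [h3] at h0 h
  have a1 : 0 < (n : ℝ) := pos_of_mul_pos_left h0 h₂.le
  have a2 : (n : ℝ) < 1 := by nlinarith
  have a3 : 0 < n := by exact_mod_cast a1
  have a4 : n < 1 := by exact_mod_cast a2
  omega

lemma notMem_rect_of_im {z : ℂ} (h0 : 0 < z.im) (h : z.im < W₁) : z ∉ (L).lattice := by
  rw [mem_rect]
  rintro ⟨m, n, -, h3⟩
  rw [h3] at h0 h
  have a1 : 0 < (m : ℝ) := pos_of_mul_pos_left h0 h₁.le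
  have a2 : (m : ℝ) < 1 := by nlinarith
  have a3 : 0 < m := by exact_mod_cast a1
  have a4 : m < 1 := by exact_mod_cast a2
  omega

lemma conj_mem_rect {z : ℂ} (h : z ∈ (L).lattice) : (starRingEnd ℂ) z ∈ (L).lattice := by
  rw [mem_rect] at h ⊢
  obtain ⟨m, n, h3, h4⟩ := h
  exact ⟨-m, n, by simpa using h3, by simp [h4]⟩

/-- Complex conjugation of a rectangular lattice. -/
def conjRect : (L).lattice ≃ (L).lattice where
  toFun l := ⟨(starRingEnd ℂ) l, conj_mem_rect h₁ h₂ l.2⟩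
  invFun l := ⟨(starRingEnd ℂ) l, conj_mem_rect h₁ h₂ l.2⟩
  left_inv l := by simp
  right_inv l := by simp

lemma weierstrassP_conj (z : ℂ) :
    ℘[L] ((starRingEnd ℂ) z) = (starRingEnd ℂ) (℘[L] z) := by
  rw [PeriodPair.weierstrassP, PeriodPair.weierstrassP, Complex.conj_tsum,
    ← (conjRect h₁ h₂).tsum_eq]
  refine tsum_congr fun l => ?_
  simp [conjRect]

lemma derivWeierstrassP_conj (z : ℂ) :
    ℘'[L] ((starRingEnd ℂ) z) = (starRingEnd ℂ) (℘'[L] z) := by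
  rw [PeriodPair.derivWeierstrassP, PeriodPair.derivWeierstrassP, map_neg, Complex.conj_tsum,
    ← (conjRect h₁ h₂).tsum_eq]
  congr 1
  refine tsum_congr fun l => ?_
  simp [conjRect, Complex.conj_ofNat]

lemma weierstrassP_eq_of_sub_mem {a b : ℂ} (h : a - b ∈ (L).lattice) : ℘[L] a = ℘[L] b := by
  have := (L).weierstrassP_add_coe b ⟨a - b, h⟩
  rw [← this]
  congr 1
  ring

/-- `℘` is real on the horizontal lines at heights in `(W₁ / 2) ℤ`. -/
lemma weierstrassP_real_of_im {z : ℂ} (m : ℤ) (h : z.im = m * (W₁ / 2)) :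
    ((℘[L] z).re : ℂ) = ℘[L] z := by
  rw [← Complex.conj_eq_iff_re, ← weierstrassP_conj]
  apply weierstrassP_eq_of_sub_mem
  rw [mem_rect]
  refine ⟨-m, 0, by simp, ?_⟩
  simp [h]
  ring

/-- `℘` is real on the vertical lines with abscissas in `(W₂ / 2) ℤ`. -/
lemma weierstrassP_real_of_re {z : ℂ} (n : ℤ) (h : z.re = n * (W₂ / 2)) :
    ((℘[L] z).re : ℂ) = ℘[L] z := by
  rw [← Complex.conj_eq_iff_re, ← weierstrassP_conj, ← (L).weierstrassP_neg z]
  apply weierstrassP_eq_of_sub_mem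
  rw [mem_rect]
  refine ⟨0, n, ?_, by simp⟩
  simp [h]
  ring

lemma derivWeierstrassP_real_of_im {z : ℂ} (m : ℤ) (h : z.im = m * (W₁ / 2)) :
    ((℘'[L] z).re : ℂ) = ℘'[L] z := by
  rw [← Complex.conj_eq_iff_re, ← derivWeierstrassP_conj]
  have hm : (starRingEnd ℂ) z - z ∈ (L).lattice := by
    rw [mem_rect]
    refine ⟨-m, 0, by simp, ?_⟩
    simp [h]
    ring
  have := (L).derivWeierstrassP_add_coe z ⟨_, hm⟩
  rw [← this]
  congr 1
  ring

/-! ### The values at the half-periods -/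

/-- The half-period `W₂ / 2`. -/
def half₁ (_ : 0 < W₁) (_ : 0 < W₂) : ℂ := ((W₂ / 2 : ℝ) : ℂ)
/-- The half-period `W₂ / 2 + i W₁ / 2`. -/
def half₂ (_ : 0 < W₁) (_ : 0 < W₂) : ℂ := ⟨W₂ / 2, W₁ / 2⟩
/-- The half-period `i W₁ / 2`. -/
def half₃ (_ : 0 < W₁) (_ : 0 < W₂) : ℂ := ⟨0, W₁ / 2⟩

/-- The value of `℘` at the half-period `W₂ / 2`. -/
def rootE₁ : ℝ := (℘[L] (half₁ h₁ h₂)).re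
/-- The value of `℘` at the half-period `W₂ / 2 + i W₁ / 2`. -/
def rootE₂ : ℝ := (℘[L] (half₂ h₁ h₂)).re
/-- The value of `℘` at the half-period `i W₁ / 2`. -/
def rootE₃ : ℝ := (℘[L] (half₃ h₁ h₂)).re

lemma weierstrassP_half₁ : ℘[L] (half₁ h₁ h₂) = rootE₁ h₁ h₂ :=
  (weierstrassP_real_of_im h₁ h₂ 0 (by simp [half₁])).symm

lemma weierstrassP_half₂ : ℘[L] (half₂ h₁ h₂) = rootE₂ h₁ h₂ :=
  (weierstrassP_real_of_im h₁ h₂ 1 (by simp [half₂])).symm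

lemma weierstrassP_half₃ : ℘[L] (half₃ h₁ h₂) = rootE₃ h₁ h₂ :=
  (weierstrassP_real_of_im h₁ h₂ 1 (by simp [half₃])).symm

lemma half₁_notMem : half₁ h₁ h₂ ∉ (L).lattice :=
  notMem_rect_of_re h₁ h₂ (by simp [half₁, h₂]) (by simp [half₁, h₂])

lemma half₂_notMem : half₂ h₁ h₂ ∉ (L).lattice :=
  notMem_rect_of_re h₁ h₂ (by simp [half₂, h₂]) (by simp [half₂, h₂])

lemma half₃_notMem : half₃ h₁ h₂ ∉ (L).lattice :=
  notMem_rect_of_im h₁ h₂ (by simp [half₃, h₁]) (by simp [half₃, h₁])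

lemma two_half₁_mem : 2 * half₁ h₁ h₂ ∈ (L).lattice :=
  (mem_rect h₁ h₂).2 ⟨0, 1, by simp [half₁]; ring, by simp [half₁]⟩

lemma two_half₂_mem : 2 * half₂ h₁ h₂ ∈ (L).lattice :=
  (mem_rect h₁ h₂).2 ⟨1, 1, by simp [half₂]; ring, by simp [half₂]; ring⟩

lemma two_half₃_mem : 2 * half₃ h₁ h₂ ∈ (L).lattice :=
  (mem_rect h₁ h₂).2 ⟨1, 0, by simp [half₃], by simp [half₃]; ring⟩

lemma rootE_ne : rootE₁ h₁ h₂ ≠ rootE₂ h₁ h₂ ∧ rootE₁ h₁ h₂ ≠ rootE₃ h₁ h₂ ∧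
    rootE₂ h₁ h₂ ≠ rootE₃ h₁ h₂ := by
  have key : ∀ {a b : ℂ}, a ∉ (L).lattice → b ∉ (L).lattice → 2 * a ∈ (L).lattice →
      2 * b ∈ (L).lattice → a - b ∉ (L).lattice → ∀ {r s : ℝ}, ℘[L] a = r → ℘[L] b = s →
      r ≠ s := by
    intro a b ha hb ha' hb' hab r s hr hs hrs
    exact hab (sub_mem_lattice_of_eq _ ha hb (by rw [hr, hs, hrs])
      (by rw [derivWeierstrassP_half _ ha', derivWeierstrassP_half _ hb']))
  refine ⟨key (half₁_notMem h₁ h₂) (half₂_notMem h₁ h₂) (two_half₁_mem h₁ h₂) (two_half₂_mem h₁ h₂)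
    ?_ (weierstrassP_half₁ h₁ h₂) (weierstrassP_half₂ h₁ h₂),
    key (half₁_notMem h₁ h₂) (half₃_notMem h₁ h₂) (two_half₁_mem h₁ h₂) (two_half₃_mem h₁ h₂)
    ?_ (weierstrassP_half₁ h₁ h₂) (weierstrassP_half₃ h₁ h₂),
    key (half₂_notMem h₁ h₂) (half₃_notMem h₁ h₂) (two_half₂_mem h₁ h₂) (two_half₃_mem h₁ h₂)
    ?_ (weierstrassP_half₂ h₁ h₂) (weierstrassP_half₃ h₁ h₂)⟩
  · rw [← neg_mem_iff]
    exact notMem_rect_of_im h₁ h₂ (by simp [half₁, half₂, h₁]) (by simp [half₁, half₂, h₁])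
  · exact notMem_rect_of_re h₁ h₂ (by simp [half₁, half₃, h₂]) (by simp [half₁, half₃, h₂])
  · exact notMem_rect_of_re h₁ h₂ (by simp [half₂, half₃, h₂]) (by simp [half₂, half₃, h₂])

lemma rootE_sum_and_fac :
    (rootE₁ h₁ h₂ : ℂ) + rootE₂ h₁ h₂ + rootE₃ h₁ h₂ = 0 ∧
    ∀ u : ℂ, 4 * u ^ 3 - (L).g₂ * u - (L).g₃ =
      4 * (u - rootE₁ h₁ h₂) * (u - rootE₂ h₁ h₂) * (u - rootE₃ h₁ h₂) := by
  obtain ⟨n1, n2, n3⟩ := rootE_ne h₁ h₂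
  have r1 := cubic_half_eq_zero _ (half₁_notMem h₁ h₂) (two_half₁_mem h₁ h₂)
  have r2 := cubic_half_eq_zero _ (half₂_notMem h₁ h₂) (two_half₂_mem h₁ h₂)
  have r3 := cubic_half_eq_zero _ (half₃_notMem h₁ h₂) (two_half₃_mem h₁ h₂)
  rw [weierstrassP_half₁] at r1
  rw [weierstrassP_half₂] at r2
  rw [weierstrassP_half₃] at r3
  exact cubic_of_roots r1 r2 r3 (by exact_mod_cast n1) (by exact_mod_cast n2)
    (by exact_mod_cast n3) (by norm_num)

lemma derivWeierstrassP_sq_eq {z : ℂ} (hz : z ∉ (L).lattice) :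
    ℘'[L] z ^ 2 =
      4 * (℘[L] z - rootE₁ h₁ h₂) * (℘[L] z - rootE₂ h₁ h₂) * (℘[L] z - rootE₃ h₁ h₂) := by
  rw [PeriodPair.derivWeierstrassP_sq _ z hz, (rootE_sum_and_fac h₁ h₂).2]

/-! ### `℘` on the sides of the quarter rectangle -/

/-- A segment on which `℘` is real, in a real or imaginary direction `v`, without half-periods in
its interior. -/
structure IsRealSegment (z₀ v : ℂ) (ε ℓ : ℝ) : Prop where
  dir : v ^ 2 = ε
  pos : 0 < ℓ
  real : ∀ t : ℝ, ((℘[L] (z₀ + v * t)).re : ℂ) = ℘[L] (z₀ + v * t)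
  notMem : ∀ t ∈ Set.Ioo 0 ℓ, z₀ + v * (t : ℝ) ∉ (L).lattice
  notMem_half : ∀ t ∈ Set.Ioo 0 ℓ, 2 * (z₀ + v * (t : ℝ)) ∉ (L).lattice

variable {h₁ h₂}

namespace IsRealSegment

variable {z₀ v : ℂ} {ε ℓ : ℝ}

lemma hasDerivAt {t : ℝ} (ht : z₀ + v * t ∉ (L).lattice) :
    HasDerivAt (fun t : ℝ => (℘[L] (z₀ + v * t)).re) (v * ℘'[L] (z₀ + v * t)).re t := by
  have h1 : HasDerivAt (fun s : ℂ => z₀ + v * s) v (t : ℂ) := by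
    simpa using ((hasDerivAt_id (t : ℂ)).const_mul v).const_add z₀
  have h2 := (hasDerivAt_weierstrassP _ ht).comp (t : ℂ) h1
  rw [mul_comm] at h2
  exact h2.real_of_complex

lemma deriv_sq (h : IsRealSegment h₁ h₂ z₀ v ε ℓ) {t : ℝ} (ht : t ∈ Set.Ioo 0 ℓ) :
    ((v * ℘'[L] (z₀ + v * t)).re) ^ 2 = ε *
      cubic (rootE₁ h₁ h₂) (rootE₂ h₁ h₂) (rootE₃ h₁ h₂) (℘[L] (z₀ + v * t)).re := by
  have hnm := h.notMem t ht
  -- the derivative of a function with real values is real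
  have h1 : HasDerivAt (fun s : ℝ => ℘[L] (z₀ + v * s)) (v * ℘'[L] (z₀ + v * t)) t := by
    have h1 : HasDerivAt (fun s : ℂ => z₀ + v * s) v (t : ℂ) := by
      simpa using ((hasDerivAt_id (t : ℂ)).const_mul v).const_add z₀
    have h2 := (hasDerivAt_weierstrassP _ hnm).comp (t : ℂ) h1
    rw [mul_comm] at h2
    exact h2.comp_ofReal
  have h2 : HasDerivAt (fun s : ℝ => ((℘[L] (z₀ + v * s)).re : ℂ))
      (((v * ℘'[L] (z₀ + v * t)).re : ℝ) : ℂ) t := (hasDerivAt hnm).ofReal_comp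
  simp only [h.real] at h2
  have h3 := h2.unique h1
  have h4 : ((((v * ℘'[L] (z₀ + v * t)).re) ^ 2 : ℝ) : ℂ) = ((ε *
      cubic (rootE₁ h₁ h₂) (rootE₂ h₁ h₂) (rootE₃ h₁ h₂) (℘[L] (z₀ + v * t)).re : ℝ) : ℂ) := by
    rw [Complex.ofReal_pow, h3, mul_pow, h.dir, derivWeierstrassP_sq_eq h₁ h₂ hnm]
    simp only [cubic, Complex.ofReal_mul, Complex.ofReal_sub, h.real, Complex.ofReal_ofNat]
  exact_mod_cast h4

lemma deriv_ne_zero (h : IsRealSegment h₁ h₂ z₀ v ε ℓ) (hε : ε ≠ 0) {t : ℝ}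
    (ht : t ∈ Set.Ioo 0 ℓ) : (v * ℘'[L] (z₀ + v * t)).re ≠ 0 := by
  intro h0
  have h1 := h.deriv_sq ht
  have hnm := h.notMem t ht
  rw [h0] at h1
  have h2 : ℘'[L] (z₀ + v * t) ^ 2 = 0 := by
    have h3 : cubic (rootE₁ h₁ h₂) (rootE₂ h₁ h₂) (rootE₃ h₁ h₂) (℘[L] (z₀ + v * t)).re = 0 := by
      simpa [hε] using h1.symm
    rw [derivWeierstrassP_sq_eq h₁ h₂ hnm, ← h.real]
    rw [cubic] at h3
    exact_mod_cast h3
  exact h.notMem_half t ht (two_mul_mem_lattice_of_derivWeierstrassP_eq_zero _ hnm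
    (pow_eq_zero_iff two_ne_zero |>.1 h2))

lemma deriv_sign (h : IsRealSegment h₁ h₂ z₀ v ε ℓ) (hε : ε ≠ 0) :
    (∀ t ∈ Set.Ioo 0 ℓ, (v * ℘'[L] (z₀ + v * (t : ℝ))).re < 0) ∨
    ∀ t ∈ Set.Ioo 0 ℓ, 0 < (v * ℘'[L] (z₀ + v * (t : ℝ))).re :=
  hasDerivWithinAt_forall_lt_or_forall_gt_of_forall_ne (convex_Ioo 0 ℓ)
    (fun t ht => (hasDerivAt (h.notMem t ht)).hasDerivWithinAt)
    fun _ ht => h.deriv_ne_zero hε ht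

/-- The time spent between two values is an elliptic integral. -/
lemma integral_eq (h : IsRealSegment h₁ h₂ z₀ v ε ℓ) (hε : ε = 1 ∨ ε = -1) {a b : ℝ}
    (ha : 0 ≤ a) (hab : a ≤ b) (hb : b ≤ ℓ) :
    ∫ u in (fun t : ℝ => (℘[L] (z₀ + v * t)).re) '' Set.Ioo a b,
      2 / √(ε * cubic (rootE₁ h₁ h₂) (rootE₂ h₁ h₂) (rootE₃ h₁ h₂) u) = 2 * (b - a) := by
  have hε0 : ε ≠ 0 := by rcases hε with rfl | rfl <;> norm_num
  have hsub : Set.Ioo a b ⊆ Set.Ioo 0 ℓ := Set.Ioo_subset_Ioo ha hb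
  have hinj : Set.InjOn (fun t : ℝ => (℘[L] (z₀ + v * t)).re) (Set.Ioo 0 ℓ) := by
    have hc : ContinuousOn (fun t : ℝ => (℘[L] (z₀ + v * t)).re) (Set.Ioo 0 ℓ) :=
      fun t ht => (hasDerivAt (h.notMem t ht)).continuousAt.continuousWithinAt
    rcases h.deriv_sign hε0 with hs | hs
    · refine (strictAntiOn_of_deriv_neg (convex_Ioo 0 ℓ) hc fun t ht => ?_).injOn
      rw [interior_Ioo] at ht
      rw [(hasDerivAt (h.notMem t ht)).deriv]
      exact hs t ht
    · refine (strictMonoOn_of_deriv_pos (convex_Ioo 0 ℓ) hc fun t ht => ?_).injOn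
      rw [interior_Ioo] at ht
      rw [(hasDerivAt (h.notMem t ht)).deriv]
      exact hs t ht
  rw [integral_image_eq_integral_abs_deriv_smul measurableSet_Ioo
    (fun t ht => (hasDerivAt (h.notMem t (hsub ht))).hasDerivWithinAt) (hinj.mono hsub)]
  have hcongr : ∀ t ∈ Set.Ioo a b, |(v * ℘'[L] (z₀ + v * (t : ℝ))).re| •
      (2 / √(ε * cubic (rootE₁ h₁ h₂) (rootE₂ h₁ h₂) (rootE₃ h₁ h₂)
        (℘[L] (z₀ + v * (t : ℝ))).re)) = 2 := by
    intro t ht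
    have hne := abs_ne_zero.2 (h.deriv_ne_zero hε0 (hsub ht))
    rw [← h.deriv_sq (hsub ht), Real.sqrt_sq_eq_abs, smul_eq_mul]
    field_simp
  rw [setIntegral_congr_fun measurableSet_Ioo hcongr]
  simp [hab, mul_comm]

end IsRealSegment

end Rect

lemma image_Ioo_of_strictAntiOn {f : ℝ → ℝ} {a b : ℝ} (hab : a ≤ b)
    (hc : ContinuousOn f (Set.Icc a b)) (hf : StrictAntiOn f (Set.Icc a b)) :
    f '' Set.Ioo a b = Set.Ioo (f b) (f a) := by
  refine Set.Subset.antisymm ?_ (intermediate_value_Ioo' hab hc)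
  rintro _ ⟨r, hr, rfl⟩
  exact ⟨hf (Set.Ioo_subset_Icc_self hr) (Set.right_mem_Icc.2 hab) hr.2,
    hf (Set.left_mem_Icc.2 hab) (Set.Ioo_subset_Icc_self hr) hr.1⟩

lemma image_Ioo_of_strictMonoOn {f : ℝ → ℝ} {a b : ℝ} (hab : a ≤ b)
    (hc : ContinuousOn f (Set.Icc a b)) (hf : StrictMonoOn f (Set.Icc a b)) :
    f '' Set.Ioo a b = Set.Ioo (f a) (f b) := by
  refine Set.Subset.antisymm ?_ (intermediate_value_Ioo hab hc)
  rintro _ ⟨r, hr, rfl⟩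
  exact ⟨hf (Set.left_mem_Icc.2 hab) (Set.Ioo_subset_Icc_self hr) hr.1,
    hf (Set.Ioo_subset_Icc_self hr) (Set.right_mem_Icc.2 hab) hr.2⟩

section Rect

variable {W₁ W₂ : ℝ} {h₁ : 0 < W₁} {h₂ : 0 < W₂}

local notation "L" => rectPair h₁ h₂

lemma isRealSegment_bottom : IsRealSegment h₁ h₂ 0 1 1 (W₂ / 2) where
  dir := by simp
  pos := by linarith
  real t := weierstrassP_real_of_im h₁ h₂ 0 (by simp)
  notMem t ht := notMem_rect_of_re h₁ h₂ (by simpa using ht.1) (by simp; linarith [ht.2])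
  notMem_half t ht := notMem_rect_of_re h₁ h₂ (by simpa using ht.1) (by simp; linarith [ht.2])

lemma isRealSegment_left : IsRealSegment h₁ h₂ 0 Complex.I (-1) (W₁ / 2) where
  dir := by simp
  pos := by linarith
  real t := weierstrassP_real_of_re h₁ h₂ 0 (by simp)
  notMem t ht := notMem_rect_of_im h₁ h₂ (by simpa using ht.1) (by simp; linarith [ht.2])
  notMem_half t ht := notMem_rect_of_im h₁ h₂ (by simpa using ht.1) (by simp; linarith [ht.2])

lemma isRealSegment_top : IsRealSegment h₁ h₂ (half₃ h₁ h₂) 1 1 (W₂ / 2) where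
  dir := by simp
  pos := by linarith
  real t := weierstrassP_real_of_im h₁ h₂ 1 (by simp [half₃])
  notMem t ht := notMem_rect_of_re h₁ h₂ (by simpa [half₃] using ht.1)
    (by simp [half₃]; linarith [ht.2])
  notMem_half t ht := notMem_rect_of_re h₁ h₂ (by simpa [half₃] using ht.1)
    (by simp [half₃]; linarith [ht.2])

lemma isRealSegment_right : IsRealSegment h₁ h₂ (half₁ h₁ h₂) Complex.I (-1) (W₁ / 2) where
  dir := by simp
  pos := by linarith
  real t := weierstrassP_real_of_re h₁ h₂ 1 (by simp [half₁])
  notMem t ht := notMem_rect_of_im h₁ h₂ (by simpa [half₁] using ht.1)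
    (by simp [half₁]; linarith [ht.2])
  notMem_half t ht := notMem_rect_of_im h₁ h₂ (by simpa [half₁] using ht.1)
    (by simp [half₁]; linarith [ht.2])

lemma continuousAt_re_weierstrassP {z₀ v : ℂ} {t : ℝ} (ht : z₀ + v * t ∉ (L).lattice) :
    ContinuousAt (fun t : ℝ => (℘[L] (z₀ + v * t)).re) t :=
  (IsRealSegment.hasDerivAt ht).continuousAt

lemma right_end_bottom : (0 : ℂ) + 1 * ((W₂ / 2 : ℝ) : ℂ) = half₁ h₁ h₂ := by simp [half₁]

lemma right_end_top : half₃ h₁ h₂ + 1 * ((W₂ / 2 : ℝ) : ℂ) = half₂ h₁ h₂ := by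
  apply Complex.ext <;> simp [half₂, half₃]

lemma upper_end_right : half₁ h₁ h₂ + Complex.I * ((W₁ / 2 : ℝ) : ℂ) = half₂ h₁ h₂ := by
  apply Complex.ext <;> simp [half₁, half₂]

lemma upper_end_left : (0 : ℂ) + Complex.I * ((W₁ / 2 : ℝ) : ℂ) = half₃ h₁ h₂ := by
  apply Complex.ext <;> simp [half₃]

/-- Near the origin `℘` behaves like `z ^ (-2)`. -/
lemma tendsto_weierstrassP_bottom :
    Tendsto (fun t : ℝ => (℘[L] (0 + 1 * t)).re) (𝓝[>] 0) atTop := by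
  obtain ⟨f, hf, hP⟩ := exists_weierstrassP_eq_add (L)
  have e : (fun t : ℝ => (℘[L] (0 + 1 * t)).re) = fun t : ℝ => (f t).re + (t ^ 2)⁻¹ := by
    ext t
    rw [hP]
    simp [← Complex.ofReal_pow, ← Complex.ofReal_inv]
  rw [e]
  have h1 : Tendsto (fun t : ℝ => (f t).re) (𝓝[>] 0) (𝓝 (f (0 : ℝ)).re) := by
    have : ContinuousAt (fun t : ℝ => (f t).re) 0 := by
      have h0 : ContinuousAt (fun t : ℝ => f t) 0 :=
        ContinuousAt.comp (f := fun t : ℝ => (t : ℂ)) (by simpa using hf) (by fun_prop)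
      exact Complex.continuous_re.continuousAt.comp h0
    exact this.tendsto.mono_left nhdsWithin_le_nhds
  have h2 : Tendsto (fun t : ℝ => (t ^ 2)⁻¹) (𝓝[>] 0) atTop := by
    refine tendsto_inv_nhdsGT_zero.comp (tendsto_nhdsWithin_iff.2 ⟨?_, ?_⟩)
    · have : Continuous fun t : ℝ => t ^ 2 := by fun_prop
      have := this.tendsto 0
      simp only [ne_eq, OfNat.ofNat_ne_zero, not_false_eq_true, zero_pow] at this
      exact this.mono_left nhdsWithin_le_nhds
    · filter_upwards [self_mem_nhdsWithin] with t ht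
      exact pow_pos (Set.mem_Ioi.1 ht) 2
  exact h1.add_atTop h2

lemma tendsto_weierstrassP_left :
    Tendsto (fun t : ℝ => (℘[L] (0 + Complex.I * t)).re) (𝓝[>] 0) atBot := by
  obtain ⟨f, hf, hP⟩ := exists_weierstrassP_eq_add (L)
  have e : (fun t : ℝ => (℘[L] (0 + Complex.I * t)).re) =
      fun t : ℝ => (f (Complex.I * t)).re + -(t ^ 2)⁻¹ := by
    ext t
    rw [hP]
    simp [mul_pow, ← Complex.ofReal_pow, ← Complex.ofReal_inv]
  rw [e]
  have h1 : Tendsto (fun t : ℝ => (f (Complex.I * t)).re) (𝓝[>] 0)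
      (𝓝 (f (Complex.I * (0 : ℝ))).re) := by
    have : ContinuousAt (fun t : ℝ => (f (Complex.I * t)).re) 0 := by
      have h0 : ContinuousAt (fun t : ℝ => f (Complex.I * t)) 0 :=
        ContinuousAt.comp (f := fun t : ℝ => Complex.I * (t : ℂ)) (by simpa using hf) (by fun_prop)
      exact Complex.continuous_re.continuousAt.comp h0
    exact this.tendsto.mono_left nhdsWithin_le_nhds
  have h2 : Tendsto (fun t : ℝ => (t ^ 2)⁻¹) (𝓝[>] 0) atTop := by
    refine tendsto_inv_nhdsGT_zero.comp (tendsto_nhdsWithin_iff.2 ⟨?_, ?_⟩)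
    · have : Continuous fun t : ℝ => t ^ 2 := by fun_prop
      have := this.tendsto 0
      simp only [ne_eq, OfNat.ofNat_ne_zero, not_false_eq_true, zero_pow] at this
      exact this.mono_left nhdsWithin_le_nhds
    · filter_upwards [self_mem_nhdsWithin] with t ht
      exact pow_pos (Set.mem_Ioi.1 ht) 2
  exact h1.add_atBot (tendsto_neg_atTop_atBot.comp h2)

variable (h₁ h₂) in
lemma strictAntiOn_bottom :
    StrictAntiOn (fun t : ℝ => (℘[L] (0 + 1 * t)).re) (Set.Ioc 0 (W₂ / 2)) ∧
    ContinuousOn (fun t : ℝ => (℘[L] (0 + 1 * t)).re) (Set.Ioc 0 (W₂ / 2)) := by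
  have hs := isRealSegment_bottom (h₁ := h₁) (h₂ := h₂)
  have hc : ContinuousOn (fun t : ℝ => (℘[L] (0 + 1 * t)).re) (Set.Ioc 0 (W₂ / 2)) := by
    intro t ht
    refine (continuousAt_re_weierstrassP ?_).continuousWithinAt
    exact notMem_rect_of_re h₁ h₂ (by simpa using ht.1) (by simp; linarith [ht.2])
  refine ⟨?_, hc⟩
  rcases hs.deriv_sign one_ne_zero with h | h
  · refine strictAntiOn_of_deriv_neg (convex_Ioc _ _) hc fun t ht => ?_
    rw [interior_Ioc] at ht
    rw [(IsRealSegment.hasDerivAt (hs.notMem t ht)).deriv]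
    exact h t ht
  · exfalso
    have hm : StrictMonoOn (fun t : ℝ => (℘[L] (0 + 1 * t)).re) (Set.Ioc 0 (W₂ / 2)) := by
      refine strictMonoOn_of_deriv_pos (convex_Ioc _ _) hc fun t ht => ?_
      rw [interior_Ioc] at ht
      rw [(IsRealSegment.hasDerivAt (hs.notMem t ht)).deriv]
      exact h t ht
    have h3 := (tendsto_weierstrassP_bottom (h₁ := h₁) (h₂ := h₂)).eventually_gt_atTop
      (℘[L] (0 + 1 * ((W₂ / 2 : ℝ) : ℂ))).re
    obtain ⟨t, ht1, ht2⟩ := (h3.and (Ioo_mem_nhdsGT hs.pos)).exists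
    exact lt_asymm ht1 (hm (Set.Ioo_subset_Ioc_self ht2) (Set.right_mem_Ioc.2 hs.pos) ht2.2)

variable (h₁ h₂) in
lemma strictMonoOn_left :
    StrictMonoOn (fun t : ℝ => (℘[L] (0 + Complex.I * t)).re) (Set.Ioc 0 (W₁ / 2)) ∧
    ContinuousOn (fun t : ℝ => (℘[L] (0 + Complex.I * t)).re) (Set.Ioc 0 (W₁ / 2)) := by
  have hs := isRealSegment_left (h₁ := h₁) (h₂ := h₂)
  have hc : ContinuousOn (fun t : ℝ => (℘[L] (0 + Complex.I * t)).re) (Set.Ioc 0 (W₁ / 2)) := by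
    intro t ht
    refine (continuousAt_re_weierstrassP ?_).continuousWithinAt
    exact notMem_rect_of_im h₁ h₂ (by simpa using ht.1) (by simp; linarith [ht.2])
  refine ⟨?_, hc⟩
  rcases hs.deriv_sign (by norm_num) with h | h
  · exfalso
    have hm : StrictAntiOn (fun t : ℝ => (℘[L] (0 + Complex.I * t)).re) (Set.Ioc 0 (W₁ / 2)) := by
      refine strictAntiOn_of_deriv_neg (convex_Ioc _ _) hc fun t ht => ?_
      rw [interior_Ioc] at ht
      rw [(IsRealSegment.hasDerivAt (hs.notMem t ht)).deriv]
      exact h t ht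
    have h3 := (tendsto_weierstrassP_left (h₁ := h₁) (h₂ := h₂)).eventually_lt_atBot
      (℘[L] (0 + Complex.I * ((W₁ / 2 : ℝ) : ℂ))).re
    obtain ⟨t, ht1, ht2⟩ := (h3.and (Ioo_mem_nhdsGT hs.pos)).exists
    exact lt_asymm ht1 (hm (Set.Ioo_subset_Ioc_self ht2) (Set.right_mem_Ioc.2 hs.pos) ht2.2)
  · refine strictMonoOn_of_deriv_pos (convex_Ioc _ _) hc fun t ht => ?_
    rw [interior_Ioc] at ht
    rw [(IsRealSegment.hasDerivAt (hs.notMem t ht)).deriv]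
    exact h t ht

lemma exists_bottom_eq {u : ℝ} (hu : rootE₁ h₁ h₂ < u) :
    ∃ τ ∈ Set.Ioo 0 (W₂ / 2), (℘[L] (0 + 1 * (τ : ℝ))).re = u := by
  have hs := isRealSegment_bottom (h₁ := h₁) (h₂ := h₂)
  have h3 := (tendsto_weierstrassP_bottom (h₁ := h₁) (h₂ := h₂)).eventually_gt_atTop u
  obtain ⟨t, ht1, ht2⟩ := (h3.and (Ioo_mem_nhdsGT hs.pos)).exists
  obtain ⟨-, hc⟩ := strictAntiOn_bottom h₁ h₂
  have h4 := intermediate_value_Ioo' ht2.2.le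
    (hc.mono (show Set.Icc t (W₂ / 2) ⊆ _ from fun s hs => ⟨ht2.1.trans_le hs.1, hs.2⟩))
  simp only [right_end_bottom (h₁ := h₁) (h₂ := h₂)] at h4
  obtain ⟨τ, hτ1, hτ2⟩ := h4 ⟨hu, ht1⟩
  exact ⟨τ, ⟨ht2.1.trans hτ1.1, hτ1.2⟩, hτ2⟩

lemma exists_left_eq {u : ℝ} (hu : u < rootE₃ h₁ h₂) :
    ∃ τ ∈ Set.Ioo 0 (W₁ / 2), (℘[L] (0 + Complex.I * (τ : ℝ))).re = u := by
  have hs := isRealSegment_left (h₁ := h₁) (h₂ := h₂)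
  have h3 := (tendsto_weierstrassP_left (h₁ := h₁) (h₂ := h₂)).eventually_lt_atBot u
  obtain ⟨t, ht1, ht2⟩ := (h3.and (Ioo_mem_nhdsGT hs.pos)).exists
  obtain ⟨-, hc⟩ := strictMonoOn_left h₁ h₂
  have h4 := intermediate_value_Ioo ht2.2.le
    (hc.mono (show Set.Icc t (W₁ / 2) ⊆ _ from fun s hs => ⟨ht2.1.trans_le hs.1, hs.2⟩))
  simp only [upper_end_left (h₁ := h₁) (h₂ := h₂)] at h4
  obtain ⟨τ, hτ1, hτ2⟩ := h4 ⟨ht1, hu⟩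
  exact ⟨τ, ⟨ht2.1.trans hτ1.1, hτ1.2⟩, hτ2⟩

variable (h₁ h₂) in
/-- The half-period values in order: the cubic is positive on the range of `℘` on the bottom side
and negative on its range on the left side. -/
theorem isRootTriple_rootE : IsRootTriple (rootE₁ h₁ h₂) (rootE₂ h₁ h₂) (rootE₃ h₁ h₂) := by
  obtain ⟨n1, n2, n3⟩ := rootE_ne h₁ h₂
  have above : ∀ u, rootE₁ h₁ h₂ < u →
      cubic (rootE₁ h₁ h₂) (rootE₂ h₁ h₂) (rootE₃ h₁ h₂) u ≠ 0 := by
    intro u hu h0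
    obtain ⟨τ, hτ, rfl⟩ := exists_bottom_eq hu
    have hs := isRealSegment_bottom (h₁ := h₁) (h₂ := h₂)
    have := hs.deriv_sq hτ
    rw [h0, mul_zero] at this
    exact hs.deriv_ne_zero one_ne_zero hτ (pow_eq_zero_iff two_ne_zero |>.1 this)
  have below : ∀ u, u < rootE₃ h₁ h₂ →
      cubic (rootE₁ h₁ h₂) (rootE₂ h₁ h₂) (rootE₃ h₁ h₂) u ≠ 0 := by
    intro u hu h0
    obtain ⟨τ, hτ, rfl⟩ := exists_left_eq hu
    have hs := isRealSegment_left (h₁ := h₁) (h₂ := h₂)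
    have := hs.deriv_sq hτ
    rw [h0, mul_zero] at this
    exact hs.deriv_ne_zero (by norm_num) hτ (pow_eq_zero_iff two_ne_zero |>.1 this)
  refine ⟨?_, ?_, ?_⟩
  · exact lt_of_le_of_ne (not_lt.1 fun h => above _ h (by simp [cubic])) n1.symm
  · exact lt_of_le_of_ne (not_lt.1 fun h => below _ h (by simp [cubic])) n3.symm
  · exact_mod_cast (rootE_sum_and_fac h₁ h₂).1

variable (h₁ h₂) in
lemma top_side : (∀ t ∈ Set.Ioo 0 (W₂ / 2), 0 < (℘'[L] (half₃ h₁ h₂ + (t : ℝ))).re) ∧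
    (fun t : ℝ => (℘[L] (half₃ h₁ h₂ + 1 * t)).re) '' Set.Ioo 0 (W₂ / 2) =
      Set.Ioo (rootE₃ h₁ h₂) (rootE₂ h₁ h₂) := by
  have hs := isRealSegment_top (h₁ := h₁) (h₂ := h₂)
  have hc : ContinuousOn (fun t : ℝ => (℘[L] (half₃ h₁ h₂ + 1 * t)).re) (Set.Icc 0 (W₂ / 2)) := by
    intro t _
    refine (continuousAt_re_weierstrassP ?_).continuousWithinAt
    exact notMem_rect_of_im h₁ h₂ (by simp [half₃, h₁]) (by simp [half₃, h₁])
  have hlt := (isRootTriple_rootE h₁ h₂).lt₂₃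
  have v0 : (℘[L] (half₃ h₁ h₂ + 1 * ((0 : ℝ) : ℂ))).re = rootE₃ h₁ h₂ := by simp [rootE₃]
  have v1 : (℘[L] (half₃ h₁ h₂ + 1 * ((W₂ / 2 : ℝ) : ℂ))).re = rootE₂ h₁ h₂ := by
    rw [right_end_top]; rfl
  rcases hs.deriv_sign one_ne_zero with h | h
  · exfalso
    have := strictAntiOn_of_deriv_neg (convex_Icc 0 (W₂ / 2)) hc fun t ht => by
      rw [interior_Icc] at ht
      rw [(IsRealSegment.hasDerivAt (hs.notMem t ht)).deriv]
      exact h t ht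
    have := this (Set.left_mem_Icc.2 hs.pos.le) (Set.right_mem_Icc.2 hs.pos.le) hs.pos
    simp only [v0, v1] at this
    exact lt_asymm hlt this
  · refine ⟨fun t ht => by simpa using h t ht, ?_⟩
    have := strictMonoOn_of_deriv_pos (convex_Icc 0 (W₂ / 2)) hc fun t ht => by
      rw [interior_Icc] at ht
      rw [(IsRealSegment.hasDerivAt (hs.notMem t ht)).deriv]
      exact h t ht
    have := image_Ioo_of_strictMonoOn hs.pos.le hc this
    rwa [v0, v1] at this

variable (h₁ h₂) in
lemma right_side : (fun t : ℝ => (℘[L] (half₁ h₁ h₂ + Complex.I * t)).re) '' Set.Ioo 0 (W₁ / 2) =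
      Set.Ioo (rootE₂ h₁ h₂) (rootE₁ h₁ h₂) := by
  have hs := isRealSegment_right (h₁ := h₁) (h₂ := h₂)
  have hc : ContinuousOn (fun t : ℝ => (℘[L] (half₁ h₁ h₂ + Complex.I * t)).re)
      (Set.Icc 0 (W₁ / 2)) := by
    intro t _
    refine (continuousAt_re_weierstrassP ?_).continuousWithinAt
    exact notMem_rect_of_re h₁ h₂ (by simp [half₁, h₂]) (by simp [half₁, h₂])
  have hlt := (isRootTriple_rootE h₁ h₂).lt₁₂
  have v0 : (℘[L] (half₁ h₁ h₂ + Complex.I * ((0 : ℝ) : ℂ))).re = rootE₁ h₁ h₂ := by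
    simp [rootE₁]
  have v1 : (℘[L] (half₁ h₁ h₂ + Complex.I * ((W₁ / 2 : ℝ) : ℂ))).re = rootE₂ h₁ h₂ := by
    rw [upper_end_right]; rfl
  rcases hs.deriv_sign (by norm_num) with h | h
  · have := strictAntiOn_of_deriv_neg (convex_Icc 0 (W₁ / 2)) hc fun t ht => by
      rw [interior_Icc] at ht
      rw [(IsRealSegment.hasDerivAt (hs.notMem t ht)).deriv]
      exact h t ht
    have := image_Ioo_of_strictAntiOn hs.pos.le hc this
    rwa [v0, v1] at this
  · exfalso
    have := strictMonoOn_of_deriv_pos (convex_Icc 0 (W₁ / 2)) hc fun t ht => by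
      rw [interior_Icc] at ht
      rw [(IsRealSegment.hasDerivAt (hs.notMem t ht)).deriv]
      exact h t ht
    have := this (Set.left_mem_Icc.2 hs.pos.le) (Set.right_mem_Icc.2 hs.pos.le) hs.pos
    simp only [v0, v1] at this
    exact lt_asymm hlt this

variable (h₁ h₂) in
lemma realPeriod_rootE : realPeriod (rootE₁ h₁ h₂) (rootE₂ h₁ h₂) (rootE₃ h₁ h₂) = W₂ := by
  have h := isRealSegment_top (h₁ := h₁) (h₂ := h₂)
  have h1 := h.integral_eq (Or.inl rfl) le_rfl h.pos.le le_rfl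
  rw [(top_side h₁ h₂).2] at h1
  simp only [one_mul] at h1
  rw [realPeriod, h1]
  ring

variable (h₁ h₂) in
lemma imagPeriod_rootE : imagPeriod (rootE₁ h₁ h₂) (rootE₂ h₁ h₂) (rootE₃ h₁ h₂) = W₁ := by
  have h := isRealSegment_right (h₁ := h₁) (h₂ := h₂)
  have h1 := h.integral_eq (Or.inr rfl) le_rfl h.pos.le le_rfl
  rw [right_side h₁ h₂] at h1
  simp only [neg_one_mul] at h1
  rw [imagPeriod, h1]
  ring

/-- The abelian integral from `e₁` to a larger value. -/
lemma exists_bottom_integral {u : ℝ} (hu : rootE₁ h₁ h₂ < u) :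
    ∃ τ ∈ Set.Ioo 0 (W₂ / 2), ℘[L] (τ : ℝ) = u ∧ ℘'[L] (τ : ℝ) ≠ 0 ∧
      ∫ s in Set.Ioo (rootE₁ h₁ h₂) u,
        2 / √(cubic (rootE₁ h₁ h₂) (rootE₂ h₁ h₂) (rootE₃ h₁ h₂) s) = 2 * (W₂ / 2 - τ) := by
  obtain ⟨τ, hτ, hτu⟩ := exists_bottom_eq hu
  have h := isRealSegment_bottom (h₁ := h₁) (h₂ := h₂)
  have h1 := h.integral_eq (Or.inl rfl) hτ.1.le hτ.2.le le_rfl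
  have hsub : Set.Icc τ (W₂ / 2) ⊆ Set.Ioc 0 (W₂ / 2) := fun s hs => ⟨hτ.1.trans_le hs.1, hs.2⟩
  obtain ⟨ha, hc⟩ := strictAntiOn_bottom h₁ h₂
  have h2 := image_Ioo_of_strictAntiOn hτ.2.le (hc.mono hsub) (ha.mono hsub)
  simp only [right_end_bottom (h₁ := h₁) (h₂ := h₂), hτu] at h2
  rw [h2] at h1
  simp only [one_mul] at h1
  refine ⟨τ, hτ, ?_, ?_, h1⟩
  · have := h.real τ
    rw [hτu] at this
    simpa using this.symm
  · intro h0
    apply h.deriv_ne_zero one_ne_zero hτ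
    simp [h0]

/-- `℘` maps the line `Re z = W₂ / 2` to `[e₂, e₁]`. -/
lemma weierstrassP_right_line (s : ℝ) : ∃ u : ℝ, rootE₂ h₁ h₂ ≤ u ∧ u ≤ rootE₁ h₁ h₂ ∧
    ℘[L] ⟨W₂ / 2, s⟩ = u := by
  set r := s - round (s / W₁) * W₁ with hr
  have hr2 : |r| ≤ W₁ / 2 := by
    have := abs_sub_round (s / W₁)
    have e : r = (s / W₁ - round (s / W₁)) * W₁ := by rw [hr]; field_simp
    rw [e, abs_mul, abs_of_pos h₁]
    nlinarith
  have e1 : ℘[L] ⟨W₂ / 2, s⟩ = ℘[L] ⟨W₂ / 2, |r|⟩ := by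
    rcases abs_choice r with h | h
    · rw [h]
      apply weierstrassP_eq_of_sub_mem
      exact (mem_rect h₁ h₂).2 ⟨round (s / W₁), 0, by simp, by simp [hr]⟩
    · rw [h, ← (L).weierstrassP_neg]
      apply weierstrassP_eq_of_sub_mem
      exact (mem_rect h₁ h₂).2 ⟨-round (s / W₁), -1, by simp; ring, by simp [hr]; ring⟩
  have e2 : (⟨W₂ / 2, |r|⟩ : ℂ) = half₁ h₁ h₂ + Complex.I * (|r| : ℝ) := by
    apply Complex.ext <;> simp [half₁]
  have hreal := (isRealSegment_right (h₁ := h₁) (h₂ := h₂)).real |r|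
  refine ⟨(℘[L] (half₁ h₁ h₂ + Complex.I * (|r| : ℝ))).re, ?_⟩
  rw [e1, e2, hreal]
  have hlt := (isRootTriple_rootE h₁ h₂).lt₁₂
  have key : rootE₂ h₁ h₂ ≤ (℘[L] (half₁ h₁ h₂ + Complex.I * (|r| : ℝ))).re ∧
      (℘[L] (half₁ h₁ h₂ + Complex.I * (|r| : ℝ))).re ≤ rootE₁ h₁ h₂ := by
    rcases (abs_nonneg r).eq_or_lt with h0 | h0
    · rw [← h0]
      simp only [Complex.ofReal_zero, mul_zero, add_zero]
      exact ⟨hlt.le, le_rfl⟩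
    rcases hr2.eq_or_lt with h3 | h3
    · rw [h3, upper_end_right]
      exact ⟨le_rfl, hlt.le⟩
    · have := (right_side h₁ h₂).subset (Set.mem_image_of_mem _ (show |r| ∈ Set.Ioo _ _ from ⟨h0, h3⟩))
      exact ⟨this.1.le, this.2.le⟩
  exact ⟨key.1, key.2, rfl⟩

/-- `℘` maps the line `Re z = 0` to `[-∞, e₃]`. -/
lemma weierstrassP_left_line {s : ℝ} (hs : (⟨0, s⟩ : ℂ) ∉ (L).lattice) :
    ∃ u : ℝ, u ≤ rootE₃ h₁ h₂ ∧ ℘[L] ⟨0, s⟩ = u := by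
  set r := s - round (s / W₁) * W₁ with hr
  have hr2 : |r| ≤ W₁ / 2 := by
    have := abs_sub_round (s / W₁)
    have e : r = (s / W₁ - round (s / W₁)) * W₁ := by rw [hr]; field_simp
    rw [e, abs_mul, abs_of_pos h₁]
    nlinarith
  have e1 : ℘[L] ⟨0, s⟩ = ℘[L] ⟨0, |r|⟩ := by
    rcases abs_choice r with h | h
    · rw [h]
      apply weierstrassP_eq_of_sub_mem
      exact (mem_rect h₁ h₂).2 ⟨round (s / W₁), 0, by simp, by simp [hr]⟩
    · rw [h, ← (L).weierstrassP_neg]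
      apply weierstrassP_eq_of_sub_mem
      exact (mem_rect h₁ h₂).2 ⟨-round (s / W₁), 0, by simp, by simp [hr]; ring⟩
  have e2 : (⟨0, |r|⟩ : ℂ) = 0 + Complex.I * (|r| : ℝ) := by
    apply Complex.ext <;> simp
  have hr0 : 0 < |r| := by
    refine abs_pos.2 fun h0 => hs ((mem_rect h₁ h₂).2 ⟨round (s / W₁), 0, by simp, ?_⟩)
    simp only
    linarith
  have hreal := (isRealSegment_left (h₁ := h₁) (h₂ := h₂)).real |r|
  refine ⟨(℘[L] (0 + Complex.I * (|r| : ℝ))).re, ?_⟩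
  rw [e1, e2, hreal]
  have hend : (℘[L] (0 + Complex.I * ((W₁ / 2 : ℝ) : ℂ))).re = rootE₃ h₁ h₂ := by
    rw [upper_end_left]; rfl
  refine ⟨?_, rfl⟩
  rcases hr2.eq_or_lt with h3 | h3
  · rw [h3, hend]
  · have := (strictMonoOn_left h₁ h₂).1 ⟨hr0, hr2⟩ (Set.right_mem_Ioc.2 (by linarith)) h3
    simp only [hend] at this
    exact this.le

end Rect

/-! ### The weights of a walk -/

section Walk

/-- The weights of the walk with step set `S`: each step has weight `z`. -/
def walkWeight (S : Finset (ℤ × ℤ)) (z : ℝ) (i j : ℤ) : ℝ := if (i, j) ∈ S then z else 0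

variable {S : Finset (ℤ × ℤ)} {z : ℝ}

lemma sum_small_steps (hS : ∀ s ∈ S, (-1 ≤ s.1 ∧ s.1 ≤ 1) ∧ (-1 ≤ s.2 ∧ s.2 ≤ 1))
    {M : Type*} [AddCommMonoid M] (f : ℤ × ℤ → M) :
    ∑ s ∈ S, f s = ∑ i ∈ ({-1, 0, 1} : Finset ℤ), ∑ j ∈ ({-1, 0, 1} : Finset ℤ),
      if (i, j) ∈ S then f (i, j) else 0 := by
  rw [← Finset.sum_product', ← Finset.sum_filter]
  refine Finset.sum_congr ?_ fun _ _ => rfl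
  ext ⟨i, j⟩
  simp only [Finset.mem_filter, Finset.mem_product, Finset.mem_insert, Finset.mem_singleton]
  refine ⟨fun h => ⟨?_, h⟩, fun h => h.2⟩
  have := hS _ h
  simp only at this
  omega

lemma isWeight_walkWeight
    (hsmall : ∀ s ∈ S, (-1 ≤ s.1 ∧ s.1 ≤ 1) ∧ (-1 ≤ s.2 ∧ s.2 ≤ 1) ∧ s ≠ (0, 0))
    (hnonsing : ∀ α β : ℝ, (α, β) ≠ (0, 0) → ∃ s ∈ S, α * s.1 + β * s.2 < 0)
    (hz : 0 < z) (hz' : S.card * z < 1) : IsWeight (walkWeight S z) where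
  nonneg i j := by unfold walkWeight; split_ifs <;> linarith
  zero := by
    rw [walkWeight, if_neg]
    exact fun h => (hsmall _ h).2.2 rfl
  sum_lt := by
    have h1 : ∑ s ∈ S, z = S.card * z := by simp
    rw [sum_small_steps (fun s hs => ⟨(hsmall s hs).1, (hsmall s hs).2.1⟩)] at h1
    have h0 : ((0, 0) : ℤ × ℤ) ∉ S := fun h => (hsmall _ h).2.2 rfl
    simp only [walkWeight]
    simp [h0] at h1
    linarith
  small i j h := by
    have : (i, j) ∈ S := by
      by_contra hn
      exact h (by rw [walkWeight, if_neg hn])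
    exact ⟨(hsmall _ this).1, (hsmall _ this).2.1⟩
  nonsing α β h := by
    obtain ⟨s, hs, h1⟩ := hnonsing α β h
    exact ⟨s.1, s.2, by rw [walkWeight, if_pos hs]; exact hz.ne', h1⟩

lemma wcoeff_walkWeight (hS : ∀ s ∈ S, (-1 ≤ s.1 ∧ s.1 ≤ 1) ∧ (-1 ≤ s.2 ∧ s.2 ≤ 1)) {j : ℤ}
    (hj : j ∈ ({-1, 0, 1} : Finset ℤ)) :
    C z * ∑ s ∈ S with s.2 = j, X ^ (s.1 + 1).toNat = wcoeff (walkWeight S z) j := by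
  rw [Finset.sum_filter, sum_small_steps hS, wcoeff]
  simp only [Finset.mem_insert, Finset.mem_singleton] at hj
  rcases hj with rfl | rfl | rfl <;>
    · simp [walkWeight, Finset.sum_insert, apply_ite C]
      split_ifs <;> simp [mul_add]
      all_goals try ring

lemma wcoeff_walkWeight_transpose (hS : ∀ s ∈ S, (-1 ≤ s.1 ∧ s.1 ≤ 1) ∧ (-1 ≤ s.2 ∧ s.2 ≤ 1))
    {i : ℤ} (hi : i ∈ ({-1, 0, 1} : Finset ℤ)) :
    C z * ∑ s ∈ S with s.1 = i, X ^ (s.2 + 1).toNat =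
      wcoeff (fun i j => walkWeight S z j i) i := by
  rw [Finset.sum_filter, sum_small_steps hS, wcoeff]
  simp only [Finset.mem_insert, Finset.mem_singleton] at hi
  rcases hi with rfl | rfl | rfl <;>
    · simp [walkWeight, Finset.sum_insert, apply_ite C]
      split_ifs <;> simp [mul_add]
      all_goals try ring

lemma d_eq_wdisc (hS : ∀ s ∈ S, (-1 ≤ s.1 ∧ s.1 ≤ 1) ∧ (-1 ≤ s.2 ∧ s.2 ≤ 1)) :
    d S z = wdisc (walkWeight S z) := by
  rw [d, a, b, c, wcoeff_walkWeight hS (by simp), wcoeff_walkWeight hS (by simp),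
    wcoeff_walkWeight hS (by simp), wdisc]

lemma d'_eq_wdisc (hS : ∀ s ∈ S, (-1 ≤ s.1 ∧ s.1 ≤ 1) ∧ (-1 ≤ s.2 ∧ s.2 ≤ 1)) :
    d' S z = wdisc fun i j => walkWeight S z j i := by
  rw [d', a', b', c', wcoeff_walkWeight_transpose hS (by simp),
    wcoeff_walkWeight_transpose hS (by simp), wcoeff_walkWeight_transpose hS (by simp), wdisc]

lemma K_eq_wker (hS : ∀ s ∈ S, (-1 ≤ s.1 ∧ s.1 ≤ 1) ∧ (-1 ≤ s.2 ∧ s.2 ≤ 1)) (x y : ℂ) :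
    K S z x y = wker (walkWeight S z) x y := by
  rw [K, sum_small_steps hS, wker]
  simp [walkWeight, Finset.sum_insert, aeval_wcoeff, apply_ite Complex.ofReal, mul_add,
    add_mul, mul_ite, ite_mul]
  ring_nf

end Walk

/-! ### The periods of the walk -/

section Periods

variable {p : ℝ[X]} {x₁ x₂ x₃ μ ν A B Γ D : ℝ}

lemma IsUniformizer.integral_image (h : IsBranched p x₁ x₂ x₃ μ ν)
    (hu : IsUniformizer p μ ν A B Γ D) (σ : ℝ) {s : Set ℝ} (hs : MeasurableSet s)
    (hlin : ∀ t ∈ s, A - Γ * t ≠ 0) :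
    ∫ t in s, 1 / √(σ * p.eval t) = ∫ u in mobInv A B Γ D '' s, 2 / √(σ *
      cubic (mobInv A B Γ D x₁) (mobInv A B Γ D x₂) (mobInv A B Γ D x₃) u) := by
  rw [← integral_mobInv hs h.natDegree_le hu hlin σ]
  simp only [(hu.isRootTriple h).2]

lemma IsUniformizer.imagPeriod_eq_integral (h : IsBranched p x₁ x₂ x₃ μ ν)
    (hu : IsUniformizer p μ ν A B Γ D) :
    ∫ t in x₁..x₂, 1 / √(-p.eval t) =
      imagPeriod (mobInv A B Γ D x₁) (mobInv A B Γ D x₂) (mobInv A B Γ D x₃) := by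
  have := h.neg_one_lt; have := h.lt₁₂; have := h.lt_one; have := h.one_lt
  have h1 := hu.integral_image h (-1) (s := Set.Ioo x₁ x₂) measurableSet_Ioo fun t ht =>
    hu.lin_ne_zero h (by linarith [ht.1]) (by linarith [ht.2])
  rw [hu.image_Ioo h (by linarith) (by linarith) (by linarith)] at h1
  simp only [neg_one_mul] at h1
  rw [intervalIntegral.integral_of_le h.lt₁₂.le, integral_Ioc_eq_integral_Ioo, h1, imagPeriod]

lemma IsUniformizer.realPeriod_eq_integral (h : IsBranched p x₁ x₂ x₃ μ ν)
    (hu : IsUniformizer p μ ν A B Γ D) :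
    ∫ t in x₂..x₃, 1 / √(p.eval t) =
      realPeriod (mobInv A B Γ D x₁) (mobInv A B Γ D x₂) (mobInv A B Γ D x₃) := by
  have := h.neg_one_lt; have := h.lt₁₂; have := h.lt_one; have := h.one_lt
  have h1 := hu.integral_image h 1 (s := Set.Ioo x₂ x₃) measurableSet_Ioo fun t ht =>
    hu.lin_ne_zero h (by linarith [ht.1]) (by linarith [ht.2])
  rw [hu.image_Ioo h (by linarith) (by linarith) (by linarith)] at h1
  simp only [one_mul] at h1
  rw [intervalIntegral.integral_of_le (by linarith), integral_Ioc_eq_integral_Ioo, h1, realPeriod]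

/-- The Möbius transformation `u ↦ (A u + B) / (Γ u + D)` maps the values of `℘` at the three
half-periods of the rectangular lattice to the branch points `x₁, x₂, x₃` of `p`, so that its
composition with `℘` uniformizes the curve `s² = 4 p(t)`. -/
structure IsCoordinate {W₁ W₂ : ℝ} (h₁ : 0 < W₁) (h₂ : 0 < W₂) (p : ℝ[X])
    (x₁ x₂ x₃ μ ν A B Γ D : ℝ) : Prop where
  branched : IsBranched p x₁ x₂ x₃ μ ν
  unif : IsUniformizer p μ ν A B Γ D
  e₁ : mobInv A B Γ D x₁ = rootE₁ h₁ h₂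
  e₂ : mobInv A B Γ D x₂ = rootE₂ h₁ h₂
  e₃ : mobInv A B Γ D x₃ = rootE₃ h₁ h₂

/-- Both coordinates of the kernel curve are uniformized by the Weierstrass function whose periods
are the complete elliptic integrals of the discriminant in `y`: the two discriminants have the
same invariants. -/
theorem exists_isCoordinate {w : ℤ → ℤ → ℝ} {y₁ y₂ y₃ μ' ν' : ℝ}
    (hx : IsBranched (wdisc w) x₁ x₂ x₃ μ ν)
    (hy : IsBranched (wdisc fun i j => w j i) y₁ y₂ y₃ μ' ν') :
    ∃ (W₁ W₂ : ℝ) (h₁ : 0 < W₁) (h₂ : 0 < W₂) (A B Γ D A' B' Γ' D' : ℝ),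
      ∫ t in x₁..x₂, 1 / √(-(wdisc w).eval t) = W₁ ∧
      ∫ t in x₂..x₃, 1 / √((wdisc w).eval t) = W₂ ∧
      IsCoordinate h₁ h₂ (wdisc w) x₁ x₂ x₃ μ ν A B Γ D ∧
      IsCoordinate h₁ h₂ (wdisc fun i j => w j i) y₁ y₂ y₃ μ' ν' A' B' Γ' D' := by
  obtain ⟨A, B, Γ, D, hu⟩ := exists_isUniformizer hx
  obtain ⟨A', B', Γ', D', hu'⟩ := exists_isUniformizer hy
  obtain ⟨t1, c1⟩ := hu.isRootTriple hx
  obtain ⟨t2, c2⟩ := hu'.isRootTriple hy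
  obtain ⟨a1, a2, a3⟩ := t1.eq_of_periods (isRootTriple_rootE (imagPeriod_pos t1) (realPeriod_pos t1))
    (realPeriod_rootE _ _).symm (imagPeriod_rootE _ _).symm
  have hc : ∀ u, cubic (mobInv A' B' Γ' D' y₁) (mobInv A' B' Γ' D' y₂) (mobInv A' B' Γ' D' y₃) u =
      cubic (mobInv A B Γ D x₁) (mobInv A B Γ D x₂) (mobInv A B Γ D x₃) u := by
    intro u
    rw [← c1, ← c2, quarticG2_transpose, quarticG3_transpose]
  obtain ⟨b1, b2, b3⟩ := t2.unique t1 hc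
  exact ⟨_, _, imagPeriod_pos t1, realPeriod_pos t1, A, B, Γ, D, A', B', Γ', D',
    hu.imagPeriod_eq_integral hx, hu.realPeriod_eq_integral hx, ⟨hx, hu, a1, a2, a3⟩,
    ⟨hy, hu', b1.trans a1, b2.trans a2, b3.trans a3⟩⟩

end Periods

/-! ### Möbius transforms of the Weierstrass function -/

section Mobius

variable {W₁ W₂ : ℝ} (h₁ : 0 < W₁) (h₂ : 0 < W₂)

local notation "L" => rectPair h₁ h₂

open Classical in
/-- The linear form `A ℘ + B`, or rather its leading coefficient `A` at the poles of `℘`. The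
quotient of two such forms is a Möbius transform of `℘` with the correct values at these poles. -/
def linP (A B : ℝ) (ω : ℂ) : ℂ := if ω ∈ (L).lattice then (A : ℂ) else A * ℘[L] ω + B

/-- The value of `(A ℘ + B) / (Γ ℘ + D)`, which is `0` at the poles of this function. -/
def mobP (A B Γ D : ℝ) (ω : ℂ) : ℂ := linP h₁ h₂ A B ω / linP h₁ h₂ Γ D ω

lemma linP_of_mem {ω : ℂ} (hω : ω ∈ (L).lattice) (A B : ℝ) : linP h₁ h₂ A B ω = A := if_pos hω

lemma linP_of_notMem {ω : ℂ} (hω : ω ∉ (L).lattice) (A B : ℝ) :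
    linP h₁ h₂ A B ω = A * ℘[L] ω + B := if_neg hω

lemma mobP_inv (A B Γ D : ℝ) (ω : ℂ) : (mobP h₁ h₂ A B Γ D ω)⁻¹ = mobP h₁ h₂ Γ D A B ω := by
  rw [mobP, mobP, inv_div]

lemma linP_eq_of_sub_mem (A B : ℝ) {ω ω' : ℂ} (h : ω - ω' ∈ (L).lattice) :
    linP h₁ h₂ A B ω = linP h₁ h₂ A B ω' := by
  have h1 : ω ∈ (L).lattice ↔ ω' ∈ (L).lattice := by
    constructor
    · intro h'
      simpa using sub_mem h' h
    · intro h'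
      simpa using add_mem h h'
  by_cases hω : ω ∈ (L).lattice
  · rw [linP_of_mem h₁ h₂ hω, linP_of_mem h₁ h₂ (h1.1 hω)]
  · rw [linP_of_notMem h₁ h₂ hω, linP_of_notMem h₁ h₂ (mt h1.2 hω),
      weierstrassP_eq_of_sub_mem h₁ h₂ h]

lemma linP_neg (A B : ℝ) (ω : ℂ) : linP h₁ h₂ A B (-ω) = linP h₁ h₂ A B ω := by
  by_cases hω : ω ∈ (L).lattice
  · rw [linP_of_mem h₁ h₂ hω, linP_of_mem h₁ h₂ (neg_mem hω)]
  · rw [linP_of_notMem h₁ h₂ hω, linP_of_notMem h₁ h₂ (by simpa using hω),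
      (L).weierstrassP_neg]

lemma conj_mem_rect_iff {z : ℂ} : (starRingEnd ℂ) z ∈ (L).lattice ↔ z ∈ (L).lattice :=
  ⟨fun h => by simpa using conj_mem_rect h₁ h₂ h, conj_mem_rect h₁ h₂⟩

lemma linP_conj (A B : ℝ) (ω : ℂ) :
    linP h₁ h₂ A B ((starRingEnd ℂ) ω) = (starRingEnd ℂ) (linP h₁ h₂ A B ω) := by
  by_cases hω : ω ∈ (L).lattice
  · rw [linP_of_mem h₁ h₂ hω, linP_of_mem h₁ h₂ ((conj_mem_rect_iff h₁ h₂).2 hω),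
      Complex.conj_ofReal]
  · rw [linP_of_notMem h₁ h₂ hω, linP_of_notMem h₁ h₂ (mt (conj_mem_rect_iff h₁ h₂).1 hω),
      weierstrassP_conj]
    simp

lemma linP_ne_zero_or {A B Γ D : ℝ} (hdet : A * D - B * Γ ≠ 0) (ω : ℂ) :
    linP h₁ h₂ A B ω ≠ 0 ∨ linP h₁ h₂ Γ D ω ≠ 0 := by
  by_contra! h
  apply hdet
  unfold linP at h
  split_ifs at h
  · have h3 : A = 0 := by exact_mod_cast h.1
    have h4 : Γ = 0 := by exact_mod_cast h.2
    rw [h3, h4]; ring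
  · have : (A : ℂ) * D - B * Γ = 0 := by linear_combination A * h.2 - Γ * h.1
    exact_mod_cast this

lemma tendsto_linP_cobounded {Γ : ℝ} (D : ℝ) (hΓ : Γ ≠ 0) {l : ℂ} (hl : l ∈ (L).lattice) :
    Tendsto (fun ω => (Γ : ℂ) * ℘[L] ω + D) (𝓝[≠] l) (Bornology.cobounded ℂ) := by
  have h1 := tendsto_norm_cobounded_atTop.comp (tendsto_weierstrassP_cobounded (L) hl)
  have h2 : Tendsto (fun ω => |Γ| * ‖℘[L] ω‖ - |D|) (𝓝[≠] l) atTop :=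
    tendsto_atTop_add_const_right _ _ (h1.const_mul_atTop (abs_pos.2 hΓ))
  rw [← tendsto_norm_atTop_iff_cobounded]
  refine tendsto_atTop_mono (fun ω => ?_) h2
  have := norm_sub_le ((Γ : ℂ) * ℘[L] ω + D) D
  simp only [add_sub_cancel_right, norm_mul, Complex.norm_real, Real.norm_eq_abs] at this
  linarith

lemma eventually_linP_ne_zero {Γ D : ℝ} {ω : ℂ} (h : linP h₁ h₂ Γ D ω ≠ 0) :
    ∀ᶠ u in 𝓝 ω, linP h₁ h₂ Γ D u ≠ 0 := by
  by_cases hω : ω ∈ (L).lattice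
  · have hΓ : Γ ≠ 0 := by
      rw [linP_of_mem h₁ h₂ hω] at h; exact_mod_cast h
    have h1 := (tendsto_linP_cobounded h₁ h₂ D hΓ hω).eventually (Bornology.eventually_ne_cobounded 0)
    have h2 : ∀ᶠ u in 𝓝[≠] ω, linP h₁ h₂ Γ D u ≠ 0 := by
      filter_upwards [h1, eventually_notMem_lattice (L) ω] with u hu hu'
      rwa [linP_of_notMem h₁ h₂ hu']
    rw [eventually_nhdsWithin_iff] at h2
    filter_upwards [h2] with u hu
    by_cases h3 : u = ω
    · rwa [h3]
    · exact hu h3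
  · have hc : ContinuousAt (fun u => (Γ : ℂ) * ℘[L] u + D) ω :=
      ((hasDerivAt_weierstrassP (L) hω).continuousAt.const_mul _).add_const _
    rw [linP_of_notMem h₁ h₂ hω] at h
    filter_upwards [hc.eventually_ne h, (L).isClosed_lattice.isOpen_compl.mem_nhds hω] with u hu hu'
    rwa [linP_of_notMem h₁ h₂ hu']

lemma hasDerivAt_mobP (A B : ℝ) {Γ D : ℝ} {ω : ℂ} (hω : ω ∉ (L).lattice)
    (h : linP h₁ h₂ Γ D ω ≠ 0) :
    HasDerivAt (mobP h₁ h₂ A B Γ D) ((A * D - B * Γ) * ℘'[L] ω / linP h₁ h₂ Γ D ω ^ 2) ω := by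
  have hP := hasDerivAt_weierstrassP (L) hω
  rw [linP_of_notMem h₁ h₂ hω] at h ⊢
  have h1 := ((hP.const_mul (A : ℂ)).add_const (B : ℂ)).div
    ((hP.const_mul (Γ : ℂ)).add_const (D : ℂ)) h
  refine (h1.congr_of_eventuallyEq ?_).congr_deriv ?_
  · filter_upwards [(L).isClosed_lattice.isOpen_compl.mem_nhds hω] with u hu
    rw [mobP, linP_of_notMem h₁ h₂ hu, linP_of_notMem h₁ h₂ hu]
    rfl
  · congr 1
    ring

lemma analyticAt_mobP (A B : ℝ) {Γ D : ℝ} {ω : ℂ} (h : linP h₁ h₂ Γ D ω ≠ 0) :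
    AnalyticAt ℂ (mobP h₁ h₂ A B Γ D) ω := by
  refine Complex.analyticAt_of_differentiable_on_punctured_nhds_of_continuousAt ?_ ?_
  · filter_upwards [eventually_notMem_lattice (L) ω,
      nhdsWithin_le_nhds (eventually_linP_ne_zero h₁ h₂ h)] with u hu hu'
    exact (hasDerivAt_mobP h₁ h₂ A B hu hu').differentiableAt
  · by_cases hω : ω ∈ (L).lattice
    · have hΓ : (Γ : ℂ) ≠ 0 := by rwa [linP_of_mem h₁ h₂ hω] at h
      rw [continuousAt_iff_punctured_nhds, mobP, linP_of_mem h₁ h₂ hω, linP_of_mem h₁ h₂ hω]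
      have h1 := tendsto_inv₀_cobounded.comp
        (tendsto_linP_cobounded h₁ h₂ D (by exact_mod_cast hΓ) hω)
      have h2 := (h1.const_mul (((A : ℂ) * D - B * Γ) / Γ)).const_sub ((A : ℂ) / Γ)
      rw [mul_zero, sub_zero] at h2
      refine h2.congr' ?_
      filter_upwards [eventually_notMem_lattice (L) ω,
        nhdsWithin_le_nhds (eventually_linP_ne_zero h₁ h₂ h)] with u hu hu'
      rw [linP_of_notMem h₁ h₂ hu] at hu'
      rw [mobP, linP_of_notMem h₁ h₂ hu, linP_of_notMem h₁ h₂ hu]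
      simp only [Function.comp]
      field_simp
      ring
    · exact (hasDerivAt_mobP h₁ h₂ A B hω h).continuousAt

/-- A Möbius transform of the Weierstrass function that uniformizes the curve `s² = 4 p(t)`. -/
structure IsMobius (p : ℝ[X]) (A B Γ D : ℝ) : Prop where
  natDegree_le : p.natDegree ≤ 4
  det_ne : A * D - B * Γ ≠ 0
  homEval_eq : ∀ u : ℂ, 4 * homEval p (A * u + B) (Γ * u + D) = (A * D - B * Γ) ^ 2 *
    (4 * (u - rootE₁ h₁ h₂) * (u - rootE₂ h₁ h₂) * (u - rootE₃ h₁ h₂))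

variable {h₁ h₂} {p : ℝ[X]} {A B Γ D : ℝ}

namespace IsMobius

lemma eventually_deriv_sq (h : IsMobius h₁ h₂ p A B Γ D) {ω : ℂ} (hω : ω ∉ (L).lattice)
    (hd : linP h₁ h₂ Γ D ω ≠ 0) :
    deriv (mobP h₁ h₂ A B Γ D) ω ^ 2 = 4 * aeval (mobP h₁ h₂ A B Γ D ω) p := by
  rw [(hasDerivAt_mobP h₁ h₂ A B hω hd).deriv]
  have h1 := h.homEval_eq (℘[L] ω)
  rw [← derivWeierstrassP_sq_eq h₁ h₂ hω, ← linP_of_notMem h₁ h₂ hω, ← linP_of_notMem h₁ h₂ hω,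
    QuarterPlane.homEval_eq h.natDegree_le _ hd] at h1
  rw [div_pow, mobP, mul_pow, ← h1]
  field_simp

/-- The differential equation of the uniformization. -/
lemma deriv_sq (h : IsMobius h₁ h₂ p A B Γ D) {ω : ℂ} (hd : linP h₁ h₂ Γ D ω ≠ 0) :
    deriv (mobP h₁ h₂ A B Γ D) ω ^ 2 = 4 * aeval (mobP h₁ h₂ A B Γ D ω) p := by
  have ha := analyticAt_mobP h₁ h₂ A B hd
  have h1 : ContinuousAt (fun u => deriv (mobP h₁ h₂ A B Γ D) u ^ 2) ω :=
    ha.deriv.continuousAt.pow 2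
  have h2 : ContinuousAt (fun u => 4 * aeval (mobP h₁ h₂ A B Γ D u) p) ω :=
    (ContinuousAt.comp (g := fun v : ℂ => aeval v p) (p.continuous_aeval).continuousAt
      ha.continuousAt).const_mul 4
  refine ((h1.eventuallyEq_nhds_iff_eventuallyEq_nhdsNE h2).1 ?_).eq_of_nhds
  filter_upwards [eventually_notMem_lattice (L) ω,
    nhdsWithin_le_nhds (eventually_linP_ne_zero h₁ h₂ hd)] with u hu hu'
  exact h.eventually_deriv_sq hu hu'

lemma eventually_deriv_ne_zero (h : IsMobius h₁ h₂ p A B Γ D) {ω : ℂ}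
    (hd : linP h₁ h₂ Γ D ω ≠ 0) : ∀ᶠ u in 𝓝[≠] ω, deriv (mobP h₁ h₂ A B Γ D) u ≠ 0 := by
  have h3 : ∀ᶠ u in 𝓝[≠] ω, 2 * u ∉ (L).lattice := by
    have h4 : Tendsto (fun u : ℂ => 2 * u) (𝓝[≠] ω) (𝓝[≠] (2 * ω)) := by
      refine tendsto_nhdsWithin_of_tendsto_nhds_of_eventually_within _ ?_ ?_
      · exact ((continuous_const.mul continuous_id).tendsto ω).mono_left nhdsWithin_le_nhds
      · filter_upwards [self_mem_nhdsWithin] with u hu h5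
        exact hu (mul_left_cancel₀ two_ne_zero h5)
    exact h4.eventually (eventually_notMem_lattice (L) (2 * ω))
  filter_upwards [eventually_notMem_lattice (L) ω, h3,
    nhdsWithin_le_nhds (eventually_linP_ne_zero h₁ h₂ hd)] with u hu h2u hu'
  rw [(hasDerivAt_mobP h₁ h₂ A B hu hu').deriv]
  refine div_ne_zero (mul_ne_zero (by exact_mod_cast h.det_ne) fun h0 => h2u ?_) (pow_ne_zero _ hu')
  exact two_mul_mem_lattice_of_derivWeierstrassP_eq_zero (L) hu h0

/-- The differential equation of second order. -/
lemma deriv_deriv (h : IsMobius h₁ h₂ p A B Γ D) {ω : ℂ} (hd : linP h₁ h₂ Γ D ω ≠ 0) :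
    deriv (deriv (mobP h₁ h₂ A B Γ D)) ω =
      2 * aeval (mobP h₁ h₂ A B Γ D ω) (derivative p) := by
  have ha := analyticAt_mobP h₁ h₂ A B hd
  refine ((ha.deriv.deriv.continuousAt.eventuallyEq_nhds_iff_eventuallyEq_nhdsNE
    ((ContinuousAt.comp (g := fun v : ℂ => aeval v (derivative p))
      ((derivative p).continuous_aeval).continuousAt ha.continuousAt).const_mul 2)).1 ?_).eq_of_nhds
  filter_upwards [h.eventually_deriv_ne_zero hd,
    nhdsWithin_le_nhds (eventually_linP_ne_zero h₁ h₂ hd)] with u hu hu'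
  have hb := analyticAt_mobP h₁ h₂ A B hu'
  have e : (fun v => deriv (mobP h₁ h₂ A B Γ D) v ^ 2) =ᶠ[𝓝 u]
      fun v => 4 * aeval (mobP h₁ h₂ A B Γ D v) p := by
    filter_upwards [eventually_linP_ne_zero h₁ h₂ hu'] with v hv
    exact h.deriv_sq hv
  have e1 := e.deriv_eq
  have d1 := (hb.deriv.differentiableAt.hasDerivAt.pow 2).deriv
  have d2 := (((p.hasDerivAt_aeval (mobP h₁ h₂ A B Γ D u)).comp u
    hb.differentiableAt.hasDerivAt).const_mul 4).deriv
  have d3 : deriv (fun v => deriv (mobP h₁ h₂ A B Γ D) v ^ 2) u = _ := d1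
  have d4 : deriv (fun v => 4 * aeval (mobP h₁ h₂ A B Γ D v) p) u = _ := d2
  rw [d3, d4] at e1
  refine mul_right_cancel₀ (mul_ne_zero (two_ne_zero' ℂ) hu) ?_
  simp only [Nat.cast_ofNat] at e1
  simp only [Function.comp]
  linear_combination e1

end IsMobius

lemma meromorphic_mobP : Meromorphic (mobP h₁ h₂ A B Γ D) := by
  intro ω
  have hP := (L).meromorphic_weierstrassP ω
  have h : MeromorphicAt (fun u => ((A : ℂ) * ℘[L] u + B) / (Γ * ℘[L] u + D)) ω := by fun_prop
  refine h.congr ?_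
  filter_upwards [eventually_notMem_lattice (L) ω] with u hu
  rw [mobP, linP_of_notMem h₁ h₂ hu, linP_of_notMem h₁ h₂ hu]

/-! ### The position with respect to the unit circle -/

variable (h₁ h₂) in
/-- A continuous function of `ω` with the sign of `|f(ω)| - 1`, for the Möbius transform
`f = (A ℘ + B) / (Γ ℘ + D)`. -/
def height (A B Γ D : ℝ) (ω : ℂ) : ℝ :=
  (‖linP h₁ h₂ A B ω‖ ^ 2 - ‖linP h₁ h₂ Γ D ω‖ ^ 2) /
    (‖linP h₁ h₂ A B ω‖ ^ 2 + ‖linP h₁ h₂ Γ D ω‖ ^ 2)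

lemma height_denom_pos (hdet : A * D - B * Γ ≠ 0) (ω : ℂ) :
    0 < ‖linP h₁ h₂ A B ω‖ ^ 2 + ‖linP h₁ h₂ Γ D ω‖ ^ 2 := by
  rcases linP_ne_zero_or h₁ h₂ hdet ω with h | h
  · have := norm_pos_iff.2 h; positivity
  · have := norm_pos_iff.2 h; positivity

lemma height_eq {ω : ℂ} (hd : linP h₁ h₂ Γ D ω ≠ 0) :
    height h₁ h₂ A B Γ D ω =
      (‖mobP h₁ h₂ A B Γ D ω‖ ^ 2 - 1) / (‖mobP h₁ h₂ A B Γ D ω‖ ^ 2 + 1) := by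
  have := norm_pos_iff.2 hd
  rw [mobP, norm_div, height, div_pow]
  field_simp

lemma height_swap (ω : ℂ) : height h₁ h₂ Γ D A B ω = -height h₁ h₂ A B Γ D ω := by
  rw [height, height, ← neg_div, add_comm]
  congr 1
  ring

lemma continuous_height (hdet : A * D - B * Γ ≠ 0) : Continuous (height h₁ h₂ A B Γ D) := by
  have key : ∀ {A B Γ D : ℝ} {ω : ℂ}, linP h₁ h₂ Γ D ω ≠ 0 →
      ContinuousAt (height h₁ h₂ A B Γ D) ω := by
    intro A B Γ D ω hd
    have hc := (analyticAt_mobP h₁ h₂ A B hd).continuousAt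
    have h1 : ContinuousAt (fun ω => (‖mobP h₁ h₂ A B Γ D ω‖ ^ 2 - 1) /
        (‖mobP h₁ h₂ A B Γ D ω‖ ^ 2 + 1)) ω :=
      ((hc.norm.pow 2).sub_const 1).div ((hc.norm.pow 2).add_const 1) (by positivity)
    refine h1.congr ?_
    filter_upwards [eventually_linP_ne_zero h₁ h₂ hd] with u hu
    rw [height_eq hu]
  refine continuous_iff_continuousAt.2 fun ω => ?_
  rcases linP_ne_zero_or h₁ h₂ hdet ω with h | h
  · have h2 := (key (A := Γ) (B := D) h).neg
    refine h2.congr (Eventually.of_forall fun u => ?_)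
    rw [Pi.neg_apply, height_swap, neg_neg]
  · exact key h

lemma height_neg_iff (hdet : A * D - B * Γ ≠ 0) (ω : ℂ) : height h₁ h₂ A B Γ D ω < 0 ↔
    linP h₁ h₂ Γ D ω ≠ 0 ∧ ‖mobP h₁ h₂ A B Γ D ω‖ < 1 := by
  have h3 := height_denom_pos (h₁ := h₁) (h₂ := h₂) hdet ω
  rw [height, div_lt_iff₀ h3, zero_mul, sub_neg,
    pow_lt_pow_iff_left₀ (norm_nonneg _) (norm_nonneg _) two_ne_zero, mobP, norm_div]
  constructor
  · intro h
    have h0 := (norm_nonneg _).trans_lt h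
    exact ⟨norm_pos_iff.1 h0, (div_lt_one h0).2 h⟩
  · rintro ⟨h0, h⟩
    exact (div_lt_one (norm_pos_iff.2 h0)).1 h

lemma height_eq_zero_iff (hdet : A * D - B * Γ ≠ 0) (ω : ℂ) : height h₁ h₂ A B Γ D ω = 0 ↔
    linP h₁ h₂ Γ D ω ≠ 0 ∧ ‖mobP h₁ h₂ A B Γ D ω‖ = 1 := by
  rw [height, div_eq_zero_iff, or_iff_left (height_denom_pos hdet ω).ne', sub_eq_zero,
    pow_left_inj₀ (norm_nonneg _) (norm_nonneg _) two_ne_zero, mobP, norm_div]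
  constructor
  · intro h
    have h0 : linP h₁ h₂ Γ D ω ≠ 0 := by
      intro h0
      have h1 := height_denom_pos (h₁ := h₁) (h₂ := h₂) hdet ω
      rw [h, h0] at h1
      simp at h1
    exact ⟨h0, by rw [h, div_self (norm_ne_zero_iff.2 h0)]⟩
  · rintro ⟨h0, h⟩
    exact (div_eq_one_iff_eq (norm_ne_zero_iff.2 h0)).1 h

lemma height_eq_of_sub_mem {ω ω' : ℂ} (h : ω - ω' ∈ (L).lattice) :
    height h₁ h₂ A B Γ D ω = height h₁ h₂ A B Γ D ω' := by
  simp only [height, linP_eq_of_sub_mem h₁ h₂ _ _ h]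

lemma height_neg_arg (ω : ℂ) : height h₁ h₂ A B Γ D (-ω) = height h₁ h₂ A B Γ D ω := by
  simp only [height, linP_neg]

lemma height_conj (ω : ℂ) :
    height h₁ h₂ A B Γ D ((starRingEnd ℂ) ω) = height h₁ h₂ A B Γ D ω := by
  simp only [height, linP_conj, RCLike.norm_conj]

/-- The derivative of `|f|² / 2` along horizontal lines. -/
def radial (f : ℂ → ℂ) (ω : ℂ) : ℝ := (deriv f ω * (starRingEnd ℂ) (f ω)).re

lemma sign_height {ω : ℂ} (hdet : A * D - B * Γ ≠ 0) (h0 : height h₁ h₂ A B Γ D ω = 0) {ε : ℝ}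
    (hε : 0 < ε * radial (mobP h₁ h₂ A B Γ D) ω) :
    ∀ᶠ t : ℝ in 𝓝 0, SignType.sign (ε * height h₁ h₂ A B Γ D (ω + t)) = SignType.sign t := by
  obtain ⟨hd, h1⟩ := (height_eq_zero_iff hdet ω).1 h0
  have hf := (analyticAt_mobP h₁ h₂ A B hd).differentiableAt.hasDerivAt
  have hl : HasDerivAt (fun t : ℝ => mobP h₁ h₂ A B Γ D (ω + t))
      (deriv (mobP h₁ h₂ A B Γ D) ω) 0 := by
    have hadd : HasDerivAt (fun t : ℂ => ω + t) 1 ((0 : ℝ) : ℂ) := by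
      simpa using (hasDerivAt_id (0 : ℂ)).const_add ω
    have h3 : HasDerivAt (mobP h₁ h₂ A B Γ D) (deriv (mobP h₁ h₂ A B Γ D) ω)
        (ω + ((0 : ℝ) : ℂ)) := by simpa using hf
    simpa using (h3.comp ((0 : ℝ) : ℂ) hadd).comp_ofReal
  have hn := ((hl.norm_sq.sub_const 1).const_mul ε)
  have hpos : 0 < deriv (fun t : ℝ => ε * (‖mobP h₁ h₂ A B Γ D (ω + t)‖ ^ 2 - 1)) 0 := by
    rw [hn.deriv]
    have e : inner ℝ (mobP h₁ h₂ A B Γ D (ω + (0 : ℝ))) (deriv (mobP h₁ h₂ A B Γ D) ω) =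
        radial (mobP h₁ h₂ A B Γ D) ω := by
      rw [Complex.inner, radial]
      simp
    rw [e]
    linarith
  have hzero : ε * (‖mobP h₁ h₂ A B Γ D (ω + (0 : ℝ))‖ ^ 2 - 1) = 0 := by
    simp [h1]
  have h4 := eventually_nhdsWithin_sign_eq_of_deriv_pos hpos hzero
  have h5 : ∀ᶠ t : ℝ in 𝓝 0, linP h₁ h₂ Γ D (ω + t) ≠ 0 := by
    have : Tendsto (fun t : ℝ => ω + (t : ℂ)) (𝓝 0) (𝓝 ω) := by
      have : Continuous fun t : ℝ => ω + (t : ℂ) := by fun_prop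
      simpa using this.tendsto 0
    exact this.eventually (eventually_linP_ne_zero h₁ h₂ hd)
  filter_upwards [h4, h5] with t ht ht'
  rw [sub_zero] at ht
  rw [← ht, height_eq ht', ← mul_div_assoc, div_eq_mul_inv, sign_mul,
    sign_pos (inv_pos.2 (by positivity)), mul_one]

/-- On the unit circle, `f` crosses transversally in the horizontal direction. -/
lemma radial_ne_zero {w : ℤ → ℤ → ℝ} (hw : IsWeight w) (h : IsMobius h₁ h₂ (wdisc w) A B Γ D)
    {ω : ℂ} (h0 : height h₁ h₂ A B Γ D ω = 0) : radial (mobP h₁ h₂ A B Γ D) ω ≠ 0 := by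
  obtain ⟨hd, h1⟩ := (height_eq_zero_iff h.det_ne ω).1 h0
  intro hr
  set f := mobP h₁ h₂ A B Γ D with hf
  have hmul : (starRingEnd ℂ) (f ω) * f ω = 1 := by
    rw [mul_comm, Complex.mul_conj, Complex.normSq_eq_norm_sq, h1]; norm_num
  set v := deriv f ω * (starRingEnd ℂ) (f ω) with hv
  have hv2 : v = (v.im : ℝ) * Complex.I := by
    apply Complex.ext
    · have : v.re = 0 := hr
      simp [this]
    · simp
  have h2 := h.deriv_sq hd
  rw [← hf] at h2
  have h3 : deriv f ω = v * f ω := by rw [hv, mul_assoc, hmul, mul_one]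
  refine wdisc_div_sq_ne hw h1 (r := -(v.im ^ 2) / 4) (by nlinarith [sq_nonneg v.im]) ?_
  have h4 : v ^ 2 = -((v.im : ℂ) ^ 2) := by
    conv_lhs => rw [hv2]
    rw [mul_pow, Complex.I_sq]; ring
  push_cast
  rw [h3] at h2
  linear_combination -h2 / 4 + h4 * f ω ^ 2 / 4

end Mobius

/-! ### Families of functions with transversal zeros -/

/-- A continuous family of functions `φ(·, s)` on `[0, c]`, positive at `0` and negative at `c`,
whose zeros are transversal; `ψ` has the sign of the derivative at these zeros. -/
structure IsTransversal (c : ℝ) (φ ψ : ℝ × ℝ → ℝ) : Prop where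
  pos : 0 < c
  cont : Continuous φ
  contOn : ContinuousOn ψ {v | φ v = 0}
  ne_zero : ∀ v, φ v = 0 → ψ v ≠ 0
  sign_of_pos : ∀ t s, φ (t, s) = 0 → 0 < ψ (t, s) →
    ∀ᶠ δ in 𝓝 (0 : ℝ), SignType.sign (φ (t + δ, s)) = SignType.sign δ
  sign_of_neg : ∀ t s, φ (t, s) = 0 → ψ (t, s) < 0 →
    ∀ᶠ δ in 𝓝 (0 : ℝ), SignType.sign (-φ (t + δ, s)) = SignType.sign δ
  left_pos : ∀ s, 0 < φ (0, s)
  right_neg : ∀ s, φ (c, s) < 0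

namespace IsTransversal

variable {c : ℝ} {φ ψ : ℝ × ℝ → ℝ}

lemma isClosed_zeros (h : IsTransversal c φ ψ) :
    IsClosed ({v : ℝ × ℝ | φ v = 0} ∩ ψ ⁻¹' Set.Ici 0) :=
  h.contOn.preimage_isClosed_of_isClosed (isClosed_eq h.cont continuous_const) isClosed_Ici

/-- The direction in which zeros are crossed does not depend on the parameter. -/
lemma crossing_neg (h : IsTransversal c φ ψ) {s₀ : ℝ}
    (h0 : ∀ t ∈ Set.Icc 0 c, φ (t, s₀) = 0 → ψ (t, s₀) < 0) (s : ℝ) :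
    ∀ t ∈ Set.Icc 0 c, φ (t, s) = 0 → ψ (t, s) < 0 := by
  set T : Set ℝ := {s | ∀ t ∈ Set.Icc 0 c, φ (t, s) = 0 → ψ (t, s) < 0} with hT
  have hTc : Tᶜ = Prod.snd '' ((Set.Icc 0 c ×ˢ Set.univ) ∩
      ({v : ℝ × ℝ | φ v = 0} ∩ ψ ⁻¹' Set.Ici 0)) := by
    ext s
    simp only [hT, Set.mem_compl_iff, Set.mem_ofPred_eq, Set.mem_image, Set.mem_inter_iff,
      Set.mem_prod, Set.mem_univ, and_true, Set.mem_preimage, Set.mem_Ici, Prod.exists,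
      exists_eq_right]
    push Not
    rfl
  have hopen : IsOpen T := by
    rw [← isClosed_compl_iff, hTc]
    have hK : IsCompact (Set.Icc (0 : ℝ) c) := isCompact_Icc
    have : Prod.snd '' ((Set.Icc 0 c ×ˢ Set.univ) ∩
        ({v : ℝ × ℝ | φ v = 0} ∩ ψ ⁻¹' Set.Ici 0)) =
      Prod.snd '' ((Prod.map ((↑) : Set.Icc (0 : ℝ) c → ℝ) (id : ℝ → ℝ)) ⁻¹'
        ({v : ℝ × ℝ | φ v = 0} ∩ ψ ⁻¹' Set.Ici 0)) := by
      ext s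
      constructor
      · rintro ⟨⟨t, s⟩, ⟨⟨ht, -⟩, h2⟩, rfl⟩
        exact ⟨(⟨t, ht⟩, s), h2, rfl⟩
      · rintro ⟨⟨t, s⟩, h2, rfl⟩
        exact ⟨(t, s), ⟨⟨t.2, trivial⟩, h2⟩, rfl⟩
    rw [this]
    have : CompactSpace (Set.Icc (0 : ℝ) c) := isCompact_iff_compactSpace.1 hK
    exact isClosedMap_snd_of_compactSpace _
      (h.isClosed_zeros.preimage (continuous_subtype_val.prodMap continuous_id))
  have hclosed : IsOpen Tᶜ := by
    rw [isOpen_iff_mem_nhds]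
    intro s hs
    simp only [hT, Set.mem_compl_iff, Set.mem_ofPred_eq] at hs
    push Not at hs
    obtain ⟨t, ht, h1, h2⟩ := hs
    have h3 : 0 < ψ (t, s) := lt_of_le_of_ne h2 (h.ne_zero _ h1).symm
    have ht0 : 0 < t := lt_of_le_of_ne ht.1 (by rintro rfl; exact (h.left_pos s).ne' h1)
    have htc : t < c := lt_of_le_of_ne ht.2 (by rintro rfl; exact (h.right_neg s).ne h1)
    -- zeros near `(t, s)` are crossed upwards
    have h4 : ∀ᶠ v in 𝓝 (t, s), φ v = 0 → 0 < ψ v :=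
      eventually_nhdsWithin_iff.1 ((h.contOn (t, s) h1).eventually_const_lt h3)
    obtain ⟨ε, hε, h5⟩ := Metric.eventually_nhds_iff.1 h4
    obtain ⟨η, hη, h6⟩ := Metric.eventually_nhds_iff.1 (h.sign_of_pos t s h1 h3)
    set δ := min (min (ε / 2) (η / 2)) (min t (c - t)) with hδ
    have hδ0 : 0 < δ := by
      simp only [hδ, lt_min_iff]
      exact ⟨⟨by linarith, by linarith⟩, ht0, by linarith⟩
    have d1 : δ ≤ ε / 2 := (min_le_left _ _).trans (min_le_left _ _)
    have d2 : δ ≤ η / 2 := (min_le_left _ _).trans (min_le_right _ _)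
    have d3 : δ ≤ t := (min_le_right _ _).trans (min_le_left _ _)
    have d4 : δ ≤ c - t := (min_le_right _ _).trans (min_le_right _ _)
    have p1 : 0 < φ (t + δ, s) := by
      have := h6 (y := δ) (by rw [Real.dist_eq, sub_zero, abs_of_pos hδ0]; linarith)
      rwa [sign_pos hδ0, sign_eq_one_iff] at this
    have p2 : φ (t - δ, s) < 0 := by
      have := h6 (y := -δ) (by rw [Real.dist_eq, sub_zero, abs_neg, abs_of_pos hδ0]; linarith)
      rwa [Left.sign_neg, sign_pos hδ0, sign_eq_neg_one_iff, ← sub_eq_add_neg] at this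
    have c1 : Continuous fun r => φ (t + δ, r) := h.cont.comp (by fun_prop)
    have c2 : Continuous fun r => φ (t - δ, r) := h.cont.comp (by fun_prop)
    filter_upwards [c1.continuousAt.eventually_const_lt p1, c2.continuousAt.eventually_lt_const p2,
      Metric.ball_mem_nhds s hε] with r hr1 hr2 hr3
    have c3 : ContinuousOn (fun u => φ (u, r)) (Set.Icc (t - δ) (t + δ)) :=
      (h.cont.comp (by fun_prop : Continuous fun u : ℝ => (u, r))).continuousOn
    obtain ⟨u, hu, hu0⟩ := intermediate_value_Icc (by linarith) c3
      ⟨hr2.le, hr1.le⟩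
    simp only [hT, Set.mem_compl_iff, Set.mem_ofPred_eq]
    push Not
    refine ⟨u, ⟨by linarith [hu.1], by linarith [hu.2]⟩, hu0, (h5 ?_ hu0).le⟩
    rw [Prod.dist_eq, max_lt_iff]
    refine ⟨?_, hr3⟩
    rw [Real.dist_eq, abs_lt]
    constructor <;> linarith [hu.1, hu.2]
  have huniv : T = Set.univ := IsClopen.eq_univ ⟨isOpen_compl_iff.1 hclosed, hopen⟩ ⟨s₀, h0⟩
  have : s ∈ T := huniv ▸ Set.mem_univ s
  exact this

/-- The set of negativity is an interval ending at `c`. -/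
lemma neg_of_nonpos (h : IsTransversal c φ ψ) {s : ℝ}
    (hs : ∀ t ∈ Set.Icc 0 c, φ (t, s) = 0 → ψ (t, s) < 0) {t₁ t₂ : ℝ} (h0 : 0 ≤ t₁)
    (h12 : t₁ < t₂) (h2 : t₂ ≤ c) (h1 : φ (t₁, s) ≤ 0) : φ (t₂, s) < 0 := by
  have hc : Continuous fun u => φ (u, s) := h.cont.comp (by fun_prop)
  have sgn : ∀ t ∈ Set.Icc 0 c, φ (t, s) = 0 → ∃ η > 0, (∀ u, t < u → u < t + η → φ (u, s) < 0) ∧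
      ∀ u, t - η < u → u < t → 0 < φ (u, s) := by
    intro t ht ht0
    obtain ⟨η, hη, h6⟩ := Metric.eventually_nhds_iff.1 (h.sign_of_neg t s ht0 (hs t ht ht0))
    refine ⟨η, hη, fun u h3 h4 => ?_, fun u h3 h4 => ?_⟩
    · have := h6 (y := u - t) (by rw [Real.dist_eq, sub_zero, abs_of_pos] <;> linarith)
      rw [sign_pos (sub_pos.2 h3), add_sub_cancel, sign_eq_one_iff] at this
      linarith
    · have := h6 (y := u - t) (by rw [Real.dist_eq, sub_zero, abs_of_neg] <;> linarith)
      rw [sign_neg (sub_neg.2 h4), add_sub_cancel, sign_eq_neg_one_iff] at this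
      linarith
  have hle : Set.Icc t₁ t₂ ⊆ {u | φ (u, s) ≤ 0} := by
    refine IsClosed.Icc_subset_of_forall_exists_gt
      ((isClosed_le hc continuous_const).inter isClosed_Icc) h1 ?_
    rintro x ⟨hx, hx1, hx2⟩ y hy
    rcases lt_or_eq_of_le (show φ (x, s) ≤ 0 from hx) with hx | hx
    · have h7 := (hc.continuousAt.eventually_lt_const hx)
      have h8 : ∀ᶠ u in 𝓝[>] x, φ (u, s) < 0 := nhdsWithin_le_nhds h7
      obtain ⟨u, hu1, hu2⟩ := (h8.and (Ioc_mem_nhdsGT hy)).exists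
      exact ⟨u, hu1.le, hu2⟩
    · obtain ⟨η, hη, h8, -⟩ := sgn x ⟨by linarith, by linarith⟩ hx
      have hm : min (x + η / 2) y ∈ Set.Ioc x y := ⟨lt_min (by linarith) hy, min_le_right _ _⟩
      exact ⟨_, (h8 _ hm.1 ((min_le_left _ _).trans_lt (by linarith))).le, hm⟩
  refine lt_of_le_of_ne (hle ⟨h12.le, le_rfl⟩) fun h9 => ?_
  obtain ⟨η, hη, -, h8⟩ := sgn t₂ ⟨by linarith, h2⟩ h9
  have hm : max t₁ (t₂ - η / 2) ∈ Set.Icc t₁ t₂ := ⟨le_max_left _ _, max_le h12.le (by linarith)⟩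
  have h10 := h8 _ ((by linarith : t₂ - η < t₂ - η / 2).trans_le (le_max_right t₁ _))
    (max_lt h12 (by linarith))
  exact absurd (hle hm) (not_le.2 h10)

/-- The unique zero depends continuously on the parameter. -/
lemma exists_zero (h : IsTransversal c φ ψ)
    (hs : ∀ s, ∀ t ∈ Set.Icc 0 c, φ (t, s) = 0 → ψ (t, s) < 0) :
    ∃ ℓ : ℝ → ℝ, Continuous ℓ ∧ (∀ s, ℓ s ∈ Set.Ioo 0 c) ∧ ∀ s, φ (ℓ s, s) = 0 := by
  have hex : ∀ s, ∃ t ∈ Set.Ioo 0 c, φ (t, s) = 0 := by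
    intro s
    have hc : Continuous fun u => φ (u, s) := h.cont.comp (by fun_prop)
    exact intermediate_value_Ioo' h.pos.le hc.continuousOn ⟨h.right_neg s, h.left_pos s⟩
  choose ℓ hℓ1 hℓ2 using hex
  refine ⟨ℓ, continuous_iff_continuousAt.2 fun s => ?_, hℓ1, hℓ2⟩
  have pos_of_lt : ∀ {s t}, 0 ≤ t → t < ℓ s → 0 < φ (t, s) := by
    intro s t ht0 ht
    by_contra hn
    exact (h.neg_of_nonpos (hs s) ht0 ht (hℓ1 s).2.le (not_lt.1 hn)).ne (hℓ2 s)
  have neg_of_gt : ∀ {s t}, ℓ s < t → t ≤ c → φ (t, s) < 0 := fun ht htc =>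
    h.neg_of_nonpos (hs _) (hℓ1 _).1.le ht htc (hℓ2 _).le
  rw [ContinuousAt, tendsto_order]
  constructor
  · intro r hr
    have hm : max r 0 < ℓ s := max_lt hr (hℓ1 s).1
    have c1 : Continuous fun r' => φ (max r 0, r') := h.cont.comp (by fun_prop)
    filter_upwards [c1.continuousAt.eventually_const_lt (pos_of_lt (le_max_right r 0) hm)] with s' h'
    by_contra hn
    rcases lt_or_eq_of_le ((not_lt.1 hn).trans (le_max_left r 0)) with h3 | h3
    · exact (neg_of_gt h3 (hm.le.trans (hℓ1 s).2.le)).not_gt h'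
    · rw [← h3, hℓ2] at h'
      exact lt_irrefl _ h'
  · intro r hr
    have hm : ℓ s < min r c := lt_min hr (hℓ1 s).2
    have c1 : Continuous fun r' => φ (min r c, r') := h.cont.comp (by fun_prop)
    filter_upwards [c1.continuousAt.eventually_lt_const (neg_of_gt hm (min_le_right r c))] with s' h'
    by_contra hn
    rcases lt_or_eq_of_le ((min_le_left r c).trans (not_lt.1 hn)) with h3 | h3
    · exact (pos_of_lt ((hℓ1 s).1.le.trans hm.le) h3).not_gt h'
    · rw [h3, hℓ2] at h'
      exact lt_irrefl _ h'

end IsTransversal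

/-! ### The coordinates of the kernel curve -/

section Coordinate

variable {W₁ W₂ : ℝ} {h₁ : 0 < W₁} {h₂ : 0 < W₂}

local notation "L" => rectPair h₁ h₂

variable (h₁ h₂) in
open Classical in
lemma wp_rect (ω : ℂ) : wp (Complex.I * W₁) W₂ ω =
    if ω ∈ (L).lattice then OnePoint.infty else ((℘[L] ω : ℂ) : OnePoint ℂ) := by
  rw [wp, dif_pos (linearIndependent_rect h₁ h₂)]
  rfl

namespace IsCoordinate

variable {p : ℝ[X]} {x₁ x₂ x₃ μ ν A B Γ D : ℝ}

lemma isMobius (h : IsCoordinate h₁ h₂ p x₁ x₂ x₃ μ ν A B Γ D) :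
    IsMobius h₁ h₂ p A B Γ D where
  natDegree_le := h.branched.natDegree_le
  det_ne := h.unif.det_neg.ne
  homEval_eq u := by
    rw [h.unif.homEval_eq, ← h.e₁, ← h.e₂, ← h.e₃]
    congr 1
    -- an identity between polynomials that holds at all real points
    have h1 := (h.unif.isRootTriple h.branched).2
    have h2 := h1 0
    have h3 := h1 1
    have h4 := (h.unif.isRootTriple h.branched).1.sum
    simp only [cubic] at h2 h3
    have h2' := congrArg (fun r : ℝ => (r : ℂ)) h2
    have h3' := congrArg (fun r : ℝ => (r : ℂ)) h3
    have h4' := congrArg (fun r : ℝ => (r : ℂ)) h4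
    push_cast at h2' h3' h4'
    linear_combination u * h3' + (1 - u) * h2' + 4 * (u ^ 2 - u) * h4'

lemma gInv_wp (h : IsCoordinate h₁ h₂ p x₁ x₂ x₃ μ ν A B Γ D) (ω : ℂ) :
    gInv p (branch4 p) (wp (Complex.I * W₁) W₂ ω) =
      if linP h₁ h₂ Γ D ω = 0 then OnePoint.infty
      else ((mobP h₁ h₂ A B Γ D ω : ℂ) : OnePoint ℂ) := by
  rw [wp_rect h₁ h₂, mobP]
  by_cases hω : ω ∈ (L).lattice
  · rw [if_pos hω, h.unif.gInv_infty, linP_of_mem h₁ h₂ hω, linP_of_mem h₁ h₂ hω]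
    simp only [Complex.ofReal_eq_zero]
  · rw [if_neg hω, h.unif.gInv_coe, linP_of_notMem h₁ h₂ hω, linP_of_notMem h₁ h₂ hω]

lemma mobP_eq_of_mobInv (hdet : A * D - B * Γ ≠ 0) {ω : ℂ} (hω : ω ∉ (L).lattice) {t : ℝ}
    (ht : A - Γ * t ≠ 0) (h : ℘[L] ω = mobInv A B Γ D t) :
    linP h₁ h₂ Γ D ω ≠ 0 ∧ mobP h₁ h₂ A B Γ D ω = t := by
  have ht' : (A : ℂ) - Γ * t ≠ 0 := by exact_mod_cast ht
  have hdet' : (A : ℂ) * D - B * Γ ≠ 0 := by exact_mod_cast hdet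
  have e : linP h₁ h₂ Γ D ω = (A * D - B * Γ) / (A - Γ * t) := by
    rw [linP_of_notMem h₁ h₂ hω, h, mobInv]
    push_cast
    field_simp
    ring
  refine ⟨by rw [e]; exact div_ne_zero hdet' ht', ?_⟩
  have e' : linP h₁ h₂ A B ω = (A * D - B * Γ) * t / (A - Γ * t) := by
    rw [linP_of_notMem h₁ h₂ hω, h, mobInv]
    push_cast
    rw [eq_div_iff ht', add_mul, mul_assoc, div_mul_cancel₀ _ ht']
    ring
  rw [mobP, e, e']
  field_simp

lemma exists_mobInv_eq (h : IsCoordinate h₁ h₂ p x₁ x₂ x₃ μ ν A B Γ D) {s t u : ℝ} (hs : -1 ≤ s)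
    (hst : s ≤ t) (ht : t ≤ x₃) (hu1 : mobInv A B Γ D t ≤ u) (hu2 : u ≤ mobInv A B Γ D s) :
    ∃ r ∈ Set.Icc s t, mobInv A B Γ D r = u := by
  have hc : ContinuousOn (mobInv A B Γ D) (Set.Icc s t) := fun r hr =>
    (hasDerivAt_mobInv (h.unif.lin_ne_zero h.branched (hs.trans hr.1)
      (hr.2.trans ht))).continuousAt.continuousWithinAt
  exact intermediate_value_Icc' hst hc ⟨hu1, hu2⟩

/-- In the middle of the strip, the coordinate lies between `x₁` and `x₂`. -/
lemma height_mid (h : IsCoordinate h₁ h₂ p x₁ x₂ x₃ μ ν A B Γ D) (s : ℝ) :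
    height h₁ h₂ A B Γ D ⟨W₂ / 2, s⟩ < 0 := by
  have := h.branched.neg_one_lt; have := h.branched.lt₁₂
  have := h.branched.lt_one; have := h.branched.one_lt
  have hω : (⟨W₂ / 2, s⟩ : ℂ) ∉ (L).lattice :=
    notMem_rect_of_re h₁ h₂ (by simp [h₂]) (by simp [h₂])
  obtain ⟨u, hu1, hu2, hu⟩ := weierstrassP_right_line (h₁ := h₁) (h₂ := h₂) s
  obtain ⟨r, hr, rfl⟩ := h.exists_mobInv_eq (s := x₁) (t := x₂) (u := u) (by linarith) (by linarith)
    (by linarith) (by rwa [h.e₂]) (by rwa [h.e₁])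
  obtain ⟨hd, he⟩ := mobP_eq_of_mobInv h.isMobius.det_ne hω
    (h.unif.lin_ne_zero h.branched (by linarith [hr.1]) (by linarith [hr.2])) hu
  rw [height_neg_iff h.isMobius.det_ne]
  refine ⟨hd, ?_⟩
  rw [he, Complex.norm_real, Real.norm_eq_abs, abs_lt]
  constructor <;> linarith [hr.1, hr.2]

/-- On the sides of the strip, the coordinate lies in the arc from `x₃` to `x₄`, outside of the
unit disc. -/
lemma height_side (h : IsCoordinate h₁ h₂ p x₁ x₂ x₃ μ ν A B Γ D) (s : ℝ) :
    0 < height h₁ h₂ A B Γ D ⟨0, s⟩ := by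
  have hb := h.branched
  have h3 := hb.one_lt
  have hdet := h.isMobius.det_ne
  rw [height]
  refine div_pos ?_ (height_denom_pos hdet _)
  rw [sub_pos, pow_lt_pow_iff_left₀ (norm_nonneg _) (norm_nonneg _) two_ne_zero]
  by_cases hω : (⟨0, s⟩ : ℂ) ∈ (L).lattice
  · rw [linP_of_mem h₁ h₂ hω, linP_of_mem h₁ h₂ hω, Complex.norm_real, Complex.norm_real]
    obtain ⟨k, hk, rfl, rfl⟩ := h.unif.prop
    rw [norm_mul, norm_mul]
    refine mul_lt_mul_of_pos_left ?_ (norm_pos_iff.2 hk)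
    have := hb.nu_pos; have := hb.neg_lt; have := hb.mul_lt
    rw [Real.norm_eq_abs, Real.norm_eq_abs, abs_of_pos hb.nu_pos, abs_lt]
    constructor <;> nlinarith
  · obtain ⟨u, hu, hPu⟩ := weierstrassP_left_line hω
    rw [linP_of_notMem h₁ h₂ hω, linP_of_notMem h₁ h₂ hω, hPu]
    norm_cast
    rw [Real.norm_eq_abs, Real.norm_eq_abs]
    by_contra! hle
    have hg : Γ * u + D ≠ 0 := by
      intro hg
      rw [hg, abs_zero] at hle
      have ha := abs_nonpos_iff.1 hle
      exact hdet (by linear_combination A * hg - Γ * ha)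
    obtain ⟨t, ht⟩ : ∃ t, t = (A * u + B) / (Γ * u + D) := ⟨_, rfl⟩
    have ht1 : |t| ≤ 1 := by
      rw [ht, abs_div]
      exact (div_le_one (abs_pos.2 hg)).2 hle
    obtain ⟨ht2, ht3⟩ := abs_le.1 ht1
    have e : mobInv A B Γ D t = u := by
      have e1 : A - Γ * t = (A * D - B * Γ) / (Γ * u + D) := by
        rw [ht]; field_simp; ring
      have e2 := div_mul_cancel₀ (A * u + B) hg
      rw [← ht] at e2
      rw [mobInv, e1, div_eq_iff (div_ne_zero hdet hg), mul_div_assoc', eq_div_iff hg]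
      linear_combination D * e2
    have := h.unif.strictAntiOn hb ⟨ht2, by linarith⟩ ⟨by linarith, le_rfl⟩
      (by linarith : t < x₃)
    rw [e, h.e₃] at this
    linarith

/-- At half the imaginary period, the coordinate is real, between `x₂` and `x₃`. -/
lemma exists_mobP_top (h : IsCoordinate h₁ h₂ p x₁ x₂ x₃ μ ν A B Γ D) {t : ℝ}
    (ht : t ∈ Set.Ioo 0 W₂) : ∃ r ∈ Set.Icc x₂ x₃, linP h₁ h₂ Γ D ⟨t, W₁ / 2⟩ ≠ 0 ∧
      mobP h₁ h₂ A B Γ D ⟨t, W₁ / 2⟩ = r := by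
  have := h.branched.neg_one_lt; have := h.branched.lt₁₂
  have := h.branched.lt_one; have := h.branched.one_lt
  have key : ∀ t ∈ Set.Ioc 0 (W₂ / 2), rootE₃ h₁ h₂ ≤ (℘[L] ⟨t, W₁ / 2⟩).re ∧
      (℘[L] ⟨t, W₁ / 2⟩).re ≤ rootE₂ h₁ h₂ := by
    intro t ht
    rcases lt_or_eq_of_le ht.2 with h3 | h3
    · have h4 := (top_side h₁ h₂).2
      have h5 : (℘[L] (half₃ h₁ h₂ + 1 * (t : ℝ))).re ∈ Set.Ioo (rootE₃ h₁ h₂) (rootE₂ h₁ h₂) := by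
        rw [← h4]
        exact ⟨t, ⟨ht.1, h3⟩, rfl⟩
      have e : half₃ h₁ h₂ + 1 * ((t : ℝ) : ℂ) = ⟨t, W₁ / 2⟩ := by
        apply Complex.ext <;> simp [half₃]
      rw [e] at h5
      exact ⟨h5.1.le, h5.2.le⟩
    · have e : (⟨t, W₁ / 2⟩ : ℂ) = half₂ h₁ h₂ := by rw [h3, half₂]
      rw [e, weierstrassP_half₂]
      exact ⟨(isRootTriple_rootE h₁ h₂).lt₂₃.le, le_rfl⟩
  have key2 : rootE₃ h₁ h₂ ≤ (℘[L] ⟨t, W₁ / 2⟩).re ∧ (℘[L] ⟨t, W₁ / 2⟩).re ≤ rootE₂ h₁ h₂ := by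
    rcases le_total t (W₂ / 2) with h3 | h3
    · exact key t ⟨ht.1, h3⟩
    · have e : ℘[L] ⟨t, W₁ / 2⟩ = ℘[L] ⟨W₂ - t, W₁ / 2⟩ := by
        rw [← (L).weierstrassP_neg]
        apply weierstrassP_eq_of_sub_mem
        exact (mem_rect h₁ h₂).2 ⟨-1, -1, by simp; ring, by simp; ring⟩
      rw [e]
      exact key _ ⟨by linarith [ht.2], by linarith⟩
  have hω : (⟨t, W₁ / 2⟩ : ℂ) ∉ (L).lattice := notMem_rect_of_re h₁ h₂ ht.1 ht.2
  obtain ⟨r, hr, hru⟩ := h.exists_mobInv_eq (s := x₂) (t := x₃) (u := (℘[L] ⟨t, W₁ / 2⟩).re) (by linarith) (by linarith) le_rfl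
    (by rw [h.e₃]; exact key2.1) (by rw [h.e₂]; exact key2.2)
  have hreal : ((℘[L] ⟨t, W₁ / 2⟩).re : ℂ) = ℘[L] ⟨t, W₁ / 2⟩ :=
    weierstrassP_real_of_im h₁ h₂ 1 (by simp)
  exact ⟨r, hr, mobP_eq_of_mobInv h.isMobius.det_ne hω
    (h.unif.lin_ne_zero h.branched (by linarith [hr.1]) hr.2) (by rw [hru, hreal])⟩

/-- At half the imaginary period, the coordinate decreases from `x₃` to `x₂`. -/
lemma deriv_mobP_top (h : IsCoordinate h₁ h₂ p x₁ x₂ x₃ μ ν A B Γ D) {t : ℝ}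
    (ht : t ∈ Set.Ioo 0 (W₂ / 2)) :
    ∃ r < 0, deriv (mobP h₁ h₂ A B Γ D) ⟨t, W₁ / 2⟩ = (r : ℝ) := by
  have hω : (⟨t, W₁ / 2⟩ : ℂ) ∉ (L).lattice :=
    notMem_rect_of_re h₁ h₂ ht.1 (by simp; linarith [ht.2])
  obtain ⟨-, -, hd, -⟩ := h.exists_mobP_top (t := t) ⟨ht.1, by linarith [ht.2]⟩
  rw [(hasDerivAt_mobP h₁ h₂ A B hω hd).deriv]
  rw [linP_of_notMem h₁ h₂ hω] at hd ⊢
  have h1 : ((℘[L] ⟨t, W₁ / 2⟩).re : ℂ) = ℘[L] ⟨t, W₁ / 2⟩ :=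
    weierstrassP_real_of_im h₁ h₂ 1 (by simp)
  have h2 : ((℘'[L] ⟨t, W₁ / 2⟩).re : ℂ) = ℘'[L] ⟨t, W₁ / 2⟩ :=
    derivWeierstrassP_real_of_im h₁ h₂ 1 (by simp)
  have h3 := (top_side h₁ h₂).1 t ht
  have e : half₃ h₁ h₂ + (t : ℝ) = (⟨t, W₁ / 2⟩ : ℂ) := by
    apply Complex.ext <;> simp [half₃]
  rw [e] at h3
  rw [← h1] at hd ⊢
  rw [← h2]
  refine ⟨(A * D - B * Γ) * (℘'[L] ⟨t, W₁ / 2⟩).re / (Γ * (℘[L] ⟨t, W₁ / 2⟩).re + D) ^ 2, ?_, ?_⟩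
  · have hd' : Γ * (℘[L] ⟨t, W₁ / 2⟩).re + D ≠ 0 := by exact_mod_cast hd
    exact div_neg_of_neg_of_pos (mul_neg_of_neg_of_pos h.unif.det_neg h3) (by positivity)
  · push_cast
    rfl

end IsCoordinate

/-! ### The domain where a coordinate is small -/

variable {w : ℤ → ℤ → ℝ} {x₁ x₂ x₃ μ ν A B Γ D : ℝ}

lemma height_add_period (t s : ℝ) :
    height h₁ h₂ A B Γ D ⟨t + W₂, s⟩ = height h₁ h₂ A B Γ D ⟨t, s⟩ := by
  apply height_eq_of_sub_mem
  exact (mem_rect h₁ h₂).2 ⟨0, 1, by simp, by simp⟩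

lemma height_reflect (t s : ℝ) :
    height h₁ h₂ A B Γ D ⟨W₂ - t, s⟩ = height h₁ h₂ A B Γ D ⟨t, s⟩ := by
  rw [← height_neg_arg, ← height_conj]
  apply height_eq_of_sub_mem
  exact (mem_rect h₁ h₂).2 ⟨0, -1, by simp, by simp⟩

lemma continuous_complex_mk : Continuous fun v : ℝ × ℝ => (⟨v.1, v.2⟩ : ℂ) :=
  Complex.equivRealProdCLM.symm.continuous

namespace IsCoordinate

lemma isTransversal (hw : IsWeight w) (h : IsCoordinate h₁ h₂ (wdisc w) x₁ x₂ x₃ μ ν A B Γ D) :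
    IsTransversal (W₂ / 2) (fun v => height h₁ h₂ A B Γ D ⟨v.1, v.2⟩)
      (fun v => radial (mobP h₁ h₂ A B Γ D) ⟨v.1, v.2⟩) where
  pos := by linarith
  cont := (continuous_height h.isMobius.det_ne).comp continuous_complex_mk
  contOn := by
    intro v hv
    obtain ⟨hd, -⟩ := (height_eq_zero_iff h.isMobius.det_ne _).1 hv
    have ha := analyticAt_mobP h₁ h₂ A B hd
    have h1 : ContinuousAt (radial (mobP h₁ h₂ A B Γ D)) ⟨v.1, v.2⟩ :=
      Complex.continuous_re.continuousAt.comp (ha.deriv.continuousAt.mul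
        (Complex.continuous_conj.continuousAt.comp ha.continuousAt))
    exact (ContinuousAt.comp (f := fun v : ℝ × ℝ => (⟨v.1, v.2⟩ : ℂ)) h1
      continuous_complex_mk.continuousAt).continuousWithinAt
  ne_zero v hv := radial_ne_zero hw h.isMobius hv
  sign_of_pos t s h0 h1 := by
    filter_upwards [sign_height (ε := 1) h.isMobius.det_ne h0 (by simpa using h1)] with δ hδ
    rw [one_mul] at hδ
    rw [← hδ]
    congr 2
    apply Complex.ext <;> simp
  sign_of_neg t s h0 h1 := by
    filter_upwards [sign_height (ε := -1) h.isMobius.det_ne h0 (by simpa using h1)] with δ hδ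
    rw [neg_one_mul] at hδ
    rw [← hδ]
    congr 3
    apply Complex.ext <;> simp
  left_pos := h.height_side
  right_neg := h.height_mid

lemma crossing (hw : IsWeight w) (h : IsCoordinate h₁ h₂ (wdisc w) x₁ x₂ x₃ μ ν A B Γ D) (s : ℝ) :
    ∀ t ∈ Set.Icc 0 (W₂ / 2), height h₁ h₂ A B Γ D ⟨t, s⟩ = 0 →
      radial (mobP h₁ h₂ A B Γ D) ⟨t, s⟩ < 0 := by
  refine (h.isTransversal hw).crossing_neg (s₀ := W₁ / 2) (fun t ht h0 => ?_) s
  have h0' : height h₁ h₂ A B Γ D ⟨t, W₁ / 2⟩ = 0 := h0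
  have ht0 : 0 < t := lt_of_le_of_ne ht.1 (by rintro rfl; exact (h.height_side _).ne' h0')
  have htc : t < W₂ / 2 := lt_of_le_of_ne ht.2 (by rintro rfl; exact (h.height_mid _).ne h0')
  obtain ⟨r, hr, -, he⟩ := h.exists_mobP_top (t := t) ⟨ht0, by linarith⟩
  obtain ⟨q, hq, hq'⟩ := h.deriv_mobP_top ⟨ht0, htc⟩
  obtain ⟨-, hn⟩ := (height_eq_zero_iff h.isMobius.det_ne _).1 h0'
  have hrpos : 0 < r := h.branched.pos.trans_le hr.1
  rw [radial, hq', he, Complex.conj_ofReal, ← Complex.ofReal_mul, Complex.ofReal_re]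
  exact mul_neg_of_neg_of_pos hq hrpos

/-- On each horizontal line of the strip, the coordinate is small on an interval around the middle
of the strip. -/
lemma height_neg_of_lt (hw : IsWeight w) (h : IsCoordinate h₁ h₂ (wdisc w) x₁ x₂ x₃ μ ν A B Γ D)
    {s u v : ℝ} (hv : 0 ≤ v) (hvu : v < u) (hu : u ≤ W₂ / 2)
    (h0 : height h₁ h₂ A B Γ D ⟨W₂ / 2 + u, s⟩ ≤ 0) :
    height h₁ h₂ A B Γ D ⟨W₂ / 2 + v, s⟩ < 0 := by
  have e : ∀ r, height h₁ h₂ A B Γ D ⟨W₂ / 2 + r, s⟩ = height h₁ h₂ A B Γ D ⟨W₂ / 2 - r, s⟩ := by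
    intro r
    rw [← height_reflect]
    congr 2
    ring
  rw [e] at h0 ⊢
  exact (h.isTransversal hw).neg_of_nonpos (h.crossing hw s) (t₁ := W₂ / 2 - u) (by linarith)
    (by linarith) (by linarith) h0

/-- The half-width of the domain where the coordinate is small. -/
lemma exists_halfWidth (hw : IsWeight w)
    (h : IsCoordinate h₁ h₂ (wdisc w) x₁ x₂ x₃ μ ν A B Γ D) :
    ∃ ℓ : ℝ → ℝ, Continuous ℓ ∧ (∀ s, ℓ s ∈ Set.Ioo 0 (W₂ / 2)) ∧
      ∀ s, height h₁ h₂ A B Γ D ⟨W₂ / 2 + ℓ s, s⟩ = 0 ∧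
        height h₁ h₂ A B Γ D ⟨W₂ / 2 - ℓ s, s⟩ = 0 := by
  obtain ⟨ℓ, h3, h4, h5⟩ := (h.isTransversal hw).exists_zero (h.crossing hw)
  refine ⟨fun s => W₂ / 2 - ℓ s, by fun_prop, fun s => ⟨by linarith [(h4 s).2],
    by linarith [(h4 s).1]⟩, fun s => ⟨?_, ?_⟩⟩
  · rw [← height_reflect, ← h5 s]
    congr 2
    ring
  · rw [← h5 s]
    congr 2
    ring

end IsCoordinate

end Coordinate

/-! ### The third period -/

section Arc

variable {A B Γ D : ℝ}

lemma mobInv_lt_mobInv_iff (hdet : A * D - B * Γ < 0) {s t : ℝ} (hs : A - Γ * s ≠ 0)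
    (ht : A - Γ * t ≠ 0) :
    mobInv A B Γ D s < mobInv A B Γ D t ↔ 0 < (s - t) * ((A - Γ * s) * (A - Γ * t)) := by
  have h : 0 < ((A - Γ * s) * (A - Γ * t)) ^ 2 := by positivity
  have e : mobInv A B Γ D s - mobInv A B Γ D t = (A * D - B * Γ) *
      (((s - t) * ((A - Γ * s) * (A - Γ * t))) / ((A - Γ * s) * (A - Γ * t)) ^ 2) := by
    rw [mobInv_sub hs ht]
    field_simp
  rw [← sub_neg, e, ← smul_eq_mul, smul_neg_iff_of_neg_left hdet, lt_div_iff₀ h, zero_mul]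

lemma mobInv_sub_infty {t : ℝ} (hΓ : Γ ≠ 0) (ht : A - Γ * t ≠ 0) :
    mobInv A B Γ D t - -D / Γ = (A * D - B * Γ) / (Γ * (A - Γ * t)) := by
  rw [mobInv, div_sub_div _ _ ht hΓ, mul_comm Γ (A - Γ * t)]
  congr 1
  ring

/-- The parameter `u` of the point `X` of the projective line under the Möbius transformation
`u ↦ (A u + B) / (Γ u + D)`. -/
def IsParameter (A B Γ D : ℝ) : OnePoint ℝ → ℝ → Prop
  | OnePoint.infty, u => Γ * u + D = 0
  | OnePoint.some v, u => A - Γ * v ≠ 0 ∧ mobInv A B Γ D v = u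

/-- The Möbius transformation `mobInv` reverses the orientation of the projective line, so that it
maps the arc from `X` to `x₁` to a bounded interval. -/
lemma arc_eq (hdet : A * D - B * Γ < 0) {X : OnePoint ℝ} {u x₁ : ℝ} (hX : IsParameter A B Γ D X u)
    (h1 : A - Γ * x₁ ≠ 0) (hu : mobInv A B Γ D x₁ < u) :
    arc X x₁ = {t | A - Γ * t ≠ 0 ∧ mobInv A B Γ D x₁ < mobInv A B Γ D t ∧
      mobInv A B Γ D t < u} := by
  induction X using OnePoint.rec with
  | infty =>
    have hX' : Γ * u + D = 0 := hX
    have hΓ : Γ ≠ 0 := by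
      rintro rfl
      have : D = 0 := by linarith
      rw [this] at hdet
      simp at hdet
    have hu' : u = -D / Γ := by field_simp; linarith
    have key : ∀ {t : ℝ}, A - Γ * t ≠ 0 → (mobInv A B Γ D t < u ↔ 0 < Γ * (A - Γ * t)) := by
      intro t ht
      rw [← sub_neg, hu', mobInv_sub_infty hΓ ht, div_neg_iff]
      constructor
      · rintro (⟨h2, -⟩ | ⟨-, h2⟩)
        · exact absurd h2 hdet.not_gt
        · exact h2
      · exact fun h2 => Or.inr ⟨hdet, h2⟩
    have hpos := (key h1).1 hu
    ext t
    change t < x₁ ↔ _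
    constructor
    · intro ht
      have h2 : 0 < Γ * (A - Γ * t) := by nlinarith [mul_pos (sub_pos.2 ht) (sq_pos_of_ne_zero hΓ)]
      have h3 : A - Γ * t ≠ 0 := right_ne_zero_of_mul h2.ne'
      have h4 : 0 < (A - Γ * x₁) * (A - Γ * t) :=
        pos_of_mul_pos_right (a := Γ ^ 2) (by nlinarith [mul_pos hpos h2]) (sq_nonneg _)
      exact ⟨h3, (mobInv_lt_mobInv_iff hdet h1 h3).2 (mul_pos (sub_pos.2 ht) h4), (key h3).2 h2⟩
    · rintro ⟨h3, h4, h5⟩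
      have h2 := (key h3).1 h5
      have h6 : 0 < (A - Γ * x₁) * (A - Γ * t) :=
        pos_of_mul_pos_right (a := Γ ^ 2) (by nlinarith [mul_pos hpos h2]) (sq_nonneg _)
      have h7 := (mobInv_lt_mobInv_iff hdet h1 h3).1 h4
      exact sub_pos.1 (pos_of_mul_pos_left h7 h6.le)
  | coe v =>
    obtain ⟨hv, rfl⟩ : A - Γ * v ≠ 0 ∧ mobInv A B Γ D v = u := hX
    have h2 := (mobInv_lt_mobInv_iff hdet h1 hv).1 hu
    have h1v : x₁ ≠ v := by rintro rfl; simp at h2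
    ext t
    change t ∈ (if v ≤ x₁ then Set.Ioo v x₁ else Set.Ioi v ∪ Set.Iio x₁) ↔ _
    rcases lt_or_gt_of_ne h1v with h3 | h3
    · rw [if_neg (not_le.2 h3)]
      have h4 : (A - Γ * x₁) * (A - Γ * v) < 0 := by
        by_contra hn
        nlinarith
      constructor
      · rintro (ht | ht)
        · have ht : v < t := ht
          -- `A - Γ t` has the sign of `A - Γ v`
          have h5 : 0 < (A - Γ * t) * (A - Γ * v) := by
            have e : (v - x₁) * (A - Γ * t) = (t - x₁) * (A - Γ * v) - (t - v) * (A - Γ * x₁) := by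
              ring
            have : 0 < (v - x₁) * ((A - Γ * t) * (A - Γ * v)) := by
              have e2 : (v - x₁) * ((A - Γ * t) * (A - Γ * v)) =
                (t - x₁) * (A - Γ * v) ^ 2 - (t - v) * ((A - Γ * x₁) * (A - Γ * v)) := by
                linear_combination (A - Γ * v) * e
              rw [e2]
              have : 0 < (t - x₁) * (A - Γ * v) ^ 2 := mul_pos (by linarith) (by positivity)
              nlinarith
            exact pos_of_mul_pos_right this (by linarith)
          have h6 : A - Γ * t ≠ 0 := left_ne_zero_of_mul h5.ne'
          have h7 : (A - Γ * x₁) * (A - Γ * t) < 0 := by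
            by_contra hn
            have : 0 ≤ ((A - Γ * x₁) * (A - Γ * t)) * ((A - Γ * t) * (A - Γ * v)) :=
              mul_nonneg (not_lt.1 hn) h5.le
            have e : ((A - Γ * x₁) * (A - Γ * t)) * ((A - Γ * t) * (A - Γ * v)) =
              (A - Γ * t) ^ 2 * ((A - Γ * x₁) * (A - Γ * v)) := by ring
            have := mul_neg_of_pos_of_neg (sq_pos_of_ne_zero h6) h4
            linarith
          exact ⟨h6, (mobInv_lt_mobInv_iff hdet h1 h6).2
            (mul_pos_of_neg_of_neg (by linarith) h7), (mobInv_lt_mobInv_iff hdet h6 hv).2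
            (mul_pos (by linarith) h5)⟩
        · have ht : t < x₁ := ht
          have h5 : 0 < (A - Γ * x₁) * (A - Γ * t) := by
            have e : (v - x₁) * (A - Γ * t) = (v - t) * (A - Γ * x₁) - (x₁ - t) * (A - Γ * v) := by
              ring
            have : 0 < (v - x₁) * ((A - Γ * x₁) * (A - Γ * t)) := by
              have e2 : (v - x₁) * ((A - Γ * x₁) * (A - Γ * t)) =
                (v - t) * (A - Γ * x₁) ^ 2 - (x₁ - t) * ((A - Γ * x₁) * (A - Γ * v)) := by
                linear_combination (A - Γ * x₁) * e
              rw [e2]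
              have : 0 < (v - t) * (A - Γ * x₁) ^ 2 := mul_pos (by linarith) (by positivity)
              nlinarith
            exact pos_of_mul_pos_right this (by linarith)
          have h6 : A - Γ * t ≠ 0 := right_ne_zero_of_mul h5.ne'
          have h7 : (A - Γ * t) * (A - Γ * v) < 0 := by
            by_contra hn
            have : 0 ≤ ((A - Γ * x₁) * (A - Γ * t)) * ((A - Γ * t) * (A - Γ * v)) :=
              mul_nonneg h5.le (not_lt.1 hn)
            have e : ((A - Γ * x₁) * (A - Γ * t)) * ((A - Γ * t) * (A - Γ * v)) =
              (A - Γ * t) ^ 2 * ((A - Γ * x₁) * (A - Γ * v)) := by ring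
            have := mul_neg_of_pos_of_neg (sq_pos_of_ne_zero h6) h4
            linarith
          exact ⟨h6, (mobInv_lt_mobInv_iff hdet h1 h6).2 (mul_pos (by linarith) h5),
            (mobInv_lt_mobInv_iff hdet h6 hv).2 (mul_pos_of_neg_of_neg (by linarith) h7)⟩
      · rintro ⟨h6, h7, h8⟩
        rw [mobInv_lt_mobInv_iff hdet h1 h6] at h7
        rw [mobInv_lt_mobInv_iff hdet h6 hv] at h8
        by_contra hn
        simp only [Set.mem_union, Set.mem_Ioi, Set.mem_Iio, not_or, not_lt] at hn
        have h9 : (A - Γ * x₁) * (A - Γ * t) < 0 := by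
          by_contra hn2
          nlinarith [hn.1, hn.2]
        have h10 : (A - Γ * t) * (A - Γ * v) < 0 := by
          by_contra hn2
          nlinarith [hn.1, hn.2]
        have := mul_pos_of_neg_of_neg h9 h10
        have := mul_neg_of_pos_of_neg (sq_pos_of_ne_zero h6) h4
        nlinarith
    · rw [if_pos h3.le]
      have h4 : 0 < (A - Γ * x₁) * (A - Γ * v) := pos_of_mul_pos_right h2 (by linarith)
      constructor
      · rintro ⟨ht1, ht2⟩
        have e : (x₁ - v) * (A - Γ * t) = (t - v) * (A - Γ * x₁) + (x₁ - t) * (A - Γ * v) := by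
          ring
        have h5 : 0 < (A - Γ * x₁) * (A - Γ * t) := by
          have e2 : (x₁ - v) * ((A - Γ * x₁) * (A - Γ * t)) =
            (t - v) * (A - Γ * x₁) ^ 2 + (x₁ - t) * ((A - Γ * x₁) * (A - Γ * v)) := by
            linear_combination (A - Γ * x₁) * e
          have h6 : 0 < (t - v) * (A - Γ * x₁) ^ 2 := mul_pos (by linarith) (by positivity)
          have h7 : 0 < (x₁ - t) * ((A - Γ * x₁) * (A - Γ * v)) := mul_pos (by linarith) h4
          exact pos_of_mul_pos_right (e2 ▸ add_pos h6 h7) (by linarith)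
        have h6 : 0 < (A - Γ * t) * (A - Γ * v) := by
          have e2 : (x₁ - v) * ((A - Γ * t) * (A - Γ * v)) =
            (t - v) * ((A - Γ * x₁) * (A - Γ * v)) + (x₁ - t) * (A - Γ * v) ^ 2 := by
            linear_combination (A - Γ * v) * e
          have h6 : 0 < (x₁ - t) * (A - Γ * v) ^ 2 := mul_pos (by linarith) (by positivity)
          have h7 : 0 < (t - v) * ((A - Γ * x₁) * (A - Γ * v)) := mul_pos (by linarith) h4
          exact pos_of_mul_pos_right (e2 ▸ add_pos h7 h6) (by linarith)
        have h7 : A - Γ * t ≠ 0 := right_ne_zero_of_mul h5.ne'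
        exact ⟨h7, (mobInv_lt_mobInv_iff hdet h1 h7).2 (mul_pos (by linarith) h5),
            (mobInv_lt_mobInv_iff hdet h7 hv).2 (mul_pos (by linarith) h6)⟩
      · rintro ⟨h6, h7, h8⟩
        rw [mobInv_lt_mobInv_iff hdet h1 h6] at h7
        rw [mobInv_lt_mobInv_iff hdet h6 hv] at h8
        have h9 : 0 < (x₁ - t) * (t - v) := by
          have h10 := mul_pos h7 h8
          have e : (x₁ - t) * ((A - Γ * x₁) * (A - Γ * t)) * ((t - v) * ((A - Γ * t) * (A - Γ * v))) =
            ((A - Γ * t) ^ 2 * ((A - Γ * x₁) * (A - Γ * v))) * ((x₁ - t) * (t - v)) := by ring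
          rw [e] at h10
          exact pos_of_mul_pos_right h10 (by positivity)
        rcases pos_and_pos_or_neg_and_neg_of_mul_pos h9 with ⟨h10, h11⟩ | ⟨h10, h11⟩
        · exact ⟨by linarith, by linarith⟩
        · linarith

lemma measurableSet_arc (X : OnePoint ℝ) (v : ℝ) : MeasurableSet (arc X v) := by
  induction X using OnePoint.rec with
  | infty => exact measurableSet_Iio
  | coe u =>
    change MeasurableSet (if u ≤ v then Set.Ioo u v else Set.Ioi u ∪ Set.Iio v)
    split_ifs
    · exact measurableSet_Ioo
    · exact measurableSet_Ioi.union measurableSet_Iio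

variable {p : ℝ[X]} {x₁ x₂ x₃ μ ν : ℝ}

lemma IsUniformizer.integral_arc (h : IsBranched p x₁ x₂ x₃ μ ν)
    (hu : IsUniformizer p μ ν A B Γ D) {X : OnePoint ℝ} {u : ℝ} (hX : IsParameter A B Γ D X u)
    (hlt : mobInv A B Γ D x₁ < u) :
    ∫ t in arc X x₁, 1 / √(p.eval t) = ∫ s in Set.Ioo (mobInv A B Γ D x₁) u,
      2 / √(cubic (mobInv A B Γ D x₁) (mobInv A B Γ D x₂) (mobInv A B Γ D x₃) s) := by
  have := h.neg_one_lt; have := h.lt₁₂; have := h.lt_one; have := h.one_lt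
  have h1 := hu.lin_ne_zero h (t := x₁) (by linarith) (by linarith)
  have harc := arc_eq hu.det_neg hX h1 hlt
  have hint := hu.integral_image h 1 (measurableSet_arc X x₁) fun t ht => by
    rw [harc] at ht; exact ht.1
  simp only [one_mul] at hint
  rw [hint]
  refine setIntegral_congr_set ?_
  -- the image of the arc misses at most the value at infinity
  have hsub : mobInv A B Γ D '' arc X x₁ ⊆ Set.Ioo (mobInv A B Γ D x₁) u := by
    rintro _ ⟨t, ht, rfl⟩
    rw [harc] at ht
    exact ht.2
  have hdiff : Set.Ioo (mobInv A B Γ D x₁) u \ mobInv A B Γ D '' arc X x₁ ⊆ {-D / Γ} := by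
    rintro s ⟨hs, hns⟩
    rw [Set.mem_singleton_iff]
    by_contra hne
    have hlin : Γ * s + D ≠ 0 := by
      intro h0
      rcases eq_or_ne Γ 0 with hΓ | hΓ
      · have hD : D = 0 := by rw [hΓ] at h0; linarith
        have := hu.det_neg
        rw [hΓ, hD] at this
        simp at this
      · exact hne (by field_simp; linarith)
    obtain ⟨t, ht⟩ : ∃ t, t = (A * s + B) / (Γ * s + D) := ⟨_, rfl⟩
    have e2 := div_mul_cancel₀ (A * s + B) hlin
    rw [← ht] at e2
    have e1 : A - Γ * t = (A * D - B * Γ) / (Γ * s + D) := by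
      rw [eq_div_iff hlin]; linear_combination -Γ * e2
    have e3 : A - Γ * t ≠ 0 := by rw [e1]; exact div_ne_zero hu.det_neg.ne hlin
    have e4 : mobInv A B Γ D t = s := by
      rw [mobInv, e1, div_eq_iff (div_ne_zero hu.det_neg.ne hlin), ← mul_div_assoc, eq_div_iff hlin]
      linear_combination D * e2
    refine hns ⟨t, ?_, e4⟩
    rw [harc]
    exact ⟨e3, by rw [e4]; exact hs.1, by rw [e4]; exact hs.2⟩
  refine (ae_eq_set.2 ⟨?_, ?_⟩)
  · rw [Set.sdiff_eq_empty.2 hsub, measure_empty]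
  · exact measure_mono_null hdiff (measure_singleton _)

end Arc

section ThirdPeriod

variable {w : ℤ → ℤ → ℝ} {x₁ x₂ x₃ μ ν : ℝ}

/-- On `[x₂, x₃]` the middle coefficient of the kernel is negative. -/
lemma middle_neg (hw : IsWeight w) (h : IsBranched (wdisc w) x₁ x₂ x₃ μ ν) {v : ℝ} (h2 : x₂ ≤ v)
    (h3 : v ≤ x₃) : -v + (wcoeff w 0).eval v < 0 := by
  have hne : ∀ t ∈ Set.Icc x₂ x₃, -t + (wcoeff w 0).eval t ≠ 0 := by
    intro t ht h0
    have htpos : 0 < t := h.pos.trans_le ht.1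
    have ha := eval_wcoeff_pos hw htpos (j := 1) (by simp)
    have hc := eval_wcoeff_pos hw htpos (j := -1) (by simp)
    have hd : 0 ≤ (wdisc w).eval t := by
      have hc : Continuous fun t => (wdisc w).eval t := (wdisc w).continuous
      rcases eq_or_lt_of_le ht.1 with h4 | h4
      · rw [← h4, (h.eval_eq_zero_iff x₂).2 (by simp)]
      · rcases eq_or_lt_of_le ht.2 with h5 | h5
        · rw [h5, (h.eval_eq_zero_iff x₃).2 (by simp)]
        · exact (h.eval_pos h4 h5).le
    rw [eval_wdisc, h0] at hd
    nlinarith [mul_pos ha hc]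
  have hone : -1 + (wcoeff w 0).eval 1 < 0 := by
    rw [eval_wcoeff]
    have := hw.sum_lt; have := hw.zero
    have n := hw.nonneg
    linarith [n (-1) (-1), n (-1) 1, n 0 (-1), n 0 1, n 1 (-1), n 1 1]
  by_contra hn
  have hc : Continuous fun t : ℝ => -t + (wcoeff w 0).eval t := by fun_prop
  obtain ⟨t, ht, ht0⟩ := isPreconnected_Icc.intermediate_value (a := 1) (b := v) (s := Set.Icc x₂ x₃)
    ⟨h.lt_one.le, h.one_lt.le⟩ ⟨h2, h3⟩ hc.continuousOn ⟨hone.le, not_lt.1 hn⟩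
  exact hne t ht ht0

lemma IsBranched.eval_derivative_branch1 (h : IsBranched (wdisc w) x₁ x₂ x₃ μ ν) :
    (derivative (wdisc w)).eval x₁ = (μ * x₁ - ν) * ((x₁ - x₂) * (x₁ - x₃)) := by
  rw [h.fac]
  simp only [derivative_mul, derivative_sub, derivative_C, derivative_X, eval_add,
    eval_mul, eval_sub, eval_X, eval_C, eval_zero, eval_one]
  ring

lemma eval_derivative_wdisc (w : ℤ → ℤ → ℝ) (t : ℝ) : (derivative (wdisc w)).eval t =
    2 * (-t + (wcoeff w 0).eval t) * (-1 + w 0 0 + 2 * w 1 0 * t)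
      - 4 * ((w 0 1 + 2 * w 1 1 * t) * (wcoeff w (-1)).eval t
        + (wcoeff w 1).eval t * (w 0 (-1) + 2 * w 1 (-1) * t)) := by
  simp only [wdisc, wcoeff, derivative_sub, derivative_mul, derivative_pow, derivative_add,
    derivative_neg, derivative_X, derivative_C, derivative_ofNat, eval_sub, eval_mul, eval_pow,
    eval_add, eval_neg, eval_X, eval_C, eval_ofNat, eval_zero, eval_one]
  norm_num
  ring

variable {y₁ y₂ y₃ μ' ν' : ℝ}

open Classical in
/-- The double root in `x` of the kernel at the branch point `y₁`. -/
def doubleRoot (w : ℤ → ℤ → ℝ) (y₁ : ℝ) : OnePoint ℝ :=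
  if (wcoeff (fun i j => w j i) 1).eval y₁ = 0 then OnePoint.infty
  else ((-(-y₁ + (wcoeff (fun i j => w j i) 0).eval y₁) /
    (2 * (wcoeff (fun i j => w j i) 1).eval y₁) : ℝ) : OnePoint ℝ)

/-- A value of the cubic which is nonnegative is taken above the largest root, or between the two
other ones. -/
lemma IsRootTriple.of_cubic_nonneg {e₁ e₂ e₃ u : ℝ} (h : IsRootTriple e₁ e₂ e₃)
    (hu : 0 ≤ cubic e₁ e₂ e₃ u) : e₁ ≤ u ∨ e₃ ≤ u ∧ u ≤ e₂ := by
  have := h.lt₁₂; have := h.lt₂₃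
  by_contra! hn
  obtain ⟨h1, h2⟩ := hn
  rw [cubic] at hu
  rcases lt_or_ge u e₃ with h3 | h3
  · have := mul_pos_of_neg_of_neg (sub_neg.2 h3) (sub_neg.2 (by linarith : u < e₂))
    nlinarith
  · have h4 := h2 h3
    rcases eq_or_lt_of_le h3 with h5 | h5
    · nlinarith
    have := mul_pos (sub_pos.2 h5) (sub_pos.2 h4)
    nlinarith

variable {W₁ W₂ : ℝ} {h₁ : 0 < W₁} {h₂ : 0 < W₂} {A B Γ D : ℝ}

/-- The double root lies on the arc from `x₄` to `x₁`, that is, beyond the largest root of the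
cubic. -/
theorem exists_parameter (hw : IsWeight w)
    (hx : IsCoordinate h₁ h₂ (wdisc w) x₁ x₂ x₃ μ ν A B Γ D)
    (hy : IsBranched (wdisc fun i j => w j i) y₁ y₂ y₃ μ' ν')
    (hpos : 0 < y₁ → 0 ≤ -y₁ + (wcoeff (fun i j => w j i) 0).eval y₁) :
    ∃ u, rootE₁ h₁ h₂ < u ∧ IsParameter A B Γ D (doubleRoot w y₁) u := by
  have hb := hx.branched
  have := hb.neg_one_lt; have := hb.lt₁₂; have := hb.lt_one; have := hb.one_lt
  have hdet := hx.unif.det_neg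
  obtain ⟨ht, hq⟩ := hx.unif.isRootTriple hb
  set α := (wcoeff (fun i j => w j i) 1).eval y₁ with hα
  set β := -y₁ + (wcoeff (fun i j => w j i) 0).eval y₁ with hβ
  set γ := (wcoeff (fun i j => w j i) (-1)).eval y₁ with hγ
  have hdy : β ^ 2 - 4 * α * γ = 0 := by
    rw [hα, hβ, hγ, ← eval_wdisc, hy.eval_eq_zero_iff]; simp
  -- the kernel at `y₁`, written in the two ways
  have hK : ∀ t, (wcoeff w 1).eval t * y₁ ^ 2 + (-t + (wcoeff w 0).eval t) * y₁ +
      (wcoeff w (-1)).eval t = α * t ^ 2 + β * t + γ := by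
    intro t
    rw [hα, hβ, hγ]
    simp only [eval_wcoeff]
    ring
  have hout : ∀ {u}, 0 ≤ 4 * u ^ 3 - quarticG2 (wdisc w) * u - quarticG3 (wdisc w) →
      (∀ r ∈ Set.Icc x₂ x₃, mobInv A B Γ D r ≠ u) → mobInv A B Γ D x₁ ≠ u →
      rootE₁ h₁ h₂ < u := by
    intro u hu h5 h6
    rw [hq] at hu
    rcases ht.of_cubic_nonneg hu with h3 | ⟨h3, h4⟩
    · rw [← hx.e₁]
      exact lt_of_le_of_ne h3 h6
    · obtain ⟨r, hr, hr'⟩ := hx.exists_mobInv_eq (s := x₂) (t := x₃) (by linarith) (by linarith)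
        le_rfl h3 h4
      exact absurd hr' (h5 r hr)
  by_cases hα0 : α = 0
  · have hβ0 : β = 0 := by rw [hα0] at hdy; simpa using hdy
    have hμ4 : μ = (2 * w 1 1 * y₁ + w 1 0) ^ 2 := by
      rw [← hb.coeff_four, coeff_wdisc, wdcoeff]
      rw [hα, eval_wcoeff] at hα0
      linear_combination -4 * w 1 1 * hα0
    have hμ : μ ≠ 0 := by
      intro h0
      have h3 := hb.coeff_three
      rw [h0, coeff_wdisc, wdcoeff] at h3
      have h4 : 2 * w 1 1 * y₁ + w 1 0 = 0 := by
        rw [h0] at hμ4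
        exact pow_eq_zero_iff (two_ne_zero) |>.1 hμ4.symm
      rw [hα, eval_wcoeff] at hα0
      rw [hβ, eval_wcoeff] at hβ0
      have := hb.nu_pos
      have h5 : ν = 0 := by
        linear_combination h3 + 4 * w 1 1 * hβ0 + 4 * w 0 1 * hα0
          - (2 * (w 0 0 - 1) + 4 * w 0 1 * y₁) * h4
      linarith
    obtain ⟨k, hk, hA, hΓ⟩ := hx.unif.prop
    have hΓ0 : Γ ≠ 0 := by rw [hΓ]; exact mul_ne_zero hk hμ
    have hX : doubleRoot w y₁ = OnePoint.infty := if_pos hα0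
    rw [hX]
    have hzero : Γ * (-D / Γ) + D = 0 := by field_simp; ring
    have hne : ∀ r, A - Γ * r ≠ 0 → mobInv A B Γ D r ≠ -D / Γ := by
      intro r hr h0
      have h3 := mobInv_sub_infty (B := B) (D := D) hΓ0 hr
      rw [h0, sub_self] at h3
      exact div_ne_zero hdet.ne (mul_ne_zero hΓ0 hr) h3.symm
    refine ⟨-D / Γ, hout ?_ ?_ ?_, hzero⟩
    · have h3 := hx.unif.homEval_eq ((-D / Γ : ℝ) : ℂ)
      have e1 : (Γ : ℂ) * ((-D / Γ : ℝ) : ℂ) + D = 0 := by exact_mod_cast hzero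
      rw [e1, homEval, hb.coeff_four] at h3
      have h4 : 4 * (μ * (A * (-D / Γ) + B) ^ 4) = (A * D - B * Γ) ^ 2 *
          (4 * (-D / Γ) ^ 3 - quarticG2 (wdisc w) * (-D / Γ) - quarticG3 (wdisc w)) := by
        have h5 := h3
        simp only [ne_eq, OfNat.ofNat_ne_zero, not_false_eq_true, zero_pow, mul_zero,
          zero_add] at h5
        exact_mod_cast h5
      have h6 : 0 ≤ 4 * (μ * (A * (-D / Γ) + B) ^ 4) := by
        have : 0 ≤ μ := by rw [hμ4]; positivity
        positivity
      rw [h4] at h6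
      exact nonneg_of_mul_nonneg_right h6 (by have := hdet.ne; positivity)
    · intro r hr
      exact hne r (hx.unif.lin_ne_zero hb (by linarith [hr.1]) hr.2)
    · exact hne x₁ (hx.unif.lin_ne_zero hb (by linarith) (by linarith))
  · obtain ⟨v, hv⟩ : ∃ v, v = -β / (2 * α) := ⟨_, rfl⟩
    have hX : doubleRoot w y₁ = (v : OnePoint ℝ) := by rw [hv]; exact if_neg hα0
    have hv1 : 2 * α * v + β = 0 := by rw [hv]; field_simp; ring
    have hKv : (wcoeff w 1).eval v * y₁ ^ 2 + (-v + (wcoeff w 0).eval v) * y₁ +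
        (wcoeff w (-1)).eval v = 0 := by
      rw [hK]
      have : 4 * α * (α * v ^ 2 + β * v + γ) = 0 := by
        linear_combination (2 * α * v + β) * hv1 - hdy
      exact (mul_eq_zero.1 this).resolve_left (mul_ne_zero four_ne_zero hα0)
    have hd : (wdisc w).eval v =
        (2 * (wcoeff w 1).eval v * y₁ + (-v + (wcoeff w 0).eval v)) ^ 2 := by
      rw [eval_wdisc]
      linear_combination -4 * (wcoeff w 1).eval v * hKv
    have hnot : v ∉ Set.Icc x₂ x₃ := by
      intro hmem
      have hvpos : 0 < v := hb.pos.trans_le hmem.1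
      have ha := eval_wcoeff_pos hw hvpos (j := 1) (by simp)
      have hc := eval_wcoeff_pos hw hvpos (j := -1) (by simp)
      have hbv := middle_neg hw hb hmem.1 hmem.2
      have hy1 : 0 < y₁ := by
        by_contra hn
        nlinarith [mul_nonneg_of_nonpos_of_nonpos hbv.le (not_lt.1 hn), mul_nonneg ha.le (sq_nonneg y₁)]
      have hα1 : 0 < α := eval_wcoeff_pos hw.transpose hy1 (j := 1) (by simp)
      have := hpos hy1
      nlinarith [mul_pos hα1 hvpos]
    -- `v` is not a branch point, since the branch points are simple roots
    have hsimple : (wdisc w).eval v = 0 → (derivative (wdisc w)).eval v = 0 := by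
      intro h0
      rw [hd] at h0
      have h3 := pow_eq_zero_iff two_ne_zero |>.1 h0
      have h5 : (w 0 1 + 2 * w 1 1 * v) * y₁ ^ 2 + (-1 + w 0 0 + 2 * w 1 0 * v) * y₁ +
          (w 0 (-1) + 2 * w 1 (-1) * v) = 0 := by
        have : (w 0 1 + 2 * w 1 1 * v) * y₁ ^ 2 + (-1 + w 0 0 + 2 * w 1 0 * v) * y₁ +
          (w 0 (-1) + 2 * w 1 (-1) * v) = 2 * α * v + β := by
          rw [hα, hβ]
          simp only [eval_wcoeff]
          ring
        rw [this, hv1]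
      rw [eval_derivative_wdisc]
      linear_combination (2 * (-1 + w 0 0 + 2 * w 1 0 * v) + 4 * y₁ * (w 0 1 + 2 * w 1 1 * v)) * h3
        - 4 * (w 0 1 + 2 * w 1 1 * v) * hKv - 4 * (wcoeff w 1).eval v * h5
    have hv3 : v ≠ x₁ := by
      rintro rfl
      have h3 := hsimple ((hb.eval_eq_zero_iff v).2 (by simp))
      rw [hb.eval_derivative_branch1] at h3
      have h4 := hb.lin_neg (t := v) (by linarith) (by linarith)
      exact mul_ne_zero h4.ne (mul_ne_zero (by linarith) (by linarith)) h3
    have hlin : A - Γ * v ≠ 0 := by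
      intro h0
      obtain ⟨k, hk, hA, hΓ⟩ := hx.unif.prop
      have hμv : μ * v = ν := by
        have : k * (ν - μ * v) = 0 := by rw [hA, hΓ] at h0; linarith
        have := (mul_eq_zero.1 this).resolve_left hk
        linarith
      have h3 := hsimple ((hb.eval_eq_zero_iff v).2 (Or.inl hμv))
      rw [hb.eval_derivative_root hμv] at h3
      have hμ : μ ≠ 0 := by
        rintro rfl
        have := hb.nu_pos
        linarith
      have n2 : v ≠ x₂ := by rintro rfl; exact hnot ⟨le_rfl, by linarith⟩
      have n3 : v ≠ x₃ := by rintro rfl; exact hnot ⟨by linarith, le_rfl⟩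
      exact mul_ne_zero hμ (mul_ne_zero (mul_ne_zero (sub_ne_zero.2 hv3) (sub_ne_zero.2 n2))
        (sub_ne_zero.2 n3)) h3
    rw [hX]
    have hinj : ∀ r, A - Γ * r ≠ 0 → mobInv A B Γ D r = mobInv A B Γ D v → r = v := by
      intro r hr h0
      have h3 := mobInv_sub (B := B) (D := D) hr hlin
      rw [h0, sub_self] at h3
      have h4 := (div_eq_zero_iff.1 h3.symm).resolve_right (mul_ne_zero hr hlin)
      exact sub_eq_zero.1 ((mul_eq_zero.1 h4).resolve_left hdet.ne)
    refine ⟨mobInv A B Γ D v, hout ?_ ?_ ?_, hlin, rfl⟩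
    · rw [hx.unif.cubic_mobInv hb.natDegree_le hlin, hd]
      positivity
    · intro r hr h0
      have := hinj r (hx.unif.lin_ne_zero hb (by linarith [hr.1]) hr.2) h0
      exact hnot (this ▸ hr)
    · intro h0
      exact hv3 (hinj x₁ (hx.unif.lin_ne_zero hb (by linarith) (by linarith)) h0).symm

/-- The third period is `2 (W₂ / 2 - τ)`, where `τ` is a point of `]0, W₂ / 2[` at which `x` takes
the value `X(y₁)`. -/
theorem exists_thirdPeriod (hw : IsWeight w)
    (hx : IsCoordinate h₁ h₂ (wdisc w) x₁ x₂ x₃ μ ν A B Γ D)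
    (hy : IsBranched (wdisc fun i j => w j i) y₁ y₂ y₃ μ' ν')
    (hpos : 0 < y₁ → 0 ≤ -y₁ + (wcoeff (fun i j => w j i) 0).eval y₁) :
    ∃ τ ∈ Set.Ioo 0 (W₂ / 2),
      ∫ t in arc (doubleRoot w y₁) x₁, 1 / √((wdisc w).eval t) = 2 * (W₂ / 2 - τ) ∧
      ℘'[rectPair h₁ h₂] (τ : ℝ) ≠ 0 ∧
      ∃ u : ℝ, ℘[rectPair h₁ h₂] (τ : ℝ) = u ∧ IsParameter A B Γ D (doubleRoot w y₁) u := by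
  obtain ⟨u, hu, hX⟩ := exists_parameter hw hx hy hpos
  obtain ⟨τ, hτ, h1, h2, h3⟩ := exists_bottom_integral hu
  refine ⟨τ, hτ, ?_, h2, u, h1, hX⟩
  rw [hx.unif.integral_arc hx.branched hX (by rwa [hx.e₁]), hx.e₁, hx.e₂, hx.e₃, h3]

end ThirdPeriod

/-! ### The kernel vanishes along the uniformization -/

section Kernel

/-- The partial derivative of the kernel in `y`. The one in `x` is that of the transposed
weights. -/
def wkerY (w : ℤ → ℤ → ℝ) (x y : ℂ) : ℂ :=
  2 * aeval x (wcoeff w 1) * y + (-x + aeval x (wcoeff w 0))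

/-- The mixed partial derivative of the kernel. -/
def wkerXY (w : ℤ → ℤ → ℝ) (x y : ℂ) : ℂ :=
  -1 + w 0 0 + 2 * w 1 0 * x + 2 * (w 0 1 + 2 * w 1 1 * x) * y

variable (w : ℤ → ℤ → ℝ)

lemma wker_transpose (x y : ℂ) : wker (fun i j => w j i) y x = wker w x y := by
  simp only [wker, aeval_wcoeff]
  ring

lemma wkerXY_transpose (x y : ℂ) : wkerXY (fun i j => w j i) y x = wkerXY w x y := by
  simp only [wkerXY]
  ring

/-- For any `y`, the discriminant is `K_y² - 4 a K`. -/
lemma aeval_wdisc_eq (x y : ℂ) : aeval x (wdisc w) =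
    wkerY w x y ^ 2 - 4 * aeval x (wcoeff w 1) * wker w x y := by
  simp only [aeval_wdisc, wkerY, wker]
  ring

/-- The derivative of the preceding identity in `x`. -/
lemma aeval_derivative_wdisc_eq (x y : ℂ) : aeval x (derivative (wdisc w)) =
    2 * wkerY w x y * wkerXY w x y - 4 * (w 0 1 + 2 * w 1 1 * x) * wker w x y
      - 4 * aeval x (wcoeff w 1) * wkerY (fun i j => w j i) y x := by
  simp only [wdisc, wcoeff, derivative_mul, derivative_pow, derivative_X, derivative_C, derivative_ofNat, wkerY, wkerXY, wker, map_add,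
    map_sub, map_mul, map_neg, map_pow, aeval_X, aeval_C, Complex.coe_algebraMap, map_ofNat,
    map_zero, map_one]
  norm_num
  ring

variable {w}

lemma hasDerivAt_wker {f g : ℂ → ℂ} {f' g' ω : ℂ} (hf : HasDerivAt f f' ω)
    (hg : HasDerivAt g g' ω) : HasDerivAt (fun ω => wker w (f ω) (g ω))
      (wkerY (fun i j => w j i) (g ω) (f ω) * f' + wkerY w (f ω) (g ω) * g') ω := by
  have hc : ∀ j, HasDerivAt (fun ω => aeval (f ω) (wcoeff w j)) ((w 0 j + 2 * w 1 j * f ω) * f') ω := by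
    intro j
    simp only [aeval_wcoeff]
    refine (((hf.const_mul (w 0 j : ℂ)).const_add (w (-1) j : ℂ)).add
      ((hf.pow 2).const_mul (w 1 j : ℂ))).congr_deriv ?_
    push_cast
    ring
  refine ((((hc 1).mul (hg.pow 2)).add ((hf.neg.add (hc 0)).mul hg)).add (hc (-1))).congr_deriv ?_
  simp only [wkerY, aeval_wcoeff, Pi.pow_apply, Pi.add_apply, Pi.neg_apply]
  push_cast
  ring

lemma hasDerivAt_wkerY {f g : ℂ → ℂ} {f' g' ω : ℂ} (hf : HasDerivAt f f' ω)
    (hg : HasDerivAt g g' ω) : HasDerivAt (fun ω => wkerY w (f ω) (g ω))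
      (wkerXY w (f ω) (g ω) * f' + 2 * aeval (f ω) (wcoeff w 1) * g') ω := by
  have hc : ∀ j, HasDerivAt (fun ω => aeval (f ω) (wcoeff w j)) ((w 0 j + 2 * w 1 j * f ω) * f') ω := by
    intro j
    simp only [aeval_wcoeff]
    refine (((hf.const_mul (w 0 j : ℂ)).const_add (w (-1) j : ℂ)).add
      ((hf.pow 2).const_mul (w 1 j : ℂ))).congr_deriv ?_
    push_cast
    ring
  refine ((((hc 1).const_mul 2).mul hg).add (hf.neg.add (hc 0))).congr_deriv ?_
  simp only [wkerXY, aeval_wcoeff]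
  ring

lemma analyticAt_wker {f g : ℂ → ℂ} {ω : ℂ} (hf : AnalyticAt ℂ f ω) (hg : AnalyticAt ℂ g ω) :
    AnalyticAt ℂ (fun ω => wker w (f ω) (g ω)) ω := by
  simp only [wker, aeval_wcoeff]
  fun_prop

lemma analyticAt_wkerY {f g : ℂ → ℂ} {ω : ℂ} (hf : AnalyticAt ℂ f ω) (hg : AnalyticAt ℂ g ω) :
    AnalyticAt ℂ (fun ω => wkerY w (f ω) (g ω)) ω := by
  simp only [wkerY, aeval_wcoeff]
  fun_prop

/-- Two functions that satisfy the equations `f'' = 2 d'(f)` and `g'' = 2 d̃'(g)`, and start at a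
point of the kernel curve in a tangent direction, follow this curve: the defects of the equations
`f' = 2 σ K_y`, `g' = - 2 σ K_x` and `K = 0` satisfy a homogeneous linear system. -/
theorem eventually_wker_eq_zero {f g : ℂ → ℂ} {ω₀ σ : ℂ} (hσ : σ ^ 2 = 1)
    (hf : AnalyticAt ℂ f ω₀) (hg : AnalyticAt ℂ g ω₀)
    (hf2 : ∀ᶠ ω in 𝓝 ω₀, deriv (deriv f) ω = 2 * aeval (f ω) (derivative (wdisc w)))
    (hg2 : ∀ᶠ ω in 𝓝 ω₀, deriv (deriv g) ω =
      2 * aeval (g ω) (derivative (wdisc fun i j => w j i)))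
    (hK : wker w (f ω₀) (g ω₀) = 0)
    (hf1 : deriv f ω₀ = 2 * σ * wkerY w (f ω₀) (g ω₀))
    (hg1 : deriv g ω₀ = -2 * σ * wkerY (fun i j => w j i) (g ω₀) (f ω₀)) :
    ∀ᶠ ω in 𝓝 ω₀, wker w (f ω) (g ω) = 0 ∧ deriv f ω = 2 * σ * wkerY w (f ω) (g ω) := by
  set F : ℂ → ℂ × ℂ × ℂ := fun ω => (deriv f ω - 2 * σ * wkerY w (f ω) (g ω),
    deriv g ω + 2 * σ * wkerY (fun i j => w j i) (g ω) (f ω), wker w (f ω) (g ω)) with hF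
  have a1 := analyticAt_wkerY (w := w) hf hg
  have a2 := analyticAt_wkerY (w := fun i j => w j i) hg hf
  have hFa : AnalyticAt ℂ F ω₀ :=
    (hf.deriv.sub (analyticAt_const.mul a1)).prod
      ((hg.deriv.add (analyticAt_const.mul a2)).prod (analyticAt_wker hf hg))
  have hF0 : F ω₀ = 0 := by
    simp only [hF, Prod.mk_eq_zero]
    exact ⟨by rw [hf1]; ring, by rw [hg1]; ring, hK⟩
  -- a bound for the coefficients of the linear system
  obtain ⟨M, hM⟩ : ∃ M : ℝ, ∀ᶠ ω in 𝓝 ω₀,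
      ‖8 * ((w 0 1 : ℂ) + 2 * w 1 1 * f ω)‖ + ‖2 * σ * wkerXY w (f ω) (g ω)‖
        + ‖4 * σ * aeval (f ω) (wcoeff w 1)‖ ≤ M ∧
      ‖8 * ((w 1 0 : ℂ) + 2 * w 1 1 * g ω)‖ + ‖2 * σ * wkerXY w (f ω) (g ω)‖
        + ‖4 * σ * aeval (g ω) (wcoeff (fun i j => w j i) 1)‖ ≤ M ∧
      ‖wkerY (fun i j => w j i) (g ω) (f ω)‖ + ‖wkerY w (f ω) (g ω)‖ ≤ M := by
    have c1 := hf.continuousAt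
    have c2 := hg.continuousAt
    have c3 := a1.continuousAt
    have c4 := a2.continuousAt
    have b1 : ContinuousAt (fun ω => ‖8 * ((w 0 1 : ℂ) + 2 * w 1 1 * f ω)‖
        + ‖2 * σ * wkerXY w (f ω) (g ω)‖ + ‖4 * σ * aeval (f ω) (wcoeff w 1)‖) ω₀ := by
      simp only [wkerXY, aeval_wcoeff]
      fun_prop
    have b2 : ContinuousAt (fun ω => ‖8 * ((w 1 0 : ℂ) + 2 * w 1 1 * g ω)‖
        + ‖2 * σ * wkerXY w (f ω) (g ω)‖
        + ‖4 * σ * aeval (g ω) (wcoeff (fun i j => w j i) 1)‖) ω₀ := by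
      simp only [wkerXY, aeval_wcoeff]
      fun_prop
    have b3 : ContinuousAt (fun ω => ‖wkerY (fun i j => w j i) (g ω) (f ω)‖
        + ‖wkerY w (f ω) (g ω)‖) ω₀ := c4.norm.add c3.norm
    obtain ⟨m1, h1⟩ := exists_gt (‖8 * ((w 0 1 : ℂ) + 2 * w 1 1 * f ω₀)‖
        + ‖2 * σ * wkerXY w (f ω₀) (g ω₀)‖ + ‖4 * σ * aeval (f ω₀) (wcoeff w 1)‖)
    obtain ⟨m2, h2⟩ := exists_gt (‖8 * ((w 1 0 : ℂ) + 2 * w 1 1 * g ω₀)‖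
        + ‖2 * σ * wkerXY w (f ω₀) (g ω₀)‖
        + ‖4 * σ * aeval (g ω₀) (wcoeff (fun i j => w j i) 1)‖)
    obtain ⟨m3, h3⟩ := exists_gt (‖wkerY (fun i j => w j i) (g ω₀) (f ω₀)‖
        + ‖wkerY w (f ω₀) (g ω₀)‖)
    refine ⟨max m1 (max m2 m3), ?_⟩
    filter_upwards [b1.eventually_lt_const h1, b2.eventually_lt_const h2,
      b3.eventually_lt_const h3] with ω l1 l2 l3
    exact ⟨l1.le.trans (le_max_left _ _),
      l2.le.trans ((le_max_left _ _).trans (le_max_right _ _)),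
      l3.le.trans ((le_max_right _ _).trans (le_max_right _ _))⟩
  have key := eventually_eq_zero_of_norm_deriv_le hFa hF0 (M := M) ?_
  · filter_upwards [key] with ω hω
    simp only [hF, Prod.mk_eq_zero] at hω
    exact ⟨hω.2.2, sub_eq_zero.1 hω.1⟩
  filter_upwards [hM, hf2, hg2, hf.eventually_analyticAt, hg.eventually_analyticAt]
    with ω ⟨l1, l2, l3⟩ e1 e2 f1 g1
  have d1 := f1.differentiableAt.hasDerivAt
  have d2 := g1.differentiableAt.hasDerivAt
  have d3 := f1.deriv.differentiableAt.hasDerivAt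
  have d4 := g1.deriv.differentiableAt.hasDerivAt
  have D1 := d3.sub ((hasDerivAt_wkerY (w := w) d1 d2).const_mul (2 * σ))
  have D2 := d4.add ((hasDerivAt_wkerY (w := fun i j => w j i) d2 d1).const_mul (2 * σ))
  have D3 := hasDerivAt_wker (w := w) d1 d2
  have hFd : deriv F ω = _ := (D1.prodMk (D2.prodMk D3)).deriv
  rw [hFd, e1, e2, aeval_derivative_wdisc_eq w (f ω) (g ω),
    aeval_derivative_wdisc_eq (fun i j => w j i) (g ω) (f ω),
    wkerXY_transpose w (f ω) (g ω), wker_transpose w (f ω) (g ω)]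
  obtain ⟨P, hP⟩ : ∃ P, P = (F ω).1 := ⟨_, rfl⟩
  obtain ⟨R, hR⟩ : ∃ R, R = (F ω).2.1 := ⟨_, rfl⟩
  obtain ⟨T, hT⟩ : ∃ T, T = (F ω).2.2 := ⟨_, rfl⟩
  have nP : ‖P‖ ≤ ‖F ω‖ := hP ▸ norm_fst_le _
  have nR : ‖R‖ ≤ ‖F ω‖ := hR ▸ (norm_fst_le _).trans (norm_snd_le _)
  have nT : ‖T‖ ≤ ‖F ω‖ := hT ▸ (norm_snd_le _).trans (norm_snd_le _)
  have eP : deriv f ω = P + 2 * σ * wkerY w (f ω) (g ω) := by rw [hP]; simp [hF]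
  have eR : deriv g ω = R - 2 * σ * wkerY (fun i j => w j i) (g ω) (f ω) := by rw [hR]; simp [hF]
  have eT : wker w (f ω) (g ω) = T := by rw [hT]
  rw [eP, eR, eT]
  have bound3 : ∀ {u v t : ℂ}, ‖u‖ + ‖v‖ + ‖t‖ ≤ M →
      ‖u * T + v * P + t * R‖ ≤ M * ‖F ω‖ ∧ ‖u * T + v * R + t * P‖ ≤ M * ‖F ω‖ := by
    intro u v t hM
    have hM' := mul_le_mul_of_nonneg_right hM (norm_nonneg (F ω))
    constructor
    · refine (norm_add₃_le).trans ?_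
      rw [norm_mul, norm_mul, norm_mul]
      nlinarith [mul_le_mul_of_nonneg_left nT (norm_nonneg u),
        mul_le_mul_of_nonneg_left nP (norm_nonneg v), mul_le_mul_of_nonneg_left nR (norm_nonneg t)]
    · refine (norm_add₃_le).trans ?_
      rw [norm_mul, norm_mul, norm_mul]
      nlinarith [mul_le_mul_of_nonneg_left nT (norm_nonneg u),
        mul_le_mul_of_nonneg_left nR (norm_nonneg v), mul_le_mul_of_nonneg_left nP (norm_nonneg t)]
  simp only [Prod.norm_def, max_le_iff]
  refine ⟨?_, ?_, ?_⟩
  · have b := (bound3 (u := -(8 * ((w 0 1 : ℂ) + 2 * w 1 1 * f ω)))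
      (v := -(2 * σ * wkerXY w (f ω) (g ω))) (t := -(4 * σ * aeval (f ω) (wcoeff w 1)))
      (by rw [norm_neg, norm_neg, norm_neg]; exact l1)).1
    refine le_of_eq_of_le (congrArg norm ?_) b
    linear_combination (-4 * wkerY w (f ω) (g ω) * wkerXY w (f ω) (g ω)
      + 8 * aeval (f ω) (wcoeff w 1) * wkerY (fun i j => w j i) (g ω) (f ω)) * hσ
  · have b := (bound3 (u := -(8 * ((w 1 0 : ℂ) + 2 * w 1 1 * g ω)))
      (v := 2 * σ * wkerXY w (f ω) (g ω))
      (t := 4 * σ * aeval (g ω) (wcoeff (fun i j => w j i) 1))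
      (by rw [norm_neg]; exact l2)).2
    refine le_of_eq_of_le (congrArg norm ?_) b
    linear_combination (-4 * wkerY (fun i j => w j i) (g ω) (f ω) * wkerXY w (f ω) (g ω)
      + 8 * aeval (g ω) (wcoeff (fun i j => w j i) 1) * wkerY w (f ω) (g ω)) * hσ
  · have b := (bound3 (u := 0) (v := wkerY (fun i j => w j i) (g ω) (f ω))
      (t := wkerY w (f ω) (g ω)) (by rw [norm_zero, zero_add]; exact l3)).1
    refine le_of_eq_of_le (congrArg norm ?_) b
    ring

end Kernel

section Uniformization

variable {W₁ W₂ : ℝ} {h₁ : 0 < W₁} {h₂ : 0 < W₂} {w : ℤ → ℤ → ℝ} {A B Γ D A' B' Γ' D' : ℝ}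

local notation "L" => rectPair h₁ h₂

lemma homEval_wdisc_reflect (w : ℤ → ℤ → ℝ) (s t : ℂ) :
    homEval (wdisc fun i j => w (-i) j) s t = homEval (wdisc w) t s := by
  simp only [homEval, coeff_wdisc]
  rw [wdcoeff_reflect w 0 (by norm_num), wdcoeff_reflect w 1 (by norm_num),
    wdcoeff_reflect w 2 (by norm_num), wdcoeff_reflect w 3 (by norm_num),
    wdcoeff_reflect w 4 (by norm_num)]
  norm_num
  ring

/-- The inverse of the coordinate `x` is the coordinate of the reflected weights. -/
lemma IsMobius.reflect (h : IsMobius h₁ h₂ (wdisc w) A B Γ D) :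
    IsMobius h₁ h₂ (wdisc fun i j => w (-i) j) Γ D A B where
  natDegree_le := natDegree_wdisc_le _
  det_ne h0 := h.det_ne (by linarith)
  homEval_eq u := by
    rw [homEval_wdisc_reflect, h.homEval_eq]
    ring

lemma wdisc_transpose_reflect (w : ℤ → ℤ → ℝ) :
    (wdisc fun i j => w (-j) i) = wdisc fun i j => w j i := by
  simp only [wdisc, wcoeff, neg_neg, neg_zero]
  ring

lemma deriv_shift (f : ℂ → ℂ) (h : ℂ) :
    (deriv fun ω => f (ω - h)) = fun ω => deriv f (ω - h) :=
  funext fun ω => deriv_comp_sub_const f h ω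

lemma analyticAt_shift {h ω : ℂ} (hd : linP h₁ h₂ Γ D (ω - h) ≠ 0) :
    AnalyticAt ℂ (fun ω => mobP h₁ h₂ A B Γ D (ω - h)) ω :=
  AnalyticAt.comp (g := mobP h₁ h₂ A B Γ D) (f := fun ω => ω - h) (analyticAt_mobP h₁ h₂ A B hd)
    (analyticAt_id.sub analyticAt_const)

lemma meromorphic_shift (h : ℂ) : Meromorphic (fun ω => mobP h₁ h₂ A B Γ D (ω - h)) := fun _ =>
  MeromorphicAt.comp_analyticAt (f := mobP h₁ h₂ A B Γ D) (g := fun ω => ω - h)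
    (meromorphic_mobP _) (analyticAt_id.sub analyticAt_const)

lemma eventually_linP_shift_ne_zero {h ω : ℂ} (hd : linP h₁ h₂ Γ D (ω - h) ≠ 0) :
    ∀ᶠ u in 𝓝 ω, linP h₁ h₂ Γ D (u - h) ≠ 0 := by
  have hc : Continuous fun u : ℂ => u - h := by fun_prop
  exact hc.continuousAt.eventually (eventually_linP_ne_zero h₁ h₂ hd)

lemma exists_eventually_wker_eq_zero (hf : IsMobius h₁ h₂ (wdisc w) A B Γ D)
    (hg : IsMobius h₁ h₂ (wdisc fun i j => w j i) A' B' Γ' D') {h ω₀ : ℂ}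
    (hd : linP h₁ h₂ Γ D ω₀ ≠ 0) (hd' : linP h₁ h₂ Γ' D' (ω₀ - h) ≠ 0)
    (hK : wker w (mobP h₁ h₂ A B Γ D ω₀) (mobP h₁ h₂ A' B' Γ' D' (ω₀ - h)) = 0)
    (hKx : wkerY (fun i j => w j i) (mobP h₁ h₂ A' B' Γ' D' (ω₀ - h)) (mobP h₁ h₂ A B Γ D ω₀) = 0)
    (hg1 : deriv (mobP h₁ h₂ A' B' Γ' D') (ω₀ - h) = 0) :
    ∃ σ : ℂ, σ ^ 2 = 1 ∧ ∀ᶠ ω in 𝓝 ω₀,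
      wker w (mobP h₁ h₂ A B Γ D ω) (mobP h₁ h₂ A' B' Γ' D' (ω - h)) = 0 ∧
      deriv (mobP h₁ h₂ A B Γ D) ω =
        2 * σ * wkerY w (mobP h₁ h₂ A B Γ D ω) (mobP h₁ h₂ A' B' Γ' D' (ω - h)) := by
  have h1 := hf.deriv_sq hd
  rw [aeval_wdisc_eq w _ (mobP h₁ h₂ A' B' Γ' D' (ω₀ - h)), hK] at h1
  obtain ⟨σ, hσ, hσ'⟩ : ∃ σ : ℂ, σ ^ 2 = 1 ∧ deriv (mobP h₁ h₂ A B Γ D) ω₀ =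
      2 * σ * wkerY w (mobP h₁ h₂ A B Γ D ω₀) (mobP h₁ h₂ A' B' Γ' D' (ω₀ - h)) := by
    have h2 : (deriv (mobP h₁ h₂ A B Γ D) ω₀) ^ 2 =
        (2 * wkerY w (mobP h₁ h₂ A B Γ D ω₀) (mobP h₁ h₂ A' B' Γ' D' (ω₀ - h))) ^ 2 := by
      rw [h1]; ring
    rcases sq_eq_sq_iff_eq_or_eq_neg.1 h2 with h3 | h3
    · exact ⟨1, by norm_num, by rw [h3]; ring⟩
    · exact ⟨-1, by norm_num, by rw [h3]; ring⟩
  refine ⟨σ, hσ, eventually_wker_eq_zero (g := fun ω => mobP h₁ h₂ A' B' Γ' D' (ω - h)) hσ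
    (analyticAt_mobP h₁ h₂ A B hd) (analyticAt_shift hd') ?_ ?_ hK hσ' ?_⟩
  · filter_upwards [eventually_linP_ne_zero h₁ h₂ hd] with ω hω
    exact hf.deriv_deriv hω
  · filter_upwards [eventually_linP_shift_ne_zero hd'] with ω hω
    rw [deriv_shift, deriv_shift]
    exact hg.deriv_deriv hω
  · rw [deriv_shift, hKx, mul_zero]
    exact hg1

/-- By analytic continuation, the kernel vanishes wherever both coordinates are finite. -/
lemma wker_eq_zero_of_eventually {h ω₀ σ : ℂ} (hev : ∀ᶠ ω in 𝓝[≠] ω₀,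
      wker w (mobP h₁ h₂ A B Γ D ω) (mobP h₁ h₂ A' B' Γ' D' (ω - h)) = 0 ∧
      deriv (mobP h₁ h₂ A B Γ D) ω =
        2 * σ * wkerY w (mobP h₁ h₂ A B Γ D ω) (mobP h₁ h₂ A' B' Γ' D' (ω - h)))
    {ω : ℂ} (hd : linP h₁ h₂ Γ D ω ≠ 0) (hd' : linP h₁ h₂ Γ' D' (ω - h) ≠ 0) :
    wker w (mobP h₁ h₂ A B Γ D ω) (mobP h₁ h₂ A' B' Γ' D' (ω - h)) = 0 ∧
      deriv (mobP h₁ h₂ A B Γ D) ω =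
        2 * σ * wkerY w (mobP h₁ h₂ A B Γ D ω) (mobP h₁ h₂ A' B' Γ' D' (ω - h)) := by
  have hf := analyticAt_mobP h₁ h₂ A B hd
  have hg := analyticAt_shift (A := A') (B := B') hd'
  have mf : Meromorphic (mobP h₁ h₂ A B Γ D) := meromorphic_mobP
  have mg : Meromorphic (fun ω => mobP h₁ h₂ A' B' Γ' D' (ω - h)) := meromorphic_shift h
  constructor
  · have hm : Meromorphic fun ω =>
        wker w (mobP h₁ h₂ A B Γ D ω) (mobP h₁ h₂ A' B' Γ' D' (ω - h)) := by
      intro u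
      have := mf u
      have := mg u
      simp only [wker, aeval_wcoeff]
      fun_prop
    have h1 := eventually_nhdsNE_eq_zero hm (hev.mono fun _ h => h.1) ω
    exact (((analyticAt_wker hf hg).continuousAt.eventuallyEq_nhds_iff_eventuallyEq_nhdsNE
      (continuousAt_const (y := (0 : ℂ)))).1 h1).eq_of_nhds
  · have hm : Meromorphic fun ω => deriv (mobP h₁ h₂ A B Γ D) ω -
        2 * σ * wkerY w (mobP h₁ h₂ A B Γ D ω) (mobP h₁ h₂ A' B' Γ' D' (ω - h)) := by
      intro u
      have := mf u
      have := (mf u).deriv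
      have := mg u
      simp only [wkerY, aeval_wcoeff]
      fun_prop
    have h1 := eventually_nhdsNE_eq_zero hm (hev.mono fun _ h => sub_eq_zero.2 h.2) ω
    have hc : AnalyticAt ℂ (fun ω => deriv (mobP h₁ h₂ A B Γ D) ω -
        2 * σ * wkerY w (mobP h₁ h₂ A B Γ D ω) (mobP h₁ h₂ A' B' Γ' D' (ω - h))) ω :=
      hf.deriv.sub (analyticAt_const.mul (analyticAt_wkerY hf hg))
    exact sub_eq_zero.1 ((hc.continuousAt.eventuallyEq_nhds_iff_eventuallyEq_nhdsNE
      (continuousAt_const (y := (0 : ℂ)))).1 h1).eq_of_nhds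

lemma wker_reflect (w : ℤ → ℤ → ℝ) {ξ : ℂ} (hξ : ξ ≠ 0) (y : ℂ) :
    wker w ξ⁻¹ y = wker (fun i j => w (-i) j) ξ y / ξ ^ 2 := by
  simp only [wker, aeval_wcoeff, neg_neg, neg_zero]
  field_simp
  ring

lemma wkerY_reflect (w : ℤ → ℤ → ℝ) {ξ : ℂ} (hξ : ξ ≠ 0) (y : ℂ) :
    wkerY w ξ⁻¹ y = wkerY (fun i j => w (-i) j) ξ y / ξ ^ 2 := by
  simp only [wkerY, aeval_wcoeff, neg_neg, neg_zero]
  field_simp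
  ring

variable {x₁ x₂ x₃ μ ν y₁ y₂ y₃ μ' ν' : ℝ}

/-- The two coordinates parametrize the kernel curve. At the base point, where `y` takes the value
`y₁` and `x` the value `X(y₁)`, the kernel and its derivative in `x` vanish. -/
theorem exists_wker_eq_zero (hx : IsCoordinate h₁ h₂ (wdisc w) x₁ x₂ x₃ μ ν A B Γ D)
    (hy : IsCoordinate h₁ h₂ (wdisc fun i j => w j i) y₁ y₂ y₃ μ' ν' A' B' Γ' D') {τ u : ℝ}
    (hτ : τ ∈ Set.Ioo 0 (W₂ / 2)) (hτ' : ℘'[L] (τ : ℝ) ≠ 0) (hu : ℘[L] (τ : ℝ) = u)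
    (hX : IsParameter A B Γ D (doubleRoot w y₁) u) :
    ∃ σ : ℂ, σ ^ 2 = 1 ∧ ∀ ω, linP h₁ h₂ Γ D ω ≠ 0 →
      linP h₁ h₂ Γ' D' (ω - (W₂ / 2 - τ : ℝ)) ≠ 0 →
      wker w (mobP h₁ h₂ A B Γ D ω) (mobP h₁ h₂ A' B' Γ' D' (ω - (W₂ / 2 - τ : ℝ))) = 0 ∧
      deriv (mobP h₁ h₂ A B Γ D) ω = 2 * σ *
        wkerY w (mobP h₁ h₂ A B Γ D ω) (mobP h₁ h₂ A' B' Γ' D' (ω - (W₂ / 2 - τ : ℝ))) := by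
  have hdet := hx.unif.det_neg.ne
  have hby := hy.branched
  set h : ℂ := ((W₂ / 2 - τ : ℝ) : ℂ) with hh
  set ω₀ : ℂ := ((W₂ - τ : ℝ) : ℂ) with hω₀
  have hτL : ((τ : ℝ) : ℂ) ∉ (L).lattice :=
    notMem_rect_of_re h₁ h₂ (by simpa using hτ.1) (by simp; linarith [hτ.2])
  have hω₀L : ω₀ ∉ (L).lattice :=
    notMem_rect_of_re h₁ h₂ (by simp [hω₀]; linarith [hτ.2]) (by simp [hω₀]; linarith [hτ.1])
  have hsub : ω₀ - -((τ : ℝ) : ℂ) ∈ (L).lattice :=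
    (mem_rect h₁ h₂).2 ⟨0, 1, by simp [hω₀], by simp [hω₀]⟩
  have hP₀ : ℘[L] ω₀ = u := by
    rw [weierstrassP_eq_of_sub_mem h₁ h₂ hsub, (L).weierstrassP_neg, hu]
  have hP₀' : ℘'[L] ω₀ ≠ 0 := by
    intro h0
    have h3 := two_mul_mem_lattice_of_derivWeierstrassP_eq_zero (L) hω₀L h0
    refine hτ' (derivWeierstrassP_half (L) ?_)
    have e : 2 * ((τ : ℝ) : ℂ) = 2 * (ω₀ - -((τ : ℝ) : ℂ)) - 2 * ω₀ := by ring
    rw [e]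
    refine sub_mem ?_ h3
    rw [two_mul]
    exact add_mem hsub hsub
  have hmid : ω₀ - h = half₁ h₁ h₂ := by
    rw [hω₀, hh, half₁, ← Complex.ofReal_sub]
    congr 1
    ring
  -- the values of `y` and of its derivative at the base point
  obtain ⟨hd', hy0⟩ := IsCoordinate.mobP_eq_of_mobInv (t := y₁) hy.isMobius.det_ne
    (half₁_notMem h₁ h₂) (hy.unif.lin_ne_zero hby hby.neg_one_lt.le
      (by linarith [hby.lt₁₂, hby.lt_one, hby.one_lt])) (by rw [weierstrassP_half₁, hy.e₁])
  have hdy : deriv (mobP h₁ h₂ A' B' Γ' D') (half₁ h₁ h₂) = 0 := by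
    rw [(hasDerivAt_mobP h₁ h₂ A' B' (half₁_notMem h₁ h₂) hd').deriv,
      derivWeierstrassP_half (L) (two_half₁_mem h₁ h₂)]
    simp
  set α := (wcoeff (fun i j => w j i) 1).eval y₁ with hα
  set β := -y₁ + (wcoeff (fun i j => w j i) 0).eval y₁ with hβ
  set γ := (wcoeff (fun i j => w j i) (-1)).eval y₁ with hγ
  have hdisc : β ^ 2 - 4 * α * γ = 0 := by
    rw [hα, hβ, hγ, ← eval_wdisc, hby.eval_eq_zero_iff]; simp
  by_cases hα0 : α = 0
  · -- the inverse of `x` has a simple zero at the base point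
    have hβ0 : β = 0 := by rw [hα0] at hdisc; simpa using hdisc
    have hX' : doubleRoot w y₁ = OnePoint.infty := if_pos hα0
    rw [hX'] at hX
    have hΓ : Γ * u + D = 0 := hX
    have hden : linP h₁ h₂ Γ D ω₀ = 0 := by
      rw [linP_of_notMem h₁ h₂ hω₀L, hP₀]
      exact_mod_cast hΓ
    have hnum : linP h₁ h₂ A B ω₀ ≠ 0 :=
      (linP_ne_zero_or h₁ h₂ hdet ω₀).resolve_right (not_not.2 hden)
    have hξ0 : mobP h₁ h₂ Γ D A B ω₀ = 0 := by rw [mobP, hden, zero_div]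
    have hd0 := hasDerivAt_mobP h₁ h₂ Γ D hω₀L hnum
    have hderiv : (Γ * B - D * A : ℂ) * ℘'[L] ω₀ / linP h₁ h₂ A B ω₀ ^ 2 ≠ 0 := by
      refine div_ne_zero (mul_ne_zero ?_ hP₀') (pow_ne_zero _ hnum)
      have : Γ * B - D * A ≠ 0 := fun h0 => hdet (by linarith)
      exact_mod_cast this
    have hne := hd0.eventually_ne (c := 0) hderiv
    have hg := hy.isMobius
    rw [← wdisc_transpose_reflect] at hg
    obtain ⟨σ, hσ, hev⟩ := exists_eventually_wker_eq_zero (h := h) hx.isMobius.reflect hg hnum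
      (by rw [hmid]; exact hd') (by
        rw [hmid, hy0, hξ0]
        simp only [wker, aeval_wcoeff]
        simp only [hα, eval_wcoeff] at hα0
        have := congrArg (fun r : ℝ => (r : ℂ)) hα0
        push_cast at this
        simp only [neg_neg, neg_zero]
        linear_combination this) (by
        rw [hmid, hy0, hξ0]
        simp only [wkerY, aeval_wcoeff]
        simp only [hβ, eval_wcoeff] at hβ0
        have := congrArg (fun r : ℝ => (r : ℂ)) hβ0
        push_cast at this
        simp only [neg_zero]
        linear_combination this) (by rw [hmid]; exact hdy)
    refine ⟨-σ, by rw [neg_sq, hσ], fun ω hω hω' => wker_eq_zero_of_eventually (ω₀ := ω₀) ?_ hω hω'⟩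
    filter_upwards [hne, nhdsWithin_le_nhds hev,
      nhdsWithin_le_nhds (eventually_linP_ne_zero h₁ h₂ hnum)] with ω h3 h4 h5
    have hinv : mobP h₁ h₂ A B Γ D = fun ω => (mobP h₁ h₂ Γ D A B ω)⁻¹ :=
      funext fun ω => (mobP_inv h₁ h₂ Γ D A B ω).symm
    rw [hinv]
    refine ⟨?_, ?_⟩
    · simp only
      rw [wker_reflect w h3, h4.1, zero_div]
    · rw [deriv_fun_inv'' (analyticAt_mobP h₁ h₂ Γ D h5).differentiableAt h3]
      simp only
      rw [wkerY_reflect w h3, h4.2]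
      ring
  · obtain ⟨v, hv⟩ : ∃ v, v = -β / (2 * α) := ⟨_, rfl⟩
    have hX' : doubleRoot w y₁ = (v : OnePoint ℝ) := by rw [hv]; exact if_neg hα0
    rw [hX'] at hX
    obtain ⟨hlin, hvu⟩ : A - Γ * v ≠ 0 ∧ mobInv A B Γ D v = u := hX
    have hv1 : 2 * α * v + β = 0 := by rw [hv]; field_simp; ring
    have hv2 : α * v ^ 2 + β * v + γ = 0 := by
      have : 4 * α * (α * v ^ 2 + β * v + γ) = 0 := by
        linear_combination (2 * α * v + β) * hv1 - hdisc
      exact (mul_eq_zero.1 this).resolve_left (mul_ne_zero four_ne_zero hα0)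
    obtain ⟨hd, hx0⟩ := IsCoordinate.mobP_eq_of_mobInv hx.isMobius.det_ne hω₀L hlin
      (by rw [hP₀, hvu])
    obtain ⟨σ, hσ, hev⟩ := exists_eventually_wker_eq_zero (h := h) hx.isMobius hy.isMobius hd
      (by rw [hmid]; exact hd') (by
        rw [hmid, hy0, hx0, ← wker_transpose, wker]
        simp only [aeval_ofReal_eq]
        rw [← hα, ← hγ]
        have := congrArg (fun r : ℝ => (r : ℂ)) hv2
        rw [hβ] at this
        push_cast at this
        exact this) (by
        rw [hmid, hy0, hx0, wkerY]
        simp only [aeval_ofReal_eq]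
        rw [← hα]
        have := congrArg (fun r : ℝ => (r : ℂ)) hv1
        rw [hβ] at this
        push_cast at this
        exact this) (by rw [hmid]; exact hdy)
    exact ⟨σ, hσ, fun ω hω hω' =>
      wker_eq_zero_of_eventually (ω₀ := ω₀) (nhdsWithin_le_nhds hev) hω hω'⟩

end Uniformization

/-! ### The two domains overlap -/

section Overlap

variable {W₁ W₂ : ℝ} {h₁ : 0 < W₁} {h₂ : 0 < W₂} {w : ℤ → ℤ → ℝ} {A B Γ D A' B' Γ' D' : ℝ}

local notation "L" => rectPair h₁ h₂

lemma height_reflect_mid (u s : ℝ) : height h₁ h₂ A B Γ D ⟨W₂ / 2 - u, s⟩ =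
    height h₁ h₂ A B Γ D ⟨W₂ / 2 + u, s⟩ := by
  rw [← height_reflect]
  congr 2
  ring

lemma height_abs_mid (u s : ℝ) : height h₁ h₂ A B Γ D ⟨W₂ / 2 + |u|, s⟩ =
    height h₁ h₂ A B Γ D ⟨W₂ / 2 + u, s⟩ := by
  rcases abs_choice u with h | h <;> rw [h]
  rw [← height_reflect_mid, sub_eq_add_neg, neg_neg]

variable {x₁ x₂ x₃ μ ν y₁ y₂ y₃ μ' ν' : ℝ}

lemma IsCoordinate.height_neg_iff_abs_lt (hw : IsWeight w)
    (h : IsCoordinate h₁ h₂ (wdisc w) x₁ x₂ x₃ μ ν A B Γ D) {ℓ s u : ℝ}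
    (hℓ : ℓ ∈ Set.Ioo 0 (W₂ / 2)) (h0 : height h₁ h₂ A B Γ D ⟨W₂ / 2 + ℓ, s⟩ = 0)
    (hu : |u| ≤ W₂ / 2) : height h₁ h₂ A B Γ D ⟨W₂ / 2 + u, s⟩ < 0 ↔ |u| < ℓ := by
  rw [← height_abs_mid]
  constructor
  · intro h3
    by_contra hn
    rcases eq_or_lt_of_le (not_lt.1 hn) with h4 | h4
    · rw [← h4, h0] at h3
      exact lt_irrefl _ h3
    · exact (h.height_neg_of_lt hw hℓ.1.le h4 hu h3.le).ne h0
  · exact fun h3 => h.height_neg_of_lt hw (abs_nonneg u) h3 hℓ.2.le h0.le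

/-- At half the imaginary period, the coordinate is finite and lies between the second and the
third branch point. -/
lemma IsCoordinate.exists_mobP_horizontal {p : ℝ[X]}
    (h : IsCoordinate h₁ h₂ p x₁ x₂ x₃ μ ν A B Γ D) (t : ℝ) :
    ∃ r ∈ Set.Icc x₂ x₃, linP h₁ h₂ Γ D ⟨t, W₁ / 2⟩ ≠ 0 ∧
      mobP h₁ h₂ A B Γ D ⟨t, W₁ / 2⟩ = r := by
  have hb := h.branched
  have := hb.neg_one_lt; have := hb.lt₁₂; have := hb.lt_one; have := hb.one_lt
  obtain ⟨t', ht'⟩ : ∃ t', t' = t - ⌊t / W₂⌋ * W₂ := ⟨_, rfl⟩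
  have hmem : (⟨t, W₁ / 2⟩ : ℂ) - ⟨t', W₁ / 2⟩ ∈ (L).lattice :=
    (mem_rect h₁ h₂).2 ⟨0, ⌊t / W₂⌋, by simp [ht'], by simp⟩
  rw [mobP, linP_eq_of_sub_mem h₁ h₂ _ _ hmem, linP_eq_of_sub_mem h₁ h₂ _ _ hmem]
  have h0 : 0 ≤ t' := by
    have := Int.floor_le (t / W₂)
    rw [le_div_iff₀ h₂] at this
    linarith
  have h1 : t' < W₂ := by
    have := Int.lt_floor_add_one (t / W₂)
    rw [div_lt_iff₀ h₂] at this
    linarith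
  rcases eq_or_lt_of_le h0 with h3 | h3
  · refine ⟨x₃, ⟨by linarith, le_rfl⟩, ?_⟩
    have e : (⟨t', W₁ / 2⟩ : ℂ) = half₃ h₁ h₂ := by rw [← h3, half₃]
    rw [e]
    exact IsCoordinate.mobP_eq_of_mobInv h.isMobius.det_ne (half₃_notMem h₁ h₂)
      (h.unif.lin_ne_zero hb (by linarith) le_rfl) (by rw [weierstrassP_half₃, h.e₃])
  · exact h.exists_mobP_top ⟨h3, h1⟩

lemma deriv_mobP_sub {l : ℂ} (hl : l ∈ (L).lattice) (ω : ℂ) :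
    deriv (mobP h₁ h₂ A B Γ D) (l - ω) = -deriv (mobP h₁ h₂ A B Γ D) ω := by
  have e : mobP h₁ h₂ A B Γ D = fun ω => mobP h₁ h₂ A B Γ D (l - ω) := by
    funext ω
    have hm : l - ω - -ω ∈ (L).lattice := by simpa using hl
    rw [mobP, mobP, linP_eq_of_sub_mem h₁ h₂ _ _ hm, linP_eq_of_sub_mem h₁ h₂ _ _ hm, linP_neg,
      linP_neg]
  have h3 := deriv_comp_const_sub (mobP h₁ h₂ A B Γ D) l ω
  rw [← e] at h3
  rw [h3, neg_neg]

/-- The position of the two real zeros in `y` of `K(1, y)` with respect to `1`. -/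
lemma lt_one_iff_of_wker (hw : IsWeight w) {r q : ℝ} (hr : 0 < r) (hq : q ≠ 0)
    (hK : wker w 1 r = 0) (hKy : wkerY w 1 r = q) : q < 0 ↔ r < 1 := by
  have ha := eval_wcoeff_pos hw one_pos (j := 1) (by simp)
  have hc := eval_wcoeff_pos hw one_pos (j := -1) (by simp)
  have hsum : (wcoeff w 1).eval 1 + (-1 + (wcoeff w 0).eval 1) + (wcoeff w (-1)).eval 1 < 0 := by
    simp only [eval_wcoeff]
    have := hw.sum_lt; have := hw.zero
    linarith
  have e : ∀ p : ℝ[X], aeval (1 : ℂ) p = (p.eval 1 : ℝ) := fun p => by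
    rw [← aeval_ofReal_eq]; simp
  rw [wker, e, e, e] at hK
  rw [wkerY, e, e] at hKy
  set α := (wcoeff w 1).eval 1
  set β := (wcoeff w 0).eval 1
  set γ := (wcoeff w (-1)).eval 1
  have hK' : α * r ^ 2 + (-1 + β) * r + γ = 0 := by exact_mod_cast hK
  have hKy' : 2 * α * r + (-1 + β) = q := by exact_mod_cast hKy
  have h3 : q * r = α * r ^ 2 - γ := by rw [← hKy']; linear_combination hK'
  have h4 : (r - 1) * (γ - α * r) < 0 := by nlinarith
  constructor
  · intro h5
    by_contra h6
    have h7 : α * r ^ 2 < γ := by nlinarith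
    nlinarith [mul_nonneg (sub_nonneg.2 (not_lt.1 h6)) (by nlinarith : 0 ≤ γ - α * r)]
  · intro h5
    have h6 : 0 < γ - α * r := by
      by_contra hn
      nlinarith [mul_nonneg_of_nonpos_of_nonpos (sub_neg.2 h5).le (not_lt.1 hn)]
    rcases lt_or_gt_of_ne hq with h7 | h7
    · exact h7
    · nlinarith [mul_pos h7 hr, mul_pos (mul_pos ha hr) (sub_pos.2 h5)]

/-- On the line at half the imaginary period, where everything is real, the right end of the domain
of `x` lies in the domain of `y`. -/
lemma overlap_base (hw : IsWeight w) (hx : IsCoordinate h₁ h₂ (wdisc w) x₁ x₂ x₃ μ ν A B Γ D)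
    (hy : IsCoordinate h₁ h₂ (wdisc fun i j => w j i) y₁ y₂ y₃ μ' ν' A' B' Γ' D') {h : ℝ}
    (hh : h ∈ Set.Ioo 0 (W₂ / 2)) {σ : ℂ} (hσ : σ ^ 2 = 1)
    (hK : ∀ ω, linP h₁ h₂ Γ D ω ≠ 0 → linP h₁ h₂ Γ' D' (ω - h) ≠ 0 →
      wker w (mobP h₁ h₂ A B Γ D ω) (mobP h₁ h₂ A' B' Γ' D' (ω - h)) = 0 ∧
      deriv (mobP h₁ h₂ A B Γ D) ω = 2 * σ *
        wkerY w (mobP h₁ h₂ A B Γ D ω) (mobP h₁ h₂ A' B' Γ' D' (ω - h)))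
    {ℓ : ℝ} (hℓ : ℓ ∈ Set.Ioo 0 (W₂ / 2))
    (h0 : height h₁ h₂ A B Γ D ⟨W₂ / 2 + ℓ, W₁ / 2⟩ = 0) :
    height h₁ h₂ A' B' Γ' D' ⟨W₂ / 2 + (ℓ - h), W₁ / 2⟩ < 0 := by
  -- the relation between the signs of `x'` and `|y| - 1` where `x = 1`
  have key : ∀ t q : ℝ, q ≠ 0 → height h₁ h₂ A B Γ D ⟨t, W₁ / 2⟩ = 0 →
      deriv (mobP h₁ h₂ A B Γ D) ⟨t, W₁ / 2⟩ = 2 * σ * q →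
      (q < 0 ↔ height h₁ h₂ A' B' Γ' D' ⟨t - h, W₁ / 2⟩ < 0) := by
    intro t q hq ht hder
    obtain ⟨r, hr, hd, hxr⟩ := hx.exists_mobP_horizontal t
    obtain ⟨r', hr', hd', hyr⟩ := hy.exists_mobP_horizontal (t - h)
    have e : (⟨t, W₁ / 2⟩ : ℂ) - h = ⟨t - h, W₁ / 2⟩ := by apply Complex.ext <;> simp
    have hr1 : r = 1 := by
      obtain ⟨-, hn⟩ := (height_eq_zero_iff hx.isMobius.det_ne _).1 ht
      rw [hxr, Complex.norm_real, Real.norm_eq_abs,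
        abs_of_pos (hx.branched.pos.trans_le hr.1)] at hn
      exact hn
    have hr'pos : 0 < r' := hy.branched.pos.trans_le hr'.1
    obtain ⟨k1, k2⟩ := hK ⟨t, W₁ / 2⟩ hd (by rw [e]; exact hd')
    rw [e, hxr, hyr, hr1, Complex.ofReal_one] at k1 k2
    have hσ0 : σ ≠ 0 := by rintro rfl; norm_num at hσ
    have k3 : wkerY w 1 r' = q := by
      rw [hder] at k2
      exact (mul_left_cancel₀ (mul_ne_zero two_ne_zero hσ0) k2).symm
    rw [lt_one_iff_of_wker hw hr'pos hq k1 k3, height_neg_iff hy.isMobius.det_ne, hyr,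
      Complex.norm_real, Real.norm_eq_abs, abs_of_pos hr'pos]
    exact ⟨fun h5 => ⟨hd', h5⟩, fun h5 => h5.2⟩
  have h0' : height h₁ h₂ A B Γ D ⟨W₂ / 2 - ℓ, W₁ / 2⟩ = 0 := by rw [height_reflect_mid, h0]
  obtain ⟨q, hq, hq'⟩ := hx.deriv_mobP_top (t := W₂ / 2 - ℓ) ⟨by linarith [hℓ.2], by linarith [hℓ.1]⟩
  have hqR : deriv (mobP h₁ h₂ A B Γ D) ⟨W₂ / 2 + ℓ, W₁ / 2⟩ = (-q : ℝ) := by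
    have hl : (⟨W₂, W₁⟩ : ℂ) ∈ (L).lattice := (mem_rect h₁ h₂).2 ⟨1, 1, by simp, by simp⟩
    have e : (⟨W₂ / 2 + ℓ, W₁ / 2⟩ : ℂ) = ⟨W₂, W₁⟩ - ⟨W₂ / 2 - ℓ, W₁ / 2⟩ := by
      apply Complex.ext <;> simp <;> ring
    rw [e, deriv_mobP_sub hl, hq']
    push_cast
    rfl
  have eL : W₂ / 2 - ℓ - h = W₂ / 2 - (ℓ + h) := by ring
  have eR : W₂ / 2 + ℓ - h = W₂ / 2 + (ℓ - h) := by ring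
  have hσ' : σ = 1 ∨ σ = -1 := by
    rcases sq_eq_sq_iff_eq_or_eq_neg.1 (show σ ^ 2 = 1 ^ 2 by rw [hσ]; norm_num) with h | h
    exacts [Or.inl h, Or.inr h]
  rcases hσ' with rfl | rfl
  · -- this sign would require the domain of `y` to contain the left end but not the right one
    have hL := key (W₂ / 2 - ℓ) (q / 2) (by linarith) h0' (by rw [hq']; push_cast; ring)
    have hR := key (W₂ / 2 + ℓ) (-q / 2) (by linarith) h0 (by rw [hqR]; push_cast; ring)
    rw [eL, height_reflect_mid] at hL
    rw [eR] at hR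
    have hL' := hL.1 (by linarith)
    exfalso
    have hu0 : |ℓ - h| < ℓ + h := by
      rw [abs_lt]; constructor <;> linarith [hℓ.1, hh.1]
    have hneg : height h₁ h₂ A' B' Γ' D' ⟨W₂ / 2 + |ℓ - h|, W₁ / 2⟩ < 0 := by
      rcases le_total (ℓ + h) (W₂ / 2) with h5 | h5
      · exact hy.height_neg_of_lt hw.transpose (abs_nonneg _) hu0 h5 hL'.le
      · refine hy.height_neg_of_lt hw.transpose (u := W₂ - (ℓ + h)) (abs_nonneg _) ?_
          (by linarith) ?_
        · rw [abs_lt]; constructor <;> linarith [hℓ.2, hh.2]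
        · rw [← height_reflect_mid]
          have e : W₂ / 2 - (W₂ - (ℓ + h)) + W₂ = W₂ / 2 + (ℓ + h) := by ring
          rw [← height_add_period, e]
          exact hL'.le
    rw [height_abs_mid] at hneg
    linarith [hR.2 hneg]
  · have hR := key (W₂ / 2 + ℓ) (q / 2) (by linarith) h0 (by rw [hqR]; push_cast; ring)
    rw [eR] at hR
    exact hR.1 (by linarith)

/-- On each horizontal line, the right end of the domain of `x` lies in the domain of `y`. -/
theorem overlap (hw : IsWeight w) (hx : IsCoordinate h₁ h₂ (wdisc w) x₁ x₂ x₃ μ ν A B Γ D)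
    (hy : IsCoordinate h₁ h₂ (wdisc fun i j => w j i) y₁ y₂ y₃ μ' ν' A' B' Γ' D') {h : ℝ}
    (hh : h ∈ Set.Ioo 0 (W₂ / 2)) {σ : ℂ} (hσ : σ ^ 2 = 1)
    (hK : ∀ ω, linP h₁ h₂ Γ D ω ≠ 0 → linP h₁ h₂ Γ' D' (ω - h) ≠ 0 →
      wker w (mobP h₁ h₂ A B Γ D ω) (mobP h₁ h₂ A' B' Γ' D' (ω - h)) = 0 ∧
      deriv (mobP h₁ h₂ A B Γ D) ω = 2 * σ *
        wkerY w (mobP h₁ h₂ A B Γ D ω) (mobP h₁ h₂ A' B' Γ' D' (ω - h)))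
    {ℓ : ℝ → ℝ} (hc : Continuous ℓ) (hℓ : ∀ s, ℓ s ∈ Set.Ioo 0 (W₂ / 2))
    (h0 : ∀ s, height h₁ h₂ A B Γ D ⟨W₂ / 2 + ℓ s, s⟩ = 0) (s : ℝ) :
    height h₁ h₂ A' B' Γ' D' ⟨W₂ / 2 + (ℓ s - h), s⟩ < 0 := by
  have hcont : Continuous fun s => height h₁ h₂ A' B' Γ' D' ⟨W₂ / 2 + (ℓ s - h), s⟩ :=
    (continuous_height hy.isMobius.det_ne).comp (continuous_complex_mk.comp
      (by fun_prop : Continuous fun s : ℝ => (W₂ / 2 + (ℓ s - h), s)))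
  have hne : ∀ s, height h₁ h₂ A' B' Γ' D' ⟨W₂ / 2 + (ℓ s - h), s⟩ ≠ 0 := by
    intro s hs
    obtain ⟨hd, hn⟩ := (height_eq_zero_iff hx.isMobius.det_ne _).1 (h0 s)
    obtain ⟨hd', hn'⟩ := (height_eq_zero_iff hy.isMobius.det_ne _).1 hs
    have e : (⟨W₂ / 2 + ℓ s, s⟩ : ℂ) - h = ⟨W₂ / 2 + (ℓ s - h), s⟩ := by
      apply Complex.ext <;> simp; ring
    have h3 := (hK ⟨W₂ / 2 + ℓ s, s⟩ hd (by rw [e]; exact hd')).1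
    rw [e] at h3
    exact wker_ne_zero_of_norm_eq_one hw hn hn' h3
  have hbase := overlap_base hw hx hy hh hσ hK (hℓ (W₁ / 2)) (h0 (W₁ / 2))
  by_contra hpos
  obtain ⟨t, ht⟩ := mem_range_of_exists_le_of_exists_ge hcont ⟨_, hbase.le⟩ ⟨s, not_lt.1 hpos⟩
  exact hne t ht

end Overlap

/-! ### Domains between two graphs -/

lemma isSimplyConnected_between {m M : ℝ → ℝ} (hm : Continuous m) (hM : Continuous M)
    (hlt : ∀ s, m s < M s) : IsSimplyConnected {ω : ℂ | m ω.im < ω.re ∧ ω.re < M ω.im} := by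
  have hpos : ∀ s, 0 < M s - m s := fun s => sub_pos.2 (hlt s)
  -- straightening of the domain to a strip
  let e : ℝ × ℝ ≃ₜ ℂ :=
    { toFun := fun v => ⟨m v.2 + v.1 * (M v.2 - m v.2), v.2⟩
      invFun := fun ω => ((ω.re - m ω.im) / (M ω.im - m ω.im), ω.im)
      left_inv := fun v => by
        have := (hpos v.2).ne'
        ext <;> simp
        field_simp
      right_inv := fun ω => by
        have := (hpos ω.im).ne'
        apply Complex.ext <;> simp
        field_simp
        ring
      continuous_toFun := continuous_complex_mk.comp
        (by fun_prop : Continuous fun v : ℝ × ℝ => (m v.2 + v.1 * (M v.2 - m v.2), v.2))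
      continuous_invFun := by
        have h1 : Continuous fun ω : ℂ => m ω.im := hm.comp Complex.continuous_im
        have h2 : Continuous fun ω : ℂ => M ω.im := hM.comp Complex.continuous_im
        exact ((Complex.continuous_re.sub h1).div (h2.sub h1) fun ω => (hpos _).ne').prodMk
          Complex.continuous_im }
  have himage : {ω : ℂ | m ω.im < ω.re ∧ ω.re < M ω.im} =
      e '' (Set.Ioo (0 : ℝ) 1 ×ˢ (Set.univ : Set ℝ)) := by
    rw [e.image_eq_preimage_symm]
    ext ω
    have := hpos ω.im
    change _ ↔ (ω.re - m ω.im) / (M ω.im - m ω.im) ∈ Set.Ioo (0 : ℝ) 1 ∧ _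
    simp only [Set.mem_ofPred_eq, Set.mem_Ioo, Set.mem_univ, and_true]
    rw [lt_div_iff₀ this, div_lt_iff₀ this]
    constructor <;> rintro ⟨h1, h2⟩ <;> constructor <;> linarith
  rw [himage, e.isSimplyConnected_image]
  have hconv : Convex ℝ (Set.Ioo (0 : ℝ) 1 ×ˢ (Set.univ : Set ℝ)) :=
    (convex_Ioo 0 1).prod convex_univ
  have : ContractibleSpace (Set.Ioo (0 : ℝ) 1 ×ˢ (Set.univ : Set ℝ) : Set (ℝ × ℝ)) :=
    hconv.contractibleSpace ⟨(1 / 2, 0), by norm_num⟩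
  exact SimplyConnectedSpace.ofContractible _

/-! ### The uniformization of the kernel curve -/

section Continuation

variable {S : Finset (ℤ × ℤ)} {z : ℝ}

lemma mem_strip_iff {W₁ W₂ : ℝ} (h₁ : 0 < W₁) (e₁ : ω₁ S z = Complex.I * W₁) (e₂ : ω₂ S z = W₂)
    (r : ℝ) (ω : ℂ) : ω ∈ strip S z r ↔ r < ω.re ∧ ω.re < r + W₂ := by
  rw [strip, e₁, e₂]
  constructor
  · rintro ⟨s, t, h3, h4, rfl⟩
    simp
    exact ⟨h3, h4⟩
  · rintro ⟨h3, h4⟩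
    refine ⟨ω.im / W₁, ω.re - r, by linarith, by linarith, ?_⟩
    apply Complex.ext
    · simp
    · simp
      field_simp

/-- The part of a strip of width `W₂` where a coordinate has modulus less than one is the set of
points at distance less than the half-width `ℓ` from the middle line. -/
lemma IsCoordinate.mem_domain_iff {W₁ W₂ : ℝ} {h₁ : 0 < W₁} {h₂ : 0 < W₂} {w : ℤ → ℤ → ℝ}
    {A B Γ D x₁ x₂ x₃ μ ν : ℝ} (hw : IsWeight w)
    (hx : IsCoordinate h₁ h₂ (wdisc w) x₁ x₂ x₃ μ ν A B Γ D) {ℓ : ℝ → ℝ}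
    (hℓ : ∀ s, ℓ s ∈ Set.Ioo 0 (W₂ / 2))
    (h0 : ∀ s, height h₁ h₂ A B Γ D ⟨W₂ / 2 + ℓ s, s⟩ = 0) (ω : ℂ) :
    ((0 < ω.re ∧ ω.re < W₂) ∧ ∃ u : ℂ,
      (if linP h₁ h₂ Γ D ω = 0 then OnePoint.infty
        else ((mobP h₁ h₂ A B Γ D ω : ℂ) : OnePoint ℂ)) = u ∧ ‖u‖ < 1) ↔
      |ω.re - W₂ / 2| < ℓ ω.im := by
  have hex : (∃ u : ℂ, (if linP h₁ h₂ Γ D ω = 0 then OnePoint.infty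
      else ((mobP h₁ h₂ A B Γ D ω : ℂ) : OnePoint ℂ)) = u ∧ ‖u‖ < 1) ↔
      height h₁ h₂ A B Γ D ω < 0 := by
    rw [height_neg_iff hx.isMobius.det_ne]
    split_ifs with h
    · simp [h]
    · simp [h]
  have e : (⟨W₂ / 2 + (ω.re - W₂ / 2), ω.im⟩ : ℂ) = ω := by apply Complex.ext <;> simp
  have key := fun hu => hx.height_neg_iff_abs_lt hw (u := ω.re - W₂ / 2) (hℓ ω.im) (h0 ω.im) hu
  rw [e] at key
  rw [hex]
  constructor
  · rintro ⟨⟨h3, h4⟩, h5⟩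
    exact (key (abs_le.2 ⟨by linarith, by linarith⟩)).1 h5
  · intro h3
    have h4 := h3.trans (hℓ ω.im).2
    have h5 := abs_lt.1 h4
    exact ⟨⟨by linarith, by linarith⟩, (key h4.le).2 h3⟩

/-- The coordinates `x(ω)` and `y(ω)` are given by meromorphic functions `f` and `g`; the domains
`Δ_x` and `Δ_y` are neighbourhoods of two vertical lines at distance `h`, of half-widths `ℓ` and
`ℓ'`, on which `f` and `g` are holomorphic; and the kernel vanishes at `(f, g)` on their
intersection. -/
theorem exists_uniformization
    (hsmall : ∀ s ∈ S, (-1 ≤ s.1 ∧ s.1 ≤ 1) ∧ (-1 ≤ s.2 ∧ s.2 ≤ 1) ∧ s ≠ (0, 0))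
    (hnonsing : ∀ α β : ℝ, (α, β) ≠ (0, 0) → ∃ s ∈ S, α * s.1 + β * s.2 < 0)
    (hz : 0 < z) (hz' : S.card * z < 1) :
    ∃ (f g : ℂ → ℂ) (c h : ℝ) (ℓ ℓ' : ℝ → ℝ), Meromorphic f ∧ Meromorphic g ∧
      (∀ ω, val (x S z ω) = f ω) ∧ (∀ ω, val (y S z ω) = g ω) ∧
      Continuous ℓ ∧ Continuous ℓ' ∧ (∀ s, |ℓ s - h| < ℓ' s) ∧ 0 < h ∧ (∀ s, 0 < ℓ s) ∧
      (∀ ω, ω ∈ Δx S z ↔ |ω.re - c| < ℓ ω.im) ∧ (∀ ω, ω ∈ Δy S z ↔ |ω.re - (c + h)| < ℓ' ω.im) ∧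
      (∀ ω ∈ Δx S z, AnalyticAt ℂ f ω ∧ ‖f ω‖ < 1) ∧
      (∀ ω ∈ Δy S z, AnalyticAt ℂ g ω ∧ ‖g ω‖ < 1) ∧
      ∀ ω ∈ Δx S z, ω ∈ Δy S z → K S z (f ω) (g ω) = 0 := by
  have hS : ∀ s ∈ S, (-1 ≤ s.1 ∧ s.1 ≤ 1) ∧ (-1 ≤ s.2 ∧ s.2 ≤ 1) := fun s hs =>
    ⟨(hsmall s hs).1, (hsmall s hs).2.1⟩
  have hw := isWeight_walkWeight hsmall hnonsing hz hz'
  have hw' := hw.transpose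
  obtain ⟨x₁, x₂, x₃, μ, ν, bx, -⟩ := exists_isBranched hw
  obtain ⟨y₁, y₂, y₃, μ', ν', bY, hpos⟩ := exists_isBranched hw'
  obtain ⟨W₁, W₂, h₁, h₂, A, B, Γ, D, A', B', Γ', D', i₁, i₂, hx, hy⟩ := exists_isCoordinate bx bY
  obtain ⟨τ, hτ, i₃, hτ', u, hu, hX⟩ := exists_thirdPeriod hw hx bY hpos
  obtain ⟨σ, hσ, hK⟩ := exists_wker_eq_zero hx hy hτ hτ' hu hX
  obtain ⟨ℓ, hc, hℓ, h0⟩ := hx.exists_halfWidth hw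
  obtain ⟨ℓ', hc', hℓ', h0'⟩ := hy.exists_halfWidth hw'
  obtain ⟨h, hh⟩ : ∃ h, h = W₂ / 2 - τ := ⟨_, rfl⟩
  rw [← hh] at hK i₃
  have hhI : h ∈ Set.Ioo 0 (W₂ / 2) := ⟨by linarith [hτ.2], by linarith [hτ.1]⟩
  have e₁ : ω₁ S z = Complex.I * W₁ := by
    rw [ω₁, d_eq_wdisc hS, bx.branch1_eq, bx.branch2_eq, i₁]
  have e₂ : ω₂ S z = W₂ := by rw [ω₂, d_eq_wdisc hS, bx.branch2_eq, bx.branch3_eq, i₂]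
  have e₃ : ω₃ S z = 2 * h := by
    have eX : Xy₁ S z = doubleRoot (walkWeight S z) y₁ := by
      rw [Xy₁, d'_eq_wdisc hS, bY.branch1_eq, a', b',
        wcoeff_walkWeight_transpose hS (by simp), wcoeff_walkWeight_transpose hS (by simp),
        doubleRoot]
      simp
    rw [ω₃, eX, d_eq_wdisc hS, bx.branch1_eq, i₃]
  have e₃' : ω₃ S z / 2 = h := by rw [e₃]; ring
  have e₃C : (ω₃ S z : ℂ) / 2 = h := by rw [e₃]; push_cast; ring
  have ex : ∀ ω, x S z ω = if linP h₁ h₂ Γ D ω = 0 then OnePoint.infty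
      else ((mobP h₁ h₂ A B Γ D ω : ℂ) : OnePoint ℂ) := fun ω => by
    rw [x, e₁, e₂, d_eq_wdisc hS, hx.gInv_wp]
  have ey : ∀ ω, y S z ω = if linP h₁ h₂ Γ' D' (ω - h) = 0 then OnePoint.infty
      else ((mobP h₁ h₂ A' B' Γ' D' (ω - h) : ℂ) : OnePoint ℂ) := fun ω => by
    rw [y, e₁, e₂, d'_eq_wdisc hS, e₃C, hy.gInv_wp]
  have hΔx : ∀ ω, ω ∈ Δx S z ↔ |ω.re - W₂ / 2| < ℓ ω.im := fun ω => by
    rw [← hx.mem_domain_iff hw hℓ (fun s => (h0 s).1) ω, Δx, Set.mem_ofPred_eq,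
      mem_strip_iff h₁ e₁ e₂, ex, zero_add]
  have hΔy : ∀ ω, ω ∈ Δy S z ↔ |ω.re - (W₂ / 2 + h)| < ℓ' ω.im := fun ω => by
    have h3 := hy.mem_domain_iff hw' hℓ' (fun s => (h0' s).1) (ω - h)
    simp only [Complex.sub_re, Complex.sub_im, Complex.ofReal_re, Complex.ofReal_im, sub_zero,
      sub_pos] at h3
    rw [Δy, Set.mem_ofPred_eq, mem_strip_iff h₁ e₁ e₂, ey, e₃', ← sub_sub, sub_right_comm, ← h3,
      sub_lt_iff_lt_add']
  have hfin : ∀ ω ∈ Δx S z, linP h₁ h₂ Γ D ω ≠ 0 ∧ ‖mobP h₁ h₂ A B Γ D ω‖ < 1 := by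
    rintro ω ⟨-, u, h3, h4⟩
    rw [ex] at h3
    split_ifs at h3 with h5
    · exact absurd h3 (OnePoint.infty_ne_coe u)
    · rw [OnePoint.coe_injective h3]
      exact ⟨h5, h4⟩
  have hfin' : ∀ ω ∈ Δy S z, linP h₁ h₂ Γ' D' (ω - h) ≠ 0 ∧
      ‖mobP h₁ h₂ A' B' Γ' D' (ω - h)‖ < 1 := by
    rintro ω ⟨-, u, h3, h4⟩
    rw [ey] at h3
    split_ifs at h3 with h5
    · exact absurd h3 (OnePoint.infty_ne_coe u)
    · rw [OnePoint.coe_injective h3]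
      exact ⟨h5, h4⟩
  refine ⟨mobP h₁ h₂ A B Γ D, fun ω => mobP h₁ h₂ A' B' Γ' D' (ω - h), W₂ / 2, h, ℓ, ℓ',
    meromorphic_mobP, meromorphic_shift _, fun ω => ?_, fun ω => ?_, hc, hc', fun s => ?_, hhI.1,
    fun s => (hℓ s).1, hΔx, hΔy, fun ω hω => ⟨analyticAt_mobP h₁ h₂ A B (hfin ω hω).1,
    (hfin ω hω).2⟩, fun ω hω => ⟨analyticAt_shift (hfin' ω hω).1, (hfin' ω hω).2⟩,
    fun ω hω hω' => ?_⟩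
  -- at a pole both sides are the default value `0`
  · rw [ex]
    split_ifs with h3
    · simp [mobP, h3, val]
    · rfl
  · rw [ey]
    split_ifs with h3
    · simp [mobP, h3, val]
    · rfl
  · have h3 := overlap hw hx hy hhI hσ hK hc hℓ (fun s => (h0 s).1) s
    refine (hy.height_neg_iff_abs_lt hw' (hℓ' s) (h0' s).1 ?_).1 h3
    rw [abs_le]
    have := hℓ s
    constructor <;> linarith [this.1, this.2, hhI.1, hhI.2]
  · rw [K_eq_wker hS]
    exact (hK ω (hfin ω hω).1 (hfin' ω hω').1).1

/-! ### Analytic continuation -/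

/-- The function `u ↦ K(u, 0) Q(u, 0)` is holomorphic in the unit disc. -/
lemma analyticAt_K_mul_Q_left (hz : 0 < z) (hz' : S.card * z < 1) {u : ℂ} (hu : ‖u‖ < 1) :
    AnalyticAt ℂ (fun u => K S z u 0 * Q S z u 0) u := by
  have hQ : AnalyticAt ℂ (fun u => Q S z u 0) u :=
    (differentiableOn_Q_left hz hz').analyticAt (Metric.isOpen_ball.mem_nhds (by simpa using hu))
  have hK : AnalyticAt ℂ (fun u => K S z u 0) u := by
    unfold K
    fun_prop
  exact hK.mul hQ

/-- The function `u ↦ K(0, u) Q(0, u)` is holomorphic in the unit disc. -/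
lemma analyticAt_K_mul_Q_right (hz : 0 < z) (hz' : S.card * z < 1) {u : ℂ} (hu : ‖u‖ < 1) :
    AnalyticAt ℂ (fun u => K S z 0 u * Q S z 0 u) u := by
  have hQ : AnalyticAt ℂ (fun u => Q S z 0 u) u :=
    (differentiableOn_Q_right hz hz').analyticAt (Metric.isOpen_ball.mem_nhds (by simpa using hu))
  have hK : AnalyticAt ℂ (fun u => K S z 0 u) u := by
    unfold K
    fun_prop
  exact hK.mul hQ

lemma meromorphic_toMeromorphicNFAt {f : ℂ → ℂ} (hf : Meromorphic f) :
    Meromorphic fun ω => toMeromorphicNFAt f ω ω := by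
  have hf' : MeromorphicOn f Set.univ := fun ω _ => hf ω
  have h : (fun ω => toMeromorphicNFAt f ω ω) = toMeromorphicNFOn f Set.univ := by
    funext ω
    rw [toMeromorphicNFOn_eq_toMeromorphicNFAt hf' (Set.mem_univ ω)]
  rw [h]
  exact fun ω => (meromorphicNFOn_toMeromorphicNFOn f Set.univ).meromorphicOn ω (Set.mem_univ ω)

end Continuation

end QuarterPlane

end

theorem theorem3 (S : Finset (ℤ × ℤ))
    -- small steps
    (hsmall : ∀ s ∈ S, (-1 ≤ s.1 ∧ s.1 ≤ 1) ∧ (-1 ≤ s.2 ∧ s.2 ≤ 1) ∧ s ≠ (0, 0))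
    -- the model is non-singular: `S` lies in no closed half-plane bounded by a line through `0`
    (hnonsing : ∀ α β : ℝ, (α, β) ≠ (0, 0) → ∃ s ∈ S, α * s.1 + β * s.2 < 0)
    (z : ℝ) (hz : 0 < z) (hz' : z < 1 / (S.card : ℝ)) :
    -- `Δ` is a simply connected domain
    IsOpen (QuarterPlane.Δ S z) ∧ IsSimplyConnected (QuarterPlane.Δ S z) ∧
    -- `r_x` and `r_y` are well defined: both expressions hold, also on the overlap
    (∀ ω ∈ QuarterPlane.Δx S z,
      QuarterPlane.rx S z ω = QuarterPlane.liftX S z ω ∧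
      QuarterPlane.ry S z ω = -QuarterPlane.liftX S z ω
        + QuarterPlane.K S z 0 0 * QuarterPlane.Q S z 0 0 + QuarterPlane.xy S z ω) ∧
    (∀ ω ∈ QuarterPlane.Δy S z,
      QuarterPlane.ry S z ω = QuarterPlane.liftY S z ω ∧
      QuarterPlane.rx S z ω = -QuarterPlane.liftY S z ω
        + QuarterPlane.K S z 0 0 * QuarterPlane.Q S z 0 0 + QuarterPlane.xy S z ω) ∧
    -- they are meromorphic on `Δ`
    MeromorphicOn (QuarterPlane.rx S z) (QuarterPlane.Δ S z) ∧
    MeromorphicOn (QuarterPlane.ry S z) (QuarterPlane.Δ S z) ∧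
    -- and satisfy the functional equation there
    (∀ ω ∈ QuarterPlane.Δ S z,
      QuarterPlane.rx S z ω + QuarterPlane.ry S z ω
        - QuarterPlane.K S z 0 0 * QuarterPlane.Q S z 0 0 - QuarterPlane.xy S z ω = 0) := by
  have hcard : (0 : ℝ) < S.card := by
    by_contra hn
    rw [le_antisymm (not_lt.1 hn) (Nat.cast_nonneg _), div_zero] at hz'
    linarith
  have hzS : S.card * z < 1 := by
    rw [lt_div_iff₀ hcard] at hz'
    linarith
  obtain ⟨f, g, c, h, ℓ, ℓ', mf, mg, vx, vy, hc, hc', hov, hh, hℓ, hΔx, hΔy, af, ag, hK⟩ :=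
    QuarterPlane.exists_uniformization hsmall hnonsing hz hzS
  have hre := Complex.continuous_re
  have hℓi := hc.comp Complex.continuous_im
  have hℓi' := hc'.comp Complex.continuous_im
  have ox : IsOpen (QuarterPlane.Δx S z) := by
    have : QuarterPlane.Δx S z = {ω | |ω.re - c| < ℓ ω.im} := Set.ext hΔx
    rw [this]
    exact isOpen_lt (hre.sub continuous_const).abs hℓi
  have oy : IsOpen (QuarterPlane.Δy S z) := by
    have : QuarterPlane.Δy S z = {ω | |ω.re - (c + h)| < ℓ' ω.im} := Set.ext hΔy
    rw [this]
    exact isOpen_lt (hre.sub continuous_const).abs hℓi'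
  -- as the right end of each section of `Δx` lies in that of `Δy`, their union is an interval
  have hΔ : QuarterPlane.Δ S z = {ω : ℂ | min (c - ℓ ω.im) (c + h - ℓ' ω.im) < ω.re ∧
      ω.re < c + h + ℓ' ω.im} := by
    ext ω
    have h3 := abs_lt.1 (hov ω.im)
    have h4 := hℓ ω.im
    rw [QuarterPlane.Δ, Set.mem_union, hΔx, hΔy, Set.mem_ofPred_eq, min_lt_iff, abs_lt, abs_lt]
    constructor
    · rintro (h5 | h5)
      · exact ⟨Or.inl (by linarith [h5.1]), by linarith [h5.2]⟩
      · exact ⟨Or.inr (by linarith [h5.1]), by linarith [h5.2]⟩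
    · rintro ⟨h5 | h5, h6⟩
      · rcases lt_or_ge (ω.re - c) (ℓ ω.im) with h7 | h7
        · exact Or.inl ⟨by linarith, h7⟩
        · exact Or.inr ⟨by linarith, by linarith⟩
      · exact Or.inr ⟨by linarith, by linarith⟩
  -- the functional equation on the overlap
  have hfun : ∀ ω ∈ QuarterPlane.Δx S z, ω ∈ QuarterPlane.Δy S z →
      QuarterPlane.liftX S z ω + QuarterPlane.liftY S z ω =
        QuarterPlane.K S z 0 0 * QuarterPlane.Q S z 0 0 + QuarterPlane.xy S z ω := by
    intro ω hω hω'
    have h3 := QuarterPlane.K_mul_Q (fun s hs => ⟨(hsmall s hs).1.1, (hsmall s hs).2.1.1⟩) hz hzS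
      (af ω hω).2.le (ag ω hω').2.le
    have h4 : QuarterPlane.xy S z ω = f ω * g ω := by
      have ha : AnalyticAt ℂ (fun ω => f ω * g ω) ω := (af ω hω).1.mul (ag ω hω').1
      simp only [QuarterPlane.xy, vx, vy]
      rw [toMeromorphicNFAt_eq_self.2 ha.meromorphicNFAt]
    rw [hK ω hω hω', zero_mul] at h3
    rw [h4, QuarterPlane.liftX, QuarterPlane.liftY, vx, vy]
    linear_combination -h3
  have rx₁ : ∀ ω ∈ QuarterPlane.Δx S z, QuarterPlane.rx S z ω = QuarterPlane.liftX S z ω :=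
    fun ω hω => if_pos hω
  have ry₁ : ∀ ω ∈ QuarterPlane.Δy S z, QuarterPlane.ry S z ω = QuarterPlane.liftY S z ω :=
    fun ω hω => if_pos hω
  have rx₂ : ∀ ω ∈ QuarterPlane.Δy S z, QuarterPlane.rx S z ω = -QuarterPlane.liftY S z ω
      + QuarterPlane.K S z 0 0 * QuarterPlane.Q S z 0 0 + QuarterPlane.xy S z ω := by
    intro ω hω
    by_cases hω' : ω ∈ QuarterPlane.Δx S z
    · rw [rx₁ ω hω']
      linear_combination hfun ω hω' hω
    · exact if_neg hω'
  have ry₂ : ∀ ω ∈ QuarterPlane.Δx S z, QuarterPlane.ry S z ω = -QuarterPlane.liftX S z ω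
      + QuarterPlane.K S z 0 0 * QuarterPlane.Q S z 0 0 + QuarterPlane.xy S z ω := by
    intro ω hω
    by_cases hω' : ω ∈ QuarterPlane.Δy S z
    · rw [ry₁ ω hω']
      linear_combination hfun ω hω hω'
    · exact if_neg hω'
  have mxy : Meromorphic (QuarterPlane.xy S z) := by
    have e : QuarterPlane.xy S z = fun ω => toMeromorphicNFAt (fun ω => f ω * g ω) ω ω := by
      funext ω
      simp only [QuarterPlane.xy, vx, vy]
    rw [e]
    exact QuarterPlane.meromorphic_toMeromorphicNFAt fun ω => (mf ω).mul (mg ω)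
  have mX : ∀ ω ∈ QuarterPlane.Δx S z, MeromorphicAt (QuarterPlane.liftX S z) ω := by
    intro ω hω
    have e : QuarterPlane.liftX S z =
        (fun u => QuarterPlane.K S z u 0 * QuarterPlane.Q S z u 0) ∘ f := by
      funext ω
      simp only [QuarterPlane.liftX, vx, Function.comp]
    rw [e]
    exact ((QuarterPlane.analyticAt_K_mul_Q_left hz hzS (af ω hω).2).comp
      (af ω hω).1).meromorphicAt
  have mY : ∀ ω ∈ QuarterPlane.Δy S z, MeromorphicAt (QuarterPlane.liftY S z) ω := by
    intro ω hω
    have e : QuarterPlane.liftY S z =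
        (fun u => QuarterPlane.K S z 0 u * QuarterPlane.Q S z 0 u) ∘ g := by
      funext ω
      simp only [QuarterPlane.liftY, vy, Function.comp]
    rw [e]
    exact ((QuarterPlane.analyticAt_K_mul_Q_right hz hzS (ag ω hω).2).comp
      (ag ω hω).1).meromorphicAt
  have hcongr : ∀ {F G : ℂ → ℂ} {U : Set ℂ}, IsOpen U → (∀ ω ∈ U, F ω = G ω) → ∀ ω ∈ U,
      MeromorphicAt G ω → MeromorphicAt F ω := fun hU hFG ω hω hG =>
    hG.congr (Filter.mem_of_superset (mem_nhdsWithin_of_mem_nhds (hU.mem_nhds hω))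
      fun ω' h => (hFG ω' h).symm)
  refine ⟨ox.union oy, ?_, fun ω hω => ⟨rx₁ ω hω, ry₂ ω hω⟩, fun ω hω => ⟨ry₁ ω hω, rx₂ ω hω⟩,
    ?_, ?_, ?_⟩
  · rw [hΔ]
    refine QuarterPlane.isSimplyConnected_between (m := fun s => min (c - ℓ s) (c + h - ℓ' s))
      (M := fun s => c + h + ℓ' s) (by fun_prop) (by fun_prop) fun s => ?_
    have h3 := abs_lt.1 (hov s)
    exact (min_le_left _ _).trans_lt (by linarith [hℓ s])
  · rintro ω (hω | hω)
    · exact hcongr ox rx₁ ω hω (mX ω hω)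
    · exact hcongr oy rx₂ ω hω (((mY ω hω).neg.add (MeromorphicAt.const _ _)).add (mxy ω))
  · rintro ω (hω | hω)
    · exact hcongr ox ry₂ ω hω (((mX ω hω).neg.add (MeromorphicAt.const _ _)).add (mxy ω))
    · exact hcongr oy ry₁ ω hω (mY ω hω)
  · rintro ω (hω | hω)
    · rw [rx₁ ω hω, ry₂ ω hω]
      ring
    · rw [ry₁ ω hω, rx₂ ω hω]
      ring
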